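/- Let $M$ be a smooth (Hausdorff) manifold of dimension $n$ with a singular foliation $\mathcal F$, i.e. an involutive, locally finitely generated subsheaf of $C^\infty_M$-modules of the sheaf of smooth vector fields; write $T_xL_x\subset T_xM$ for the space of values at $x$ of sections of $\mathcal F$. *Leafwise paths.* Let $\Gamma_{\mathrm g}(\mathcal F)$ be the diffeological space of germs $[X]_x$ of local sections of $\mathcal F$ at points $x\in M$. The leafwise path category $\mathcal P(\mathcal F)$ has the points of $M$ as objects; its morphisms from $x$ to $y$ are the triples $(\gamma,[X]^{\mathrm g},d)$, where $d\ge 0$ and $t\mapsto(\gamma(t),[X(t)]_{\gamma(t)})$ is a smooth map $[0,\infty)\to\Gamma_{\mathrm g}(\mathcal F)$, constant near $0$ and constant on a neighbourhood of $[d,\infty)$, with the zero germ at time $0$ and at all times $\geq d$, such that these germs are the germs along $\gamma$ of a smooth time-dependent section $X$ (a *lift*) of $\mathcal F$ over an open neighbourhood of the image of $\gamma$, with $\dot\gamma(t)=X(t)(\gamma(t))$, $\gamma(0)=x$ and $\gamma(d)=y$. Composition is concatenation. $\mathcal P(\mathcal F)$ carries the subspace diffeology from $C^\infty([0,\infty),\Gamma_{\mathrm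 g}(\mathcal F))\times[0,\infty)$. Write $\mathrm{Fl}^X_{t,s}$ for the flow of $X$ from time $s$ to time $t$. *Transport and the germinal holonomy groupoid.* An $n$-tuple of first integrals at $x$ is the germ at $x$ of a smooth map $\sigma$ from a neighbourhood of $x$ to $\mathbb R^n$ whose derivative vanishes on $T_zL_z$ for all $z$ in that neighbourhood. The transport $T(\gamma,[X]^{\mathrm g},d)$ sends the germ of $\sigma$ at $x$ to the germ of $\sigma\circ\mathrm{Fl}^X_{0,d}$ at $y$, for any lift $X$. The germinal holonomy groupoid $\mathcal H(\pi^{\mathrm g,\mathcal F}_{M\times\mathbb R^n})$ of the trivial bundle $M\times\mathbb R^n\to M$ is the diffeological quotient of $\mathcal P(\mathcal F)$ that identifies two morphisms with the same source and range iff they have the same transport. *The Garmendia–Villatoro holonomy groupoid.* Fix for each $x\in M$ a slice $S_x$ through $x$: an embedded submanifold containing $x$ with $T_xS_x\cap T_xL_x=0$ and $T_yM=T_yS_x+T_yL_y$ for all $y\in S_x$. Let $I_y$ be the ideal of smooth functions vanishing at $y$. The holonomy of $(\gamma,[X]^{\mathrm g},d)$ is the germ at $x$ of $\mathrm{Fl}^Z_{1,0}\circ\mathrm{Fl}^X_{d,0}|_{S_x}$,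 for a lift $X$ and a $Z\in I_y\mathcal F$ for which this composition maps a neighbourhood of $x$ in $S_x$ onto a neighbourhood of $y$ in $S_y$, taken modulo composition on the left with $\exp(I_y\mathcal F|_{S_y})$, the time-one flows of time-dependent elements of $I_y\mathcal F|_{S_y}$. The Garmendia–Villatoro holonomy groupoid is the diffeological quotient of $\mathcal P(\mathcal F)$ by equality of holonomies. **Theorem.** (1) The transport $T$ is well defined: transporting a germ of an $n$-tuple of first integrals gives a germ of an $n$-tuple of first integrals that depends neither on the lift nor on the representative. Both quotients of $\mathcal P(\mathcal F)$ are groupoids. Transport descends to the Garmendia–Villatoro groupoid, and $\mathcal H(\pi^{\mathrm g,\mathcal F}_{M\times\mathbb R^n})$ is the diffeological quotient of the Garmendia–Villatoro groupoid by the equivalence relation that identifies two elements with the same source and range iff they induce the same transport on $n$-tuples of first integrals: there is a functor $\Pi$ from the Garmendia–Villatoro groupoid to $\mathcal H(\pi^{\mathrm g,\mathcal F}_{M\times\mathbb R^n})$, compatible with the quotient maps from $\mathcal P(\mathcal F)$ and subductive on arrows, with $\Pi(g)=\Pi(h)$ iff $g$ and $h$ induce the same transport. (2) If $\mathcal F$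 is regular of codimension $q\le n$ (i.e. $\dim T_xL_x=n-q$ for all $x$), then two leafwise paths with the same endpoints have the same holonomy iff they have the same transport, and $\Pi$ is an isomorphism of groupoids that is a diffeomorphism on arrows; so the two groupoids coincide. -/

import Mathlib

open scoped Manifold ContDiff Topology NNReal CategoryTheory

noncomputable section

namespace SingFol

open Set Filter TopologicalSpace Diffeology

/-! ### Diffeologies -/

/-- Euclidean space of dimension `k`. -/
abbrev Eu (k : ℕ) := EuclideanSpace ℝ (Fin k)

section Diffeologies

variable {X Y : Type*}

/-- The pullback diffeology along `f`. -/
abbrev pullbackD (f : X → Y) (d : DiffeologicalSpace Y) : DiffeologicalSpace X where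
  plots k := {p | f ∘ p ∈ d.plots k}
  constant_plots x := d.constant_plots (f x)
  plot_reparam hp hg := d.plot_reparam hp hg
  locality {k p} hp := d.locality (p := f ∘ p) fun x => by
    obtain ⟨u, hu, hx, h⟩ := hp x
    exact ⟨u, hu, hx, fun hf hg => h hf hg⟩

/-- The pushforward diffeology along `f`: the smallest diffeology on `Y` containing all
`f ∘ p` with `p` a plot of `X`. -/
abbrev pushforwardD (f : X → Y) (d : DiffeologicalSpace X) : DiffeologicalSpace Y :=
  DiffeologicalSpace.generateFrom {q | ∃ p ∈ d.plots q.1, q.2 = f ∘ p}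

/-- The product diffeology. -/
abbrev prodD (dX : DiffeologicalSpace X) (dY : DiffeologicalSpace Y) :
    DiffeologicalSpace (X × Y) :=
  pullbackD Prod.fst dX ⊓ pullbackD Prod.snd dY

/-- The functional diffeology on the space of smooth maps `X → Y`: `p` is a plot iff
`(u, x) ↦ p u x` is smooth. -/
abbrev functionalD [DiffeologicalSpace X] [DiffeologicalSpace Y] :
    DiffeologicalSpace {f : X → Y // DSmooth f} where
  plots k := {p | ∀ (m : ℕ) (a : Eu m → Eu k) (b : Eu m → X), ContDiff ℝ ∞ a → IsPlot b →
    IsPlot fun v => (p (a v)).1 (b v)}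
  constant_plots f := fun m _ b _ hb => f.2 m b hb
  plot_reparam hp hg := fun m a b ha hb => hp m _ b (hg.comp ha) hb
  locality {k p} hp := fun m a b ha hb => by
    refine DiffeologicalSpace.locality fun v => ?_
    obtain ⟨u, hu, hx, h⟩ := hp (a v)
    refine ⟨a ⁻¹' u, hu.preimage ha.continuous, hx, fun {l g} hg hgs => ?_⟩
    exact h (f := a ∘ g) hg (ha.comp hgs) l id (b ∘ g) contDiff_id (isPlot_reparam hb hgs)

/-- A subduction: a surjection whose target carries the pushforward diffeology. -/
def IsSubduction (dX : DiffeologicalSpace X) (dY : DiffeologicalSpace Y) (f : X → Y) : Prop :=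
  Function.Surjective f ∧ dY = pushforwardD f dX

/-- A diffeomorphism of diffeological spaces: a bijection that is smooth with smooth inverse. -/
def IsDiffeomorphism (dX : DiffeologicalSpace X) (dY : DiffeologicalSpace Y) (f : X → Y) : Prop :=
  ∃ e : X ≃ Y, (∀ x, e x = f x) ∧ @DSmooth X Y dX dY e ∧ @DSmooth Y X dY dX e.symm

/-- The half-line `[0, ∞)` as a diffeological subspace of `ℝ`. -/
instance : DiffeologicalSpace ℝ≥0 := pullbackD ((↑) : ℝ≥0 → ℝ) inferInstance

end Diffeologies

variable {n : ℕ} {M : Type*} [TopologicalSpace M] [ChartedSpace (Eu n) M]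
  [IsManifold (𝓡 n) ∞ M]

/-- The diffeology of a manifold: its plots are the smooth parametrisations. -/
abbrev manifoldD (n : ℕ) (M : Type*) [TopologicalSpace M] [ChartedSpace (Eu n) M] :
    DiffeologicalSpace M :=
  DiffeologicalSpace.generateFrom {q | ContMDiff (𝓡 q.1) (𝓡 n) ∞ q.2}

/-! ### Vector fields and singular foliations -/

/-- (Set-theoretic) vector fields; only the values on an open set under consideration matter. -/
abbrev VF (n : ℕ) (M : Type*) [TopologicalSpace M] [ChartedSpace (Eu n) M] :=
  (x : M) → TangentSpace (𝓡 n) x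

/-- The vector field `X` is smooth on `A`. -/
def SmoothOn (A : Set M) (X : VF n M) : Prop :=
  ContMDiffOn (𝓡 n) (𝓡 n).tangent ∞ (fun x => (⟨x, X x⟩ : TangentBundle (𝓡 n) M)) A

/-- The time-dependent vector field `X` is (jointly) smooth on `A ⊆ ℝ × M`. -/
def SmoothFamilyOn (A : Set (ℝ × M)) (X : ℝ → VF n M) : Prop :=
  ContMDiffOn (𝓘(ℝ, ℝ).prod (𝓡 n)) (𝓡 n).tangent ∞
    (fun q => (⟨q.2, X q.1 q.2⟩ : TangentBundle (𝓡 n) M)) A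

/-- A singular foliation: a subsheaf `O ↦ sec O` of modules over smooth functions of the sheaf of
smooth vector fields, which is involutive and locally finitely generated. -/
structure SingularFoliation (n : ℕ) (M : Type*) [TopologicalSpace M] [ChartedSpace (Eu n) M]
    [IsManifold (𝓡 n) ∞ M] where
  /-- The sections over an open set. -/
  sec : Opens M → Set (VF n M)
  smooth : ∀ {O X}, X ∈ sec O → SmoothOn (O : Set M) X
  congr : ∀ {O X Y}, X ∈ sec O → (∀ x ∈ O, X x = Y x) → Y ∈ sec O
  restrict : ∀ {O V X}, V ≤ O → X ∈ sec O → X ∈ sec V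
  glue : ∀ {O X}, (∀ x ∈ O, ∃ V : Opens M, x ∈ V ∧ V ≤ O ∧ X ∈ sec V) → X ∈ sec O
  zero_mem : ∀ O : Opens M, (fun _ => 0) ∈ sec O
  add_mem : ∀ {O X Y}, X ∈ sec O → Y ∈ sec O → (fun x => X x + Y x) ∈ sec O
  smul_mem : ∀ {O : Opens M} {X} {f : M → ℝ}, ContMDiffOn (𝓡 n) 𝓘(ℝ, ℝ) ∞ f O → X ∈ sec O →
    (fun x => f x • X x) ∈ sec O
  lie_mem : ∀ {O X Y}, X ∈ sec O → Y ∈ sec O → VectorField.mlieBracket (𝓡 n) X Y ∈ sec O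
  locally_fg : ∀ x : M, ∃ O : Opens M, x ∈ O ∧ ∃ (k : ℕ) (G : Fin k → VF n M),
    (∀ i, G i ∈ sec O) ∧ ∀ Y ∈ sec O, ∃ f : Fin k → M → ℝ,
      (∀ i, ContMDiffOn (𝓡 n) 𝓘(ℝ, ℝ) ∞ (f i) O) ∧ ∀ z ∈ O, Y z = ∑ i, f i z • G i z

namespace SingularFoliation

variable (F : SingularFoliation n M)

/-- The tangent space at `x` of the leaf through `x`: all values at `x` of sections of `F`. -/
def leafTangent (x : M) : Submodule ℝ (TangentSpace (𝓡 n) x) where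
  carrier := {v | ∃ (O : Opens M) (X : VF n M), x ∈ O ∧ X ∈ F.sec O ∧ X x = v}
  zero_mem' := ⟨⊤, fun _ => 0, trivial, F.zero_mem ⊤, rfl⟩
  add_mem' := by
    rintro _ _ ⟨O, X, hx, hX, rfl⟩ ⟨O', X', hx', hX', rfl⟩
    exact ⟨O ⊓ O', _, ⟨hx, hx'⟩,
      F.add_mem (F.restrict inf_le_left hX) (F.restrict inf_le_right hX'), rfl⟩
  smul_mem' := by
    rintro a _ ⟨O, X, hx, hX, rfl⟩
    exact ⟨O, _, hx, F.smul_mem (f := fun _ => a) contMDiffOn_const hX, rfl⟩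

/-- `F` is regular of codimension `q`: all leaves have codimension `q`. -/
def IsRegular (q : ℕ) : Prop :=
  ∀ x : M, Module.finrank ℝ (F.leafTangent x) + q = n

/-- Membership in `(I_y F)(O)`, where `I_y` is the ideal of functions vanishing at `y`. -/
def VanishingSec (y : M) (O : Opens M) (Z : VF n M) : Prop :=
  ∃ (k : ℕ) (f : Fin k → M → ℝ) (X : Fin k → VF n M),
    (∀ i, ContMDiffOn (𝓡 n) 𝓘(ℝ, ℝ) ∞ (f i) O ∧ f i y = 0 ∧ X i ∈ F.sec O) ∧
      ∀ z ∈ O, Z z = ∑ i, f i z • X i z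

/-! ### The pseudo-bundle of germs of `F` -/

/-- Local sections of `F` (extended by zero outside of their domain). -/
structure LocalSection where
  dom : Opens M
  field : VF n M
  mem : field ∈ F.sec dom
  off : ∀ x ∉ dom, field x = 0

/-- The functional diffeology on local sections. It is generated by the parametrisations that are
locally, in parameter and in space, jointly smooth; these already form a diffeology. -/
instance : DiffeologicalSpace F.LocalSection :=
  DiffeologicalSpace.generateFrom {q | ∀ (u₀ : Eu q.1) (x₀ : M), x₀ ∈ (q.2 u₀).dom →
    ∃ (V : Set (Eu q.1)) (O : Set M), IsOpen V ∧ u₀ ∈ V ∧ IsOpen O ∧ x₀ ∈ O ∧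
      (∀ u ∈ V, O ⊆ (q.2 u).dom) ∧
      ContMDiffOn ((𝓡 q.1).prod (𝓡 n)) (𝓡 n).tangent ∞
        (fun w : Eu q.1 × M => (⟨w.2, (q.2 w.1).field w.2⟩ : TangentBundle (𝓡 n) M)) (V ×ˢ O)}

/-- Pairs `(x, σ)` of a local section and a point of its domain. -/
def PointedSection := {q : M × F.LocalSection // q.1 ∈ q.2.dom}

instance : DiffeologicalSpace F.PointedSection :=
  pullbackD Subtype.val (prodD (manifoldD n M) inferInstance)

/-- Equality of base points and of germs. -/
instance germSetoid : Setoid F.PointedSection where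
  r a b := a.1.1 = b.1.1 ∧ ∀ᶠ z in 𝓝 a.1.1, a.1.2.field z = b.1.2.field z
  iseqv := by
    refine ⟨fun a => ⟨rfl, .of_forall fun _ => rfl⟩, fun {a b} h => ⟨h.1.symm, ?_⟩,
      fun {a b c} h h' => ⟨h.1.trans h'.1, ?_⟩⟩
    · rw [← h.1]; exact h.2.mono fun _ hz => hz.symm
    · filter_upwards [h.2, h.1 ▸ h'.2] with z h1 h2 using h1.trans h2

/-- The pseudo-bundle `Γ_g(F)` of germs of sections of `F`. -/
def GermSpace := Quotient F.germSetoid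

instance : DiffeologicalSpace F.GermSpace :=
  pushforwardD (Quotient.mk F.germSetoid) inferInstance

/-- The projection `Γ_g(F) → M`. -/
def base : F.GermSpace → M := Quotient.lift (fun a => a.1.1) fun _ _ h => h.1

open Classical in
/-- The point of `Γ_g(F)` given by the germ at `x ∈ O` of `X ∈ F(O)`. -/
def germ (O : Opens M) (X : VF n M) (hX : X ∈ F.sec O) (x : M) (hx : x ∈ O) : F.GermSpace :=
  Quotient.mk F.germSetoid ⟨(x, ⟨O, fun z => if z ∈ O then X z else 0,
    F.congr hX fun z hz => by simp [hz], fun z hz => by simp [hz]⟩), hx⟩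

/-- The zero germ at `x`. -/
def zeroGerm (x : M) : F.GermSpace := F.germ ⊤ (fun _ => 0) (F.zero_mem ⊤) x trivial

@[simp] lemma base_germ (O : Opens M) (X : VF n M) (hX : X ∈ F.sec O) (x : M) (hx : x ∈ O) :
    F.base (F.germ O X hX x hx) = x := rfl

@[simp] lemma base_zeroGerm (x : M) : F.base (F.zeroGerm x) = x := rfl

lemma germ_eq_germ {O O' : Opens M} {X X' : VF n M} {hX : X ∈ F.sec O} {hX' : X' ∈ F.sec O'}
    {x : M} {hx : x ∈ O} {hx' : x ∈ O'} :
    F.germ O X hX x hx = F.germ O' X' hX' x hx' ↔ ∀ᶠ z in 𝓝 x, X z = X' z := by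
  classical
  have hO : ∀ᶠ z in 𝓝 x, z ∈ O := O.isOpen.mem_nhds hx
  have hO' : ∀ᶠ z in 𝓝 x, z ∈ O' := O'.isOpen.mem_nhds hx'
  constructor
  · intro h
    have h2 := (Quotient.exact h).2
    filter_upwards [h2, hO, hO'] with z hz h1 h1'
    simpa [h1, h1'] using hz
  · intro h
    refine Quotient.sound ⟨rfl, ?_⟩
    filter_upwards [h, hO, hO'] with z hz h1 h1'
    simpa [h1, h1'] using hz

/-! ### Leafwise paths -/

/-- `X` is a time-dependent section of `F` over a fixed open neighbourhood `O` of the base path of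
`c : [0, ∞) → Γ_g(F)`, smooth in time and space, whose germs along the base path are `c`, of which
the base path is an integral curve, and whose germs vanish at time `0` and from time `d` on. -/
structure IsLift (c : ℝ≥0 → F.GermSpace) (d : ℝ≥0) (O : Opens M) (X : ℝ → VF n M) : Prop where
  mem : ∀ t : ℝ≥0, X t ∈ F.sec O
  smooth : SmoothFamilyOn (Ici (0 : ℝ) ×ˢ (O : Set M)) X
  base_mem : ∀ t, F.base (c t) ∈ O
  base_smooth : ContMDiffOn 𝓘(ℝ, ℝ) (𝓡 n) ∞ (fun s : ℝ => F.base (c s.toNNReal)) (Ici 0)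
  germ_eq : ∀ t : ℝ≥0, c t = F.germ O (X t) (mem t) (F.base (c t)) (base_mem t)
  velocity : ∀ t : ℝ, 0 ≤ t →
    HasMFDerivWithinAt 𝓘(ℝ, ℝ) (𝓡 n) (fun s : ℝ => F.base (c s.toNNReal)) (Ici 0) t
      ((1 : ℝ →L[ℝ] ℝ).smulRight (X t (F.base (c t.toNNReal))))
  germ_start : c 0 = F.zeroGerm (F.base (c 0))
  germ_end : ∀ t, d ≤ t → c t = F.zeroGerm (F.base (c t))

/-- The morphisms of the leafwise path category of `F`. -/
@[ext]
structure LeafPath where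
  toFun : ℝ≥0 → F.GermSpace
  dur : ℝ≥0
  dsmooth : DSmooth toFun
  const_start : ∃ ε > 0, ∀ t < ε, toFun t = toFun 0
  const_end : ∃ ε > 0, ∀ t, dur < t + ε → toFun t = toFun dur
  exists_lift : ∃ O X, F.IsLift toFun dur O X

namespace LeafPath

variable {F}

/-- The source of a leafwise path. -/
def src (p : F.LeafPath) : M := F.base (p.toFun 0)

/-- The range of a leafwise path. -/
def tgt (p : F.LeafPath) : M := F.base (p.toFun p.dur)

end LeafPath

/-- The diffeology of the leafwise path category, as a subspace of
`C^∞([0, ∞), Γ_g(F)) × [0, ∞)`. -/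
instance : DiffeologicalSpace F.LeafPath :=
  pullbackD (fun p => ((⟨p.toFun, p.dsmooth⟩ : {f : ℝ≥0 → F.GermSpace // DSmooth f}), p.dur))
    (prodD functionalD inferInstance)

variable {F}

lemma IsLift.dsmooth {c : ℝ≥0 → F.GermSpace} {d : ℝ≥0} {O : Opens M} {X : ℝ → VF n M}
    (h : F.IsLift c d O X) : DSmooth c := by
  classical
  intro k b hb
  have hb' : ContDiff ℝ ∞ (fun v => (b v : ℝ)) := isPlot_iff_contDiff.1 hb
  apply DiffeologicalSpace.isPlot_generatedFrom_of_mem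
  refine ⟨fun v => ⟨(F.base (c (b v)), ⟨O, fun z => if z ∈ O then X (b v) z else 0,
    F.congr (h.mem (b v)) fun z hz => by simp [hz], fun z hz => by simp [hz]⟩),
    h.base_mem (b v)⟩, ?_, funext fun v => h.germ_eq (b v)⟩
  refine (DiffeologicalSpace.isPlot_inf_iff).2 ⟨?_, ?_⟩
  · apply DiffeologicalSpace.isPlot_generatedFrom_of_mem
    have h1 : ContMDiff (𝓡 k) 𝓘(ℝ, ℝ) ∞ (fun v => (b v : ℝ)) := hb'.contMDiff
    have h2 := h.base_smooth.comp_contMDiff h1 (fun v => (b v).2)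
    refine h2.congr fun v => ?_
    change F.base (c (b v)) = F.base (c (b v : ℝ).toNNReal)
    rw [Real.toNNReal_coe]
  · apply DiffeologicalSpace.isPlot_generatedFrom_of_mem
    intro u₀ x₀ hx₀
    refine ⟨univ, O, isOpen_univ, trivial, O.isOpen, hx₀, fun u _ => le_rfl, ?_⟩
    have h1 : ContMDiff ((𝓡 k).prod (𝓡 n)) (𝓘(ℝ, ℝ).prod (𝓡 n)) ∞
        (fun w : Eu k × M => ((b w.1 : ℝ), w.2)) :=
      (hb'.contMDiff.comp contMDiff_fst).prodMk contMDiff_snd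
    have h2 := h.smooth.comp (h1.contMDiffOn (s := univ ×ˢ (O : Set M)))
      (fun w hw => ⟨(b w.1).2, hw.2⟩)
    refine h2.congr fun w hw => ?_
    exact congrArg (fun y => (⟨w.2, y⟩ : TangentBundle (𝓡 n) M)) (if_pos hw.2)

lemma exists_cutoff [T2Space M] {K : Set M} (hK : IsCompact K) {O : Set M} (hO : IsOpen O)
    (hKO : K ⊆ O) : ∃ χ : M → ℝ, ContMDiff (𝓡 n) 𝓘(ℝ, ℝ) ∞ χ ∧ (∀ x ∈ K, ∀ᶠ z in 𝓝 x, χ z = 1) ∧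
      tsupport χ ⊆ O := by
  refine hK.induction_on (p := fun K => ∃ χ : M → ℝ, ContMDiff (𝓡 n) 𝓘(ℝ, ℝ) ∞ χ ∧
    (∀ x ∈ K, ∀ᶠ z in 𝓝 x, χ z = 1) ∧ tsupport χ ⊆ O) ?_ ?_ ?_ ?_
  · exact ⟨fun _ => 0, contMDiff_const, by simp, by simp [tsupport]⟩
  · rintro s t hst ⟨χ, h1, h2, h3⟩
    exact ⟨χ, h1, fun x hx => h2 x (hst hx), h3⟩
  · rintro s t ⟨χ, h1, h2, h3⟩ ⟨χ', h1', h2', h3'⟩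
    refine ⟨fun z => 1 - (1 - χ z) * (1 - χ' z), ?_, ?_, ?_⟩
    · exact contMDiff_const.sub ((contMDiff_const.sub h1).mul (contMDiff_const.sub h1'))
    · rintro x (hx | hx)
      · filter_upwards [h2 x hx] with z hz; simp [hz]
      · filter_upwards [h2' x hx] with z hz; simp [hz]
    · refine (closure_minimal ?_ ((isClosed_tsupport χ).union (isClosed_tsupport χ'))).trans
        (union_subset h3 h3')
      intro z hz
      by_contra hcon
      rw [mem_union, not_or] at hcon
      have e1 := image_eq_zero_of_notMem_tsupport hcon.1
      have e2 := image_eq_zero_of_notMem_tsupport hcon.2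
      apply hz
      simp [e1, e2]
  · intro x hx
    obtain ⟨f, -, hf⟩ := (SmoothBumpFunction.nhds_basis_tsupport (I := 𝓡 n) x).mem_iff.1
      (hO.mem_nhds (hKO hx))
    obtain ⟨U, hU, hUo, hxU⟩ := mem_nhds_iff.1 f.eventuallyEq_one
    refine ⟨U, mem_nhdsWithin_of_mem_nhds (hUo.mem_nhds hxU), f, f.contMDiff, fun y hy => ?_, hf⟩
    filter_upwards [hUo.mem_nhds hy] with z hz using hU hz

lemma smoothFamilyOn_smul {A : Set (ℝ × M)} {X : ℝ → VF n M} (hX : SmoothFamilyOn A X)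
    {f : ℝ × M → ℝ} (hf : ContMDiffOn (𝓘(ℝ, ℝ).prod (𝓡 n)) 𝓘(ℝ, ℝ) ∞ f A) :
    SmoothFamilyOn A (fun t x => f (t, x) • X t x) := by
  intro q hq
  have h := hX q hq
  rw [Bundle.contMDiffWithinAt_totalSpace] at h ⊢
  refine ⟨h.1, ?_⟩
  have h2 := (hf q hq).smul h.2
  refine h2.congr_of_eventuallyEq ?_ ?_
  · have hb : ∀ᶠ w in 𝓝[A] q, w.2 ∈ (trivializationAt (Eu n) (TangentSpace (𝓡 n)) q.2).baseSet :=
      mem_nhdsWithin_of_mem_nhds (continuous_snd.continuousAt.preimage_mem_nhds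
        ((trivializationAt (Eu n) (TangentSpace (𝓡 n)) q.2).open_baseSet.mem_nhds
          (FiberBundle.mem_baseSet_trivializationAt' q.2)))
    filter_upwards [hb] with w hw
    exact ((trivializationAt (Eu n) (TangentSpace (𝓡 n)) q.2).linear ℝ hw).map_smul _ _
  · exact ((trivializationAt (Eu n) (TangentSpace (𝓡 n)) q.2).linear ℝ
      (FiberBundle.mem_baseSet_trivializationAt' q.2)).map_smul _ _

lemma smoothFamilyOn_zero (A : Set (ℝ × M)) : SmoothFamilyOn A (fun _ _ => 0 : ℝ → VF n M) :=
  ((Bundle.contMDiff_zeroSection ℝ (TangentSpace (𝓡 n) : M → Type _)).comp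
    contMDiff_snd).contMDiffOn

/-- A lift that is globally defined, smooth for all times, and zero near the ends. -/
structure IsGoodLift (p : F.LeafPath) (X : ℝ → VF n M) : Prop where
  mem : ∀ t : ℝ≥0, X t ∈ F.sec ⊤
  smooth : SmoothFamilyOn univ X
  base_smooth : ContMDiff 𝓘(ℝ, ℝ) (𝓡 n) ∞ (fun s : ℝ => F.base (p.toFun s.toNNReal))
  germ_eq : ∀ t : ℝ≥0, p.toFun t = F.germ ⊤ (X t) (mem t) (F.base (p.toFun t)) trivial
  velocity : ∀ t : ℝ,
    HasMFDerivAt 𝓘(ℝ, ℝ) (𝓡 n) (fun s : ℝ => F.base (p.toFun s.toNNReal)) t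
      ((1 : ℝ →L[ℝ] ℝ).smulRight (X t (F.base (p.toFun t.toNNReal))))
  germ_start : p.toFun 0 = F.zeroGerm p.src
  germ_end : ∀ t, p.dur ≤ t → p.toFun t = F.zeroGerm p.tgt
  zero_start : ∃ ε > 0, ∀ t < ε, X t = fun _ => 0
  zero_end : ∃ ε > 0, ∀ t, (p.dur : ℝ) < t + ε → X t = fun _ => 0
  const_end : ∃ ε > 0, ∀ t : ℝ≥0, (p.dur : ℝ) < t + ε → p.toFun t = F.zeroGerm p.tgt

lemma LeafPath.exists_goodLift [T2Space M] (p : F.LeafPath) : ∃ X, IsGoodLift p X := by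
  obtain ⟨O, X, h⟩ := p.exists_lift
  obtain ⟨ε₁, hε₁, hs⟩ := p.const_start
  obtain ⟨ε₂, hε₂, he⟩ := p.const_end
  obtain ⟨ε, hε, h1, h2⟩ : ∃ ε : ℝ, 0 < ε ∧ ε ≤ ε₁ ∧ ε ≤ ε₂ :=
    ⟨min ε₁ ε₂, lt_min hε₁ hε₂, min_le_left _ _, min_le_right _ _⟩
  set γ : ℝ → M := fun s => F.base (p.toFun s.toNNReal) with hγ
  have hstart : p.toFun 0 = F.zeroGerm p.src := h.germ_start
  have hend : p.toFun p.dur = F.zeroGerm p.tgt := h.germ_end _ le_rfl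
  have hs' : ∀ t : ℝ, t < ε → p.toFun t.toNNReal = F.zeroGerm p.src := by
    intro t ht
    rw [← hstart]
    apply hs
    rw [← NNReal.coe_lt_coe, Real.coe_toNNReal']
    exact max_lt (ht.trans_le h1) hε₁
  have he' : ∀ t : ℝ≥0, (p.dur : ℝ) < t + ε → p.toFun t = F.zeroGerm p.tgt := by
    intro t ht
    rw [← hend]
    apply he
    rw [← NNReal.coe_lt_coe, NNReal.coe_add]
    linarith
  have hcont : ContinuousOn γ (Icc 0 p.dur) :=
    h.base_smooth.continuousOn.mono fun t ht => ht.1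
  have hK : IsCompact (γ '' Icc 0 p.dur) := isCompact_Icc.image_of_continuousOn hcont
  have hKO : γ '' Icc 0 p.dur ⊆ O := by
    rintro _ ⟨t, -, rfl⟩
    exact h.base_mem _
  have hmemK : ∀ t : ℝ≥0, F.base (p.toFun t) ∈ γ '' Icc 0 p.dur := by
    intro t
    by_cases ht : t ≤ p.dur
    · exact ⟨t, ⟨t.2, ht⟩, by simp [hγ]⟩
    · refine ⟨p.dur, ⟨p.dur.2, le_rfl⟩, ?_⟩
      have : (p.dur : ℝ) < t + ε := by
        have : (p.dur : ℝ) < t := by exact_mod_cast not_le.1 ht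
        linarith
      rw [he' t this, hγ]
      simp [hend]
  obtain ⟨χ, hχs, hχ1, hχO⟩ := exists_cutoff (n := n) hK O.isOpen hKO
  set β : ℝ → ℝ := fun t => Real.smoothTransition ((t - ε / 3) / (ε / 3)) *
    Real.smoothTransition ((p.dur - ε / 3 - t) / (ε / 3)) with hβ
  have hβs : ContDiff ℝ ∞ β := by
    refine (Real.smoothTransition.contDiff.comp ?_).mul (Real.smoothTransition.contDiff.comp ?_)
    · exact (contDiff_id.sub contDiff_const).div_const _
    · exact (contDiff_const.sub contDiff_id).div_const _
  have hβ0 : ∀ t ≤ ε / 3, β t = 0 := by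
    intro t ht
    simp only [hβ]
    rw [Real.smoothTransition.zero_of_nonpos (div_nonpos_of_nonpos_of_nonneg (by linarith)
      (by linarith)), zero_mul]
  have hβ0' : ∀ t, p.dur - ε / 3 ≤ t → β t = 0 := by
    intro t ht
    simp only [hβ]
    rw [Real.smoothTransition.zero_of_nonpos (x := (p.dur - ε / 3 - t) / (ε / 3))
      (div_nonpos_of_nonpos_of_nonneg (by linarith) (by linarith)), mul_zero]
  have hβ1 : ∀ t, ε ≤ t → t ≤ p.dur - ε → β t = 1 := by
    intro t ht ht'
    simp only [hβ]
    rw [Real.smoothTransition.one_of_one_le, Real.smoothTransition.one_of_one_le, mul_one]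
    · rw [le_div_iff₀ (by linarith)]; linarith
    · rw [le_div_iff₀ (by linarith)]; linarith
  set X' : ℝ → VF n M := fun t x => (β t * χ x) • X t x with hX'
  have hzero : ∀ t, β t = 0 → X' t = fun _ => 0 := by
    intro t ht
    funext x
    simp [hX', ht]
  have hoff : ∀ t x, x ∉ tsupport χ → X' t x = 0 := by
    intro t x hx
    simp [hX', image_eq_zero_of_notMem_tsupport hx]
  have hev : ∀ t : ℝ≥0, ∀ᶠ z in 𝓝 (F.base (p.toFun t)), X t z = X' t z := by
    intro t
    have hz : p.toFun t = F.zeroGerm (F.base (p.toFun t)) →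
        ∀ᶠ z in 𝓝 (F.base (p.toFun t)), X t z = X' t z := by
      intro hz
      have := F.germ_eq_germ.1 ((h.germ_eq t).symm.trans hz)
      filter_upwards [this] with z hz
      simp [hX', hz]
    by_cases h3 : (t : ℝ) < ε
    · apply hz
      have := hs' t h3
      rw [Real.toNNReal_coe] at this
      rw [this]
      rfl
    by_cases h4 : (p.dur : ℝ) < t + ε
    · apply hz
      rw [he' t h4]
      rfl
    filter_upwards [hχ1 _ (hmemK t)] with z hz
    simp [hX', hz, hβ1 t (by linarith) (by linarith)]
  have hev' : ∀ t : ℝ, 0 ≤ t → X t (γ t) = X' t (γ t) := by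
    intro t h0
    have e := (hev t.toNNReal).self_of_nhds
    rw [Real.coe_toNNReal t h0] at e
    exact e
  have hX'mem : ∀ t : ℝ≥0, X' t ∈ F.sec ⊤ := by
    intro t
    apply F.glue
    intro x _
    by_cases hx : x ∈ O
    · exact ⟨O, hx, le_top, F.smul_mem (contMDiff_const.mul hχs).contMDiffOn (h.mem t)⟩
    · refine ⟨⟨(tsupport χ)ᶜ, (isClosed_tsupport χ).isOpen_compl⟩, fun hx' => hx (hχO hx'), le_top,
        F.congr (F.zero_mem _) fun z hz => (hoff t z hz).symm⟩
  have hloc : ∀ (A : Set ℝ) (B : Set M), IsOpen A → IsOpen B → (∀ t ∈ A, ∀ x ∈ B, X' t x = 0) →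
      ∀ q ∈ A ×ˢ B, ContMDiffAt (𝓘(ℝ, ℝ).prod (𝓡 n)) (𝓡 n).tangent ∞
        (fun q : ℝ × M => (⟨q.2, X' q.1 q.2⟩ : TangentBundle (𝓡 n) M)) q := by
    intro A B hA hB h0 q hq
    have hz := (smoothFamilyOn_zero (n := n) (univ : Set (ℝ × M))) q trivial
    rw [contMDiffWithinAt_univ] at hz
    refine hz.congr_of_eventuallyEq ?_
    filter_upwards [(hA.prod hB).mem_nhds hq] with w hw
    rw [h0 _ hw.1 _ hw.2]
  have hsm : SmoothFamilyOn univ X' := by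
    rintro ⟨t, x⟩ -
    rw [contMDiffWithinAt_univ]
    by_cases ht : t < ε / 3
    · exact hloc (Iio (ε / 3)) univ isOpen_Iio isOpen_univ
        (fun t ht x _ => by rw [hzero t (hβ0 t (le_of_lt ht))]) _ ⟨ht, trivial⟩
    by_cases hx : x ∈ O
    · have hf : ContMDiff (𝓘(ℝ, ℝ).prod (𝓡 n)) 𝓘(ℝ, ℝ) ∞ (fun q : ℝ × M => β q.1 * χ q.2) :=
        (hβs.contMDiff.comp contMDiff_fst).mul (hχs.comp contMDiff_snd)
      have := (smoothFamilyOn_smul h.smooth hf.contMDiffOn) (t, x) ⟨by simp; linarith, hx⟩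
      refine this.contMDiffAt ?_
      refine prod_mem_nhds (Ici_mem_nhds (by linarith)) (O.isOpen.mem_nhds hx)
    · exact hloc univ (tsupport χ)ᶜ isOpen_univ (isClosed_tsupport χ).isOpen_compl
        (fun t _ x hx => hoff t x hx) _ ⟨trivial, fun hx' => hx (hχO hx')⟩
  have hγc : ∀ t < ε, γ =ᶠ[𝓝 t] fun _ => p.src := by
    intro t ht
    filter_upwards [Iio_mem_nhds ht] with s hs
    simp [hγ, hs' s hs]
  refine ⟨X', hX'mem, hsm, ?_, ?_, ?_, hstart, ?_, ⟨ε / 3, by linarith, ?_⟩,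
    ⟨ε / 3, by linarith, ?_⟩, ⟨ε, hε, he'⟩⟩
  · intro t
    by_cases ht : t < ε
    · exact contMDiffAt_const.congr_of_eventuallyEq (hγc t ht)
    · exact (h.base_smooth t (by simp; linarith)).contMDiffAt (Ici_mem_nhds (by linarith))
  · intro t
    exact (h.germ_eq t).trans (F.germ_eq_germ.2 (hev t))
  · intro t
    by_cases ht : t < ε
    · have h0 : X' t (γ t) = 0 := by
        by_cases h0 : 0 ≤ t
        · have e1 := F.germ_eq_germ.1 ((h.germ_eq t.toNNReal).symm.trans
            (show _ = F.zeroGerm (F.base (p.toFun t.toNNReal)) by rw [hs' t ht]; rfl))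
          have e2 := e1.self_of_nhds
          rw [Real.coe_toNNReal t h0] at e2
          rw [← hev' t h0]
          exact e2
        · rw [hzero t (hβ0 t (by linarith))]
      have := (hasMFDerivAt_const (I := 𝓘(ℝ, ℝ)) (I' := 𝓡 n) p.src t).congr_of_eventuallyEq
        (hγc t ht)
      rw [show X' t (F.base (p.toFun t.toNNReal)) = 0 from h0, ContinuousLinearMap.smulRight_zero]
      exact this
    · have h0 : 0 ≤ t := by linarith
      have := (h.velocity t h0).hasMFDerivAt (Ici_mem_nhds (by linarith))
      rw [← show X t (F.base (p.toFun t.toNNReal)) = X' t (F.base (p.toFun t.toNNReal)) from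
        hev' t h0]
      exact this
  · intro t ht
    rw [← hend]
    apply he
    exact lt_of_le_of_lt ht (lt_add_of_pos_right t hε₂)
  · intro t ht
    exact hzero t (hβ0 t ht.le)
  · intro t ht
    exact hzero t (hβ0' t (by linarith))

/-- Concatenation of two paths, the first one being followed up to time `d`. -/
def concatFun (c₁ c₂ : ℝ≥0 → F.GermSpace) (d : ℝ≥0) : ℝ≥0 → F.GermSpace :=
  fun t => if t ≤ d then c₁ t else c₂ (t - d)

lemma exists_lift_concat [T2Space M] (p q : F.LeafPath) (hpq : p.tgt = q.src) :
    ∃ O X, F.IsLift (concatFun p.toFun q.toFun p.dur) (p.dur + q.dur) O X := by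
  obtain ⟨X, hX⟩ := p.exists_goodLift
  obtain ⟨Y, hY⟩ := q.exists_goodLift
  obtain ⟨ε₁, hε₁, hXe⟩ := hX.zero_end
  obtain ⟨ε₂, hε₂, hce⟩ := hX.const_end
  obtain ⟨ε₃, hε₃, hYs⟩ := hY.zero_start
  obtain ⟨ε, hε, h1, h2⟩ : ∃ ε : ℝ, 0 < ε ∧ ε ≤ ε₁ ∧ ε ≤ ε₂ :=
    ⟨min ε₁ ε₂, lt_min hε₁ hε₂, min_le_left _ _, min_le_right _ _⟩
  set d := p.dur with hd
  set c := concatFun p.toFun q.toFun d with hc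
  set W : ℝ → VF n M := fun t => if t ≤ d then X t else Y (t - d) with hW
  have hc1 : ∀ s : ℝ, s ≤ d → c s.toNNReal = p.toFun s.toNNReal := by
    intro s hs
    have : s.toNNReal ≤ d := by rwa [Real.toNNReal_le_iff_le_coe]
    simp [hc, concatFun, this]
  have hc2 : ∀ s : ℝ, d < s + ε → c s.toNNReal = q.toFun (s - d).toNNReal := by
    intro s hs
    by_cases hsd : s ≤ d
    · rw [hc1 s hsd, Real.toNNReal_of_nonpos (sub_nonpos.2 hsd), hY.germ_start, ← hpq]
      apply hce
      rw [Real.coe_toNNReal']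
      have := le_max_left s 0
      linarith
    · have h3 : ¬ s.toNNReal ≤ d := by
        rw [Real.toNNReal_le_iff_le_coe]; exact hsd
      simp only [hc, concatFun, if_neg h3]
      congr 1
      rw [NNReal.sub_def, Real.coe_toNNReal s (by have := d.2; linarith [not_le.1 hsd])]
  have hW1 : ∀ s : ℝ, s ≤ d → W s = X s := fun s hs => by simp [hW, hs]
  have hW2 : ∀ s : ℝ, d < s + ε → W s = Y (s - d) := by
    intro s hs
    by_cases hsd : s ≤ d
    · rw [hW1 s hsd, hXe s (by linarith), hYs (s - d) (by linarith)]
    · simp [hW, hsd]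
  have hγ1 : ∀ s : ℝ, s < d → (fun s : ℝ => F.base (c s.toNNReal)) =ᶠ[𝓝 s]
      fun s => F.base (p.toFun s.toNNReal) := by
    intro s hs
    filter_upwards [Iio_mem_nhds hs] with r hr
    rw [hc1 r (le_of_lt hr)]
  have hγ2 : ∀ s : ℝ, d < s + ε → (fun s : ℝ => F.base (c s.toNNReal)) =ᶠ[𝓝 s]
      (fun s => F.base (q.toFun s.toNNReal)) ∘ fun s => s - d := by
    intro s hs
    filter_upwards [Ioi_mem_nhds (show (d : ℝ) - ε < s by linarith)] with r hr
    rw [hc2 r (by simpa [sub_lt_iff_lt_add] using hr)]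
    rfl
  have hmem : ∀ t : ℝ≥0, W t ∈ F.sec ⊤ := by
    intro t
    by_cases ht : (t : ℝ) ≤ d
    · rw [hW1 _ ht]; exact hX.mem t
    · have := hY.mem (t - d)
      rw [NNReal.coe_sub (by exact_mod_cast (not_le.1 ht).le)] at this
      rw [hW2 _ (by linarith)]
      exact this
  refine ⟨⊤, W, hmem, ?_, fun _ => trivial, ?_, ?_, ?_, ?_, ?_⟩
  · rintro ⟨t, x⟩ -
    apply ContMDiffAt.contMDiffWithinAt
    by_cases ht : t < d
    · have := hX.smooth (t, x) trivial
      rw [contMDiffWithinAt_univ] at this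
      refine this.congr_of_eventuallyEq ?_
      filter_upwards [(isOpen_Iio.prod isOpen_univ).mem_nhds
        (show (t, x) ∈ Iio (d : ℝ) ×ˢ (univ : Set M) from ⟨ht, trivial⟩)] with w hw
      rw [hW1 w.1 (le_of_lt hw.1)]
    · have h3 := hY.smooth (t - d, x) trivial
      rw [contMDiffWithinAt_univ] at h3
      have h4 : ContMDiff (𝓘(ℝ, ℝ).prod (𝓡 n)) (𝓘(ℝ, ℝ).prod (𝓡 n)) ∞
          (fun w : ℝ × M => (w.1 - (d : ℝ), w.2)) :=
        (contMDiff_fst.sub contMDiff_const).prodMk contMDiff_snd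
      have h5 := ContMDiffAt.comp (t, x) h3 h4.contMDiffAt
      refine h5.congr_of_eventuallyEq ?_
      filter_upwards [(isOpen_Ioi.prod isOpen_univ).mem_nhds
        (show (t, x) ∈ Ioi ((d : ℝ) - ε) ×ˢ (univ : Set M) from
          ⟨by simp only [mem_Ioi]; linarith, trivial⟩)] with w hw
      rw [hW2 w.1 (by have := hw.1; simp only [mem_Ioi] at this; linarith)]
      rfl
  · intro t _
    apply ContMDiffAt.contMDiffWithinAt
    by_cases ht : t < d
    · exact hX.base_smooth.contMDiffAt.congr_of_eventuallyEq (hγ1 t ht)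
    · refine ContMDiffAt.congr_of_eventuallyEq ?_ (hγ2 t (by linarith))
      exact (hY.base_smooth.comp (contMDiff_id.sub contMDiff_const)).contMDiffAt
  · intro t
    by_cases ht : (t : ℝ) ≤ d
    · have e := hc1 t ht
      rw [Real.toNNReal_coe] at e
      have e2 := hX.germ_eq t
      rw [← e] at e2
      refine e2.trans (F.germ_eq_germ.2 (.of_forall fun z => ?_))
      rw [hW1 _ ht]
    · have e := hc2 t (by linarith)
      rw [Real.toNNReal_coe] at e
      have e2 := hY.germ_eq ((t : ℝ) - d).toNNReal
      rw [← e] at e2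
      refine e2.trans (F.germ_eq_germ.2 (.of_forall fun z => ?_))
      rw [hW2 _ (by linarith), Real.coe_toNNReal _ (by linarith)]
  · intro t ht0
    apply HasMFDerivAt.hasMFDerivWithinAt
    by_cases ht : t < d
    · have := (hX.velocity t).congr_of_eventuallyEq (hγ1 t ht)
      rw [← hc1 t ht.le] at this
      rw [hW1 t ht.le]
      exact this
    · have hs : HasMFDerivAt 𝓘(ℝ, ℝ) 𝓘(ℝ, ℝ) (fun s : ℝ => s - d) t (ContinuousLinearMap.id ℝ ℝ) :=
        ((hasFDerivAt_id t).sub_const (d : ℝ)).hasMFDerivAt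
      have h3 := (HasMFDerivAt.comp t (hY.velocity (t - d)) hs).congr_of_eventuallyEq
        (hγ2 t (by linarith))
      rw [← hc2 t (by linarith)] at h3
      rw [hW2 t (by linarith)]
      exact h3
  · have e := hc1 0 d.2
    rw [Real.toNNReal_zero] at e
    rw [e, hX.germ_start]
    rfl
  · intro t ht
    have htd : d ≤ t := le_trans (le_add_of_nonneg_right (zero_le)) ht
    have htd' : (d : ℝ) ≤ t := by exact_mod_cast htd
    have e := hc2 t (by linarith)
    rw [Real.toNNReal_coe] at e
    rw [e, hY.germ_end]
    · rfl
    · rw [← NNReal.coe_le_coe, Real.coe_toNNReal _ (by linarith)]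
      have : ((d + q.dur : ℝ≥0) : ℝ) ≤ t := by exact_mod_cast ht
      push_cast at this
      linarith

namespace LeafPath

lemma toFun_of_dur_le (p : F.LeafPath) {t : ℝ≥0} (ht : p.dur ≤ t) : p.toFun t = p.toFun p.dur := by
  obtain ⟨ε, hε, h⟩ := p.const_end
  exact h t (lt_of_le_of_lt ht (lt_add_of_pos_right t hε))

lemma toFun_dur (p : F.LeafPath) : p.toFun p.dur = F.zeroGerm p.tgt := by
  obtain ⟨O, X, h⟩ := p.exists_lift
  exact h.germ_end _ le_rfl

lemma toFun_zero (p : F.LeafPath) : p.toFun 0 = F.zeroGerm p.src := by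
  obtain ⟨O, X, h⟩ := p.exists_lift
  exact h.germ_start

/-- The constant path at `x`, of duration zero. -/
def const (x : M) : F.LeafPath where
  toFun _ := F.zeroGerm x
  dur := 0
  dsmooth := dSmooth_const
  const_start := ⟨1, one_pos, fun _ _ => rfl⟩
  const_end := ⟨1, one_pos, fun _ _ => rfl⟩
  exists_lift := ⟨⊤, fun _ _ => 0, fun _ => F.zero_mem ⊤, smoothFamilyOn_zero _, fun _ => trivial,
    contMDiffOn_const, fun _ => rfl, fun t _ => by
      rw [ContinuousLinearMap.smulRight_zero]
      exact hasMFDerivWithinAt_const _ _ _, rfl, fun _ _ => rfl⟩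

/-- The concatenation: first `p`, then `q`. -/
def concat [T2Space M] (p q : F.LeafPath) (h : p.tgt = q.src) : F.LeafPath where
  toFun := concatFun p.toFun q.toFun p.dur
  dur := p.dur + q.dur
  dsmooth := by
    obtain ⟨O, X, hX⟩ := exists_lift_concat p q h
    exact hX.dsmooth
  const_start := by
    obtain ⟨ε, hε, hp⟩ := p.const_start
    obtain ⟨ε', hε', hq⟩ := q.const_start
    refine ⟨min ε ε', lt_min hε hε', fun t ht => ?_⟩
    have h1 := hp t (lt_of_lt_of_le ht (min_le_left _ _))
    simp only [concatFun, zero_le, if_true]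
    split_ifs with htd
    · exact h1
    · rw [hq (t - p.dur) (lt_of_le_of_lt tsub_le_self (lt_of_lt_of_le ht (min_le_right _ _))),
        q.toFun_zero, ← h, ← p.toFun_dur, ← p.toFun_of_dur_le (not_le.1 htd).le, h1]
  const_end := by
    obtain ⟨ε, hε, hp⟩ := p.const_end
    obtain ⟨ε', hε', hq⟩ := q.const_end
    have hend : concatFun p.toFun q.toFun p.dur (p.dur + q.dur) = q.toFun q.dur := by
      simp only [concatFun]
      split_ifs with hd
      · have h0 : q.dur = 0 := by simpa using hd
        rw [h0, add_zero, q.toFun_zero, p.toFun_dur, h]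
      · rw [add_tsub_cancel_left]
    refine ⟨min ε ε', lt_min hε hε', fun t ht => ?_⟩
    rw [hend]
    have hm1 : p.dur + q.dur < t + ε := lt_of_lt_of_le ht (by gcongr; exact min_le_left _ _)
    have hm2 : p.dur + q.dur < t + ε' := lt_of_lt_of_le ht (by gcongr; exact min_le_right _ _)
    simp only [concatFun]
    split_ifs with htd
    · rw [hp t (lt_of_le_of_lt (le_add_of_nonneg_right (zero_le)) hm1), p.toFun_dur, h,
        ← q.toFun_zero]
      apply hq 0
      rw [zero_add]
      have : p.dur + q.dur < p.dur + ε' := lt_of_lt_of_le hm2 (by gcongr)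
      exact lt_of_add_lt_add_left this
    · apply hq
      have e : t = p.dur + (t - p.dur) := (add_tsub_cancel_of_le (not_le.1 htd).le).symm
      rw [e, add_assoc] at hm2
      exact lt_of_add_lt_add_left hm2
  exists_lift := exists_lift_concat p q h

@[simp] lemma src_const (x : M) : (const x : F.LeafPath).src = x := rfl

@[simp] lemma tgt_const (x : M) : (const x : F.LeafPath).tgt = x := rfl

lemma concat_apply [T2Space M] (p q : F.LeafPath) (h : p.tgt = q.src) (t : ℝ≥0) :
    (p.concat q h).toFun t = if t ≤ p.dur then p.toFun t else q.toFun (t - p.dur) := rfl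

lemma concat_apply_of_le [T2Space M] (p q : F.LeafPath) (h : p.tgt = q.src) {t : ℝ≥0}
    (ht : p.dur ≤ t) : (p.concat q h).toFun t = q.toFun (t - p.dur) := by
  rw [concat_apply]
  split_ifs with h1
  · have : t = p.dur := le_antisymm h1 ht
    rw [this, tsub_self, q.toFun_zero, p.toFun_dur, h]
  · rfl

@[simp] lemma src_concat [T2Space M] (p q : F.LeafPath) (h : p.tgt = q.src) :
    (p.concat q h).src = p.src := by
  simp [src, concat_apply]

@[simp] lemma tgt_concat [T2Space M] (p q : F.LeafPath) (h : p.tgt = q.src) :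
    (p.concat q h).tgt = q.tgt := by
  have : (p.concat q h).toFun (p.dur + q.dur) = q.toFun q.dur := by
    rw [concat_apply_of_le _ _ _ (le_add_of_nonneg_right (zero_le)), add_tsub_cancel_left]
  exact congrArg F.base this

end LeafPath

/-- The objects of the leafwise path category: the points of `M`. -/
@[ext]
structure PathCat (F : SingularFoliation n M) where
  pt : M

/-- The leafwise path category of `F`. Composition is concatenation. -/
instance [T2Space M] : CategoryTheory.Category F.PathCat where
  Hom x y := {p : F.LeafPath // p.src = x.pt ∧ p.tgt = y.pt}
  id x := ⟨LeafPath.const x.pt, rfl, rfl⟩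
  comp p q := ⟨p.1.concat q.1 (p.2.2.trans q.2.1.symm), by simp [p.2.1], by simp [q.2.2]⟩
  id_comp p := by
    apply Subtype.ext
    refine LeafPath.ext (funext fun t => ?_) (zero_add _)
    rw [LeafPath.concat_apply_of_le _ _ _ (zero_le)]
    exact congrArg p.1.toFun (tsub_zero t)
  comp_id p := by
    apply Subtype.ext
    refine LeafPath.ext (funext fun t => ?_) (add_zero _)
    rw [LeafPath.concat_apply]
    split_ifs with h
    · rfl
    · rw [p.1.toFun_of_dur_le (not_le.1 h).le, p.1.toFun_dur, p.2.2]
      rfl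
  assoc p q r := by
    apply Subtype.ext
    refine LeafPath.ext (funext fun t => ?_) (add_assoc _ _ _)
    have hd : (p.1.concat q.1 (p.2.2.trans q.2.1.symm)).dur = p.1.dur + q.1.dur := rfl
    by_cases h1 : t ≤ p.1.dur
    · rw [LeafPath.concat_apply, LeafPath.concat_apply, if_pos h1, LeafPath.concat_apply,
        if_pos h1, if_pos (by rw [hd]; exact h1.trans (le_add_of_nonneg_right (zero_le)))]
    · rw [LeafPath.concat_apply, LeafPath.concat_apply, if_neg h1, LeafPath.concat_apply,
        if_neg h1, LeafPath.concat_apply, hd, tsub_add_eq_tsub_tsub]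
      have : t ≤ p.1.dur + q.1.dur ↔ t - p.1.dur ≤ q.1.dur := tsub_le_iff_left.symm
      simp only [this]

/-! ### Flows -/

/-- `c` is an integral curve inside `A` of the time-dependent vector field `X` over the (unordered)
time interval between `a` and `b`. -/
def IsFlowLine (A : Set M) (X : ℝ → VF n M) (a b : ℝ) (c : ℝ → M) : Prop :=
  ∀ t ∈ uIcc a b, c t ∈ A ∧ HasMFDerivWithinAt 𝓘(ℝ, ℝ) (𝓡 n) c (uIcc a b) t
    ((1 : ℝ →L[ℝ] ℝ).smulRight (X t (c t)))

open Classical in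
/-- The flow `Fl^X_{t, t₀}` from time `t₀` to time `t` of a time-dependent vector field `X` on `A`.
The value is only meaningful where the integral curve exists. -/
def flow (A : Set M) (X : ℝ → VF n M) (t t₀ : ℝ) (y : M) : M :=
  if h : ∃ c, IsFlowLine A X t₀ t c ∧ c t₀ = y then h.choose t else y

/-! ### First integrals and the germinal holonomy groupoid of `M × ℝⁿ → M` -/

variable (F)

/-- `f` is, on a neighbourhood of `x`, an `n`-tuple of first integrals of `F`, that is to say an
`F`-invariant local section of the trivial bundle `M × ℝⁿ → M`. -/
def IsFirstIntegralAt (x : M) (f : M → Eu n) : Prop :=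
  ∃ O : Opens M, x ∈ O ∧ ContMDiffOn (𝓡 n) 𝓘(ℝ, Eu n) ∞ f O ∧
    ∀ z ∈ O, ∀ v ∈ F.leafTangent z, mfderiv (𝓡 n) 𝓘(ℝ, Eu n) f z v = 0

/-- The fibre at `x` of the pseudo-bundle of germs of `F`-invariant sections of `M × ℝⁿ → M`. -/
def InvGerm (x : M) : Type _ :=
  {g : Filter.Germ (𝓝 x) (Eu n) // ∃ f : M → Eu n, F.IsFirstIntegralAt x f ∧
    (f : Filter.Germ (𝓝 x) (Eu n)) = g}

instance (x : M) : Nonempty (F.InvGerm x) :=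
  ⟨⟨((fun _ => 0 : M → Eu n) : Filter.Germ (𝓝 x) (Eu n)), _,
    ⟨⊤, trivial, contMDiffOn_const, fun z _ v _ => by rw [mfderiv_const]; rfl⟩, rfl⟩⟩

variable {F}

section Groupoids

variable [T2Space M]

/-- The germ `g` is obtained by transporting the germ `f` of a first integral along `p`: it is the
germ of `σ ∘ Fl^X_{0, d}` for a representative `σ` of `f` and a lift `X` of `p` (on the trivial
bundle the lifted flow does not move the fibre coordinate). -/
def IsTransport {x y : F.PathCat} (p : x ⟶ y) (f : F.InvGerm x.pt) (g : F.InvGerm y.pt) : Prop :=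
  ∃ (O : Opens M) (X : ℝ → VF n M) (σ : M → Eu n), F.IsLift p.1.toFun p.1.dur O X ∧
    f.1 = (σ : Filter.Germ (𝓝 x.pt) (Eu n)) ∧
    g.1 = ((σ ∘ flow (O : Set M) X 0 p.1.dur : M → Eu n) : Filter.Germ (𝓝 y.pt) (Eu n))

/-- The germinal transport functor of `M × ℝⁿ → M` on morphisms. -/
def transport {x y : F.PathCat} (p : x ⟶ y) (f : F.InvGerm x.pt) : F.InvGerm y.pt :=
  Classical.epsilon (IsTransport p f)

variable (F) in
/-- Two leafwise paths are related if they induce the same transport. -/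
def transportRel : HomRel F.PathCat := fun _ _ p q => transport p = transport q

variable (F) in
/-- The germinal holonomy groupoid of the trivial bundle `M × ℝⁿ → M`. -/
abbrev HolonomyGroupoid := CategoryTheory.Quotient F.transportRel

end Groupoids

/-! ### Slices and the Garmendia–Villatoro holonomy groupoid -/

/-- `S` is an embedded submanifold: of one dimension `k`, and linear in suitable charts of `M`
around each of its points. -/
def IsEmbedded (n : ℕ) {M : Type*} [TopologicalSpace M] [ChartedSpace (Eu n) M]
    (S : Set M) : Prop :=
  ∃ k : ℕ, ∀ y ∈ S, ∃ e ∈ IsManifold.maximalAtlas (𝓡 n) ∞ M, y ∈ e.source ∧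
    ∃ V : Submodule ℝ (Eu n), Module.finrank ℝ V = k ∧ ∀ z ∈ e.source, z ∈ S ↔ e z ∈ V

/-- `v` is tangent to `S` at `y`: it is the velocity of a smooth curve in `S`. -/
def IsTangent (S : Set M) (y : M) (v : TangentSpace (𝓡 n) y) : Prop :=
  ∃ c : ℝ → M, ∃ ε > 0, ContMDiffOn 𝓘(ℝ, ℝ) (𝓡 n) ∞ c (Ioo (-ε) ε) ∧
    (∀ t ∈ Ioo (-ε) ε, c t ∈ S) ∧ ∃ h : c 0 = y,
    HasMFDerivAt 𝓘(ℝ, ℝ) (𝓡 n) c 0 ((1 : ℝ →L[ℝ] ℝ).smulRight (h ▸ v : TangentSpace (𝓡 n) (c 0)))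

variable (F) in
/-- A slice through `x`. -/
structure Slice (x : M) where
  carrier : Set M
  mem : x ∈ carrier
  embedded : IsEmbedded n carrier
  inter : ∀ v, IsTangent carrier x v → v ∈ F.leafTangent x → v = 0
  span : ∀ y ∈ carrier, ∀ w : TangentSpace (𝓡 n) y, ∃ v, IsTangent carrier y v ∧
    ∃ u ∈ F.leafTangent y, w = v + u

variable (F) in
/-- `ψ` represents an element of `exp (I_y F|_S)`: it is the time-one flow of a time-dependent
vector field on a neighbourhood of `y` in `S`, smooth in time and space, that lies at every time in
the span of restrictions to `S` of sections of `F` tangent to `S`, with coefficients vanishing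
at `y`. -/
def IsExp (S : Set M) (y : M) (ψ : M → M) : Prop :=
  ∃ (O : Opens M) (W : ℝ → VF n M), y ∈ O ∧
    SmoothFamilyOn (Icc (0 : ℝ) 1 ×ˢ (S ∩ (O : Set M))) W ∧
    (∀ t ∈ Icc (0 : ℝ) 1, ∃ (k : ℕ) (f : Fin k → M → ℝ) (X : Fin k → VF n M),
      (∀ i, ContMDiffOn (𝓡 n) 𝓘(ℝ, ℝ) ∞ (f i) O ∧ f i y = 0 ∧ X i ∈ F.sec O ∧
        ∀ z ∈ S ∩ (O : Set M), IsTangent S z (X i z)) ∧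
      ∀ z ∈ S ∩ (O : Set M), W t z = ∑ i, f i z • X i z) ∧
    ψ = flow (S ∩ (O : Set M)) W 1 0

section Groupoids

variable [T2Space M]

/-- `h` represents the holonomy of the leafwise path `p` as a germ of maps `S_x → S_y`: it is
`Fl^Z_{1,0} ∘ Fl^X_{d,0}` for a lift `X` of `p` and some `Z ∈ I_y F` such that this
composition maps a neighbourhood of `x` in `S_x` onto a neighbourhood of `y` in `S_y`. -/
def IsHolGerm (S : ∀ x, F.Slice x) {x y : F.PathCat} (p : x ⟶ y) (h : M → M) : Prop :=
  ∃ (O : Opens M) (X : ℝ → VF n M) (O' : Opens M) (Z : VF n M),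
    F.IsLift p.1.toFun p.1.dur O X ∧ y.pt ∈ O' ∧ F.VanishingSec y.pt O' Z ∧
    h = flow (O' : Set M) (fun _ => Z) 1 0 ∘ flow (O : Set M) X p.1.dur 0 ∧
    Filter.map h (𝓝[(S x.pt).carrier] x.pt) = 𝓝[(S y.pt).carrier] y.pt

variable (F) in
/-- Two leafwise paths have the same holonomy transformation: their holonomies agree as germs of
maps `S_x → S_y` up to an element of `exp (I_y F|_{S_y})`. -/
def HolRel (S : ∀ x, F.Slice x) : HomRel F.PathCat := fun x y p q =>
  ∃ h h' ψ : M → M, IsHolGerm S p h ∧ IsHolGerm S q h' ∧ F.IsExp (S y.pt).carrier y.pt ψ ∧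
    h =ᶠ[𝓝[(S x.pt).carrier] x.pt] ψ ∘ h'

variable (F) in
/-- The Garmendia–Villatoro holonomy groupoid: the quotient of the leafwise path category by the
fibres of the holonomy map (which are a congruence). -/
abbrev GVGroupoid (S : ∀ x, F.Slice x) := CategoryTheory.Quotient (F.HolRel S)

end Groupoids

/-! ### Spaces of arrows -/

/-- The space of all arrows of a category. -/
def Arr (C : Type*) [CategoryTheory.Category C] := Σ X Y : C, X ⟶ Y

/-- The map on arrows induced by a functor. -/
def arrMap {C D : Type*} [CategoryTheory.Category C] [CategoryTheory.Category D]
    (Φ : CategoryTheory.Functor C D) : Arr C → Arr D := fun a => ⟨_, _, Φ.map a.2.2⟩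

/-- The quotient map from leafwise paths to the arrows of a quotient of the path category. -/
def arrMk [T2Space M] (r : HomRel F.PathCat) (p : F.LeafPath) : Arr (CategoryTheory.Quotient r) :=
  ⟨_, _, (CategoryTheory.Quotient.functor r).map
    (⟨p, rfl, rfl⟩ : (⟨p.src⟩ : F.PathCat) ⟶ ⟨p.tgt⟩)⟩

/-- The quotient diffeology on the arrows of a quotient of the path category. -/
abbrev arrD [T2Space M] (r : HomRel F.PathCat) :
    DiffeologicalSpace (Arr (CategoryTheory.Quotient r)) :=
  pushforwardD (arrMk r) inferInstance

end SingularFoliation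

end SingFol

end

open SingFol SingFol.SingularFoliation

set_option linter.unusedSectionVars false

noncomputable section

namespace SingFol

open Set Filter TopologicalSpace

/-! ### The inverse function theorem -/

/-! The local picture behind everything is an adapted chart (`IsAdapted`). Near a point `p` there
are coordinates with values in a sum `V ⊕ H`, where `H` is the tangent space of the leaf at `p`. All
leaves contain the directions of `H`, and along the plaque `H` through `p` they contain no others.
Such a chart arises by flowing the points of a transversal `V` along combinations of local
generators. Involutivity turns the variation of these flows into a linear differential equation in
the span of the generators, which therefore contains the `H`-directions and does not grow in
dimension along flow lines (`exists_straightening`). This needs flows that depend smoothly on the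
initial value and satisfy the variational equation; they come from the inverse function theorem in
the Banach space of continuous curves on a compact interval (`exists_smooth_flow`).

Two facts in an adapted chart carry part (1). First integrals do not depend on the coordinates in
`H`. By a Gronwall estimate for the transverse coordinate, flow lines of sections do not leave the
central plaque. Hence flows of sections preserve the tangent spaces of leaves, so that transported
first integrals are again first integrals. Moreover, for two leafwise fields with the same base
path, the set of times at which the transported germs agree is open and closed; transport thus
depends on the base path only (`IsLeafField.comp_flow_eventuallyEq`). Functoriality follows, and
following a path and then its reverse gives a flow that fixes every point, which makes both
quotients groupoids.

Transport descends to holonomy because the two ambiguities in a holonomy germ, the flow of `Z ∈ I_y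
F` and an element of `exp (I_y F|_S)`, are flows along leaves of fields that vanish at `y`. Near `y`
their flow lines stay in the domain of a given first integral, which is constant along them. If `τ`
is the transport of `σ` and `h` the holonomy, then `τ ∘ h = σ` near `x`. As `h` covers a
neighbourhood of `y` in the slice, the holonomy determines `τ` on the slice, and then near `y`,
since in an adapted chart every nearby point has the same value as its projection to the slice
(`HolRel.transport_eq`). The projection of groupoids is now the induced map of quotients of one path
space, and it is a subduction because pushforwards of diffeologies compose.

In the regular case all leaves in an adapted chart are parallel to `H`, so the projection `π ∘ e` to
`V` is itself a tuple of first integrals; it takes its values in `V ⊆ ℝⁿ`. A suitable `Z` pushes the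
image of one slice along the plaques into the other, so that the holonomy is represented by `e⁻¹ ∘ π
∘ e` applied to the flow (`IsLift.exists_holonomy`). The transport of first integrals determines `π
∘ e` of the flow, hence the holonomy (`IsRegular.holRel_iff`). The projection is then injective, and
an injective subduction is a diffeomorphism. -/

theorem exists_smooth_localInverse {E F : Type*} [NormedAddCommGroup E] [NormedSpace ℝ E]
    [CompleteSpace E] [NormedAddCommGroup F] [NormedSpace ℝ F] {f : E → F} {Ω : Set E}
    (hΩ : IsOpen Ω) (hf : ContDiffOn ℝ ∞ f Ω) {x₀ : E} (hx₀ : x₀ ∈ Ω) (f' : E ≃L[ℝ] F)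
    (hf' : HasFDerivAt f (f' : E →L[ℝ] F) x₀) :
    ∃ e : OpenPartialHomeomorph E F, x₀ ∈ e.source ∧ e.source ⊆ Ω ∧ (∀ x, e x = f x) ∧
      ContDiffOn ℝ ∞ e.symm e.target := by
  have hat : ∀ x ∈ Ω, ContDiffAt ℝ ∞ f x := fun x hx => hf.contDiffAt (hΩ.mem_nhds hx)
  set e₀ := ContDiffAt.toOpenPartialHomeomorph f (hat x₀ hx₀) hf' (by simp) with he₀
  have hcoe : ∀ x, e₀ x = f x := fun x => by
    rw [he₀, ContDiffAt.toOpenPartialHomeomorph_coe]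
  have hcont : ContinuousOn (fderiv ℝ f) Ω :=
    (hf.fderiv_of_isOpen hΩ (m := ∞) (by simp)).continuousOn
  -- Invertible operators form an open set. On the part of the source where the derivative is
  -- invertible, the inverse is smooth at every image point and not only at `f x₀`.
  set W : Set E := Ω ∩ fderiv ℝ f ⁻¹' range ((↑) : (E ≃L[ℝ] F) → E →L[ℝ] F) with hW
  have hWo : IsOpen W := hcont.isOpen_inter_preimage hΩ ContinuousLinearEquiv.isOpen
  have hxW : x₀ ∈ W := ⟨hx₀, ⟨f', hf'.fderiv.symm⟩⟩
  have hs : (e₀.restrOpen W hWo).source = e₀.source ∩ W := rfl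
  refine ⟨e₀.restrOpen W hWo, ?_, ?_, hcoe, ?_⟩
  · rw [hs]
    exact ⟨ContDiffAt.mem_toOpenPartialHomeomorph_source _ _ _, hxW⟩
  · rw [hs]
    exact fun x hx => hx.2.1
  · intro y hy
    have h1 := (e₀.restrOpen W hWo).map_target hy
    rw [hs] at h1
    obtain ⟨f₁, hf₁⟩ := h1.2.2
    refine (OpenPartialHomeomorph.contDiffAt_symm (f₀' := f₁) (e₀.restrOpen W hWo) hy ?_
      (hat _ h1.2.1)).contDiffWithinAt
    rw [hf₁]
    exact ((hat _ h1.2.1).differentiableAt (by simp)).hasFDerivAt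

/-! ### Superposition operators -/

section Superposition

variable {E F : Type} [NormedAddCommGroup E] [NormedSpace ℝ E] [NormedAddCommGroup F]
  [NormedSpace ℝ F] {a b : ℝ}

/-- Pointwise evaluation of a continuous family of operators on a continuous curve. -/
def pointwiseApply (a b : ℝ) (E F : Type) [NormedAddCommGroup E] [NormedSpace ℝ E]
    [NormedAddCommGroup F] [NormedSpace ℝ F] :
    C(Icc a b, E →L[ℝ] F) →L[ℝ] C(Icc a b, E) →L[ℝ] C(Icc a b, F) :=
  LinearMap.mkContinuous₂
    (LinearMap.mk₂ ℝ (fun (A : C(Icc a b, E →L[ℝ] F)) (β : C(Icc a b, E)) =>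
        (⟨fun t => A t (β t), A.continuous.clm_apply β.continuous⟩ : C(Icc a b, F)))
      (fun _ _ _ => rfl) (fun _ _ _ => rfl)
      (fun A _ _ => ContinuousMap.ext fun t => (A t).map_add _ _)
      (fun c A _ => ContinuousMap.ext fun t => (A t).map_smul c _)) 1 (by
    intro A β
    rw [one_mul, ContinuousMap.norm_le _ (by positivity)]
    intro t
    exact ((A t).le_opNorm _).trans (mul_le_mul (A.norm_coe_le_norm t) (β.norm_coe_le_norm t)
      (norm_nonneg _) ((norm_nonneg _).trans (A.norm_coe_le_norm t))))

@[simp] lemma pointwiseApply_apply (A : C(Icc a b, E →L[ℝ] F)) (β : C(Icc a b, E)) (t : Icc a b) :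
    pointwiseApply a b E F A β t = A t (β t) := rfl

/-- The superposition operator `α ↦ (t ↦ v (t, α t))`. -/
def superposition (v : ℝ × E → F) (hv : ContinuousOn v (Icc a b ×ˢ univ)) (α : C(Icc a b, E)) :
    C(Icc a b, F) :=
  ⟨fun t => v (t, α t), hv.comp_continuous (by fun_prop) fun t => ⟨t.2, trivial⟩⟩

/-- The derivative of `v` in the second variable, with time confined to `[a, b]`. -/
def partialDeriv (a b : ℝ) (v : ℝ × E → F) (q : ℝ × E) : E →L[ℝ] F :=
  (fderivWithin ℝ v (Icc a b ×ˢ univ) q).comp (ContinuousLinearMap.inr ℝ ℝ E)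

lemma uniqueDiffOn_Icc_prod_univ (hab : a < b) : UniqueDiffOn ℝ (Icc a b ×ˢ (univ : Set E)) :=
  (uniqueDiffOn_Icc hab).prod uniqueDiffOn_univ

lemma contDiffOn_partialDeriv (hab : a < b) {v : ℝ × E → F}
    (hv : ContDiffOn ℝ ∞ v (Icc a b ×ˢ univ)) :
    ContDiffOn ℝ ∞ (partialDeriv a b v) (Icc a b ×ˢ univ) :=
  (hv.fderivWithin (uniqueDiffOn_Icc_prod_univ hab) (m := ∞) (by simp)).clm_comp contDiffOn_const

lemma hasFDerivAt_partialDeriv {v : ℝ × E → F} (hv : ContDiffOn ℝ ∞ v (Icc a b ×ˢ univ)) {t : ℝ}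
    (ht : t ∈ Icc a b) (x : E) :
    HasFDerivAt (fun y => v (t, y)) (partialDeriv a b v (t, x)) x := by
  have h1 : HasFDerivWithinAt v (fderivWithin ℝ v (Icc a b ×ˢ univ) (t, x)) (Icc a b ×ˢ univ)
      (t, x) := ((hv.differentiableOn (by simp)) _ ⟨ht, trivial⟩).hasFDerivWithinAt
  have h2 : HasFDerivAt (fun y : E => (t, y)) (ContinuousLinearMap.inr ℝ ℝ E) x :=
    hasFDerivAt_prodMk_right t x
  rw [← hasFDerivWithinAt_univ] at h2 ⊢
  exact HasFDerivWithinAt.comp (g := v) x h1 h2 fun y _ => ⟨ht, trivial⟩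

/-- The mean value inequality at each fixed `t` bounds the remainder by the oscillation of the
partial derivative. The oscillation is small uniformly in `t`, because all the points involved lie
in the compact set `[a, b] × B(0, ‖α‖ + 1)`, on which the partial derivative is uniformly
continuous. -/
lemma hasFDerivAt_superposition [FiniteDimensional ℝ E] (hab : a < b) {v : ℝ × E → F}
    (hv : ContDiffOn ℝ ∞ v (Icc a b ×ˢ univ)) (α : C(Icc a b, E)) :
    HasFDerivAt (superposition v hv.continuousOn)
      (pointwiseApply a b E F
        (superposition (partialDeriv a b v) (contDiffOn_partialDeriv hab hv).continuousOn α)) α := by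
  rw [hasFDerivAt_iff_isLittleO_nhds_zero, Asymptotics.isLittleO_iff]
  intro c hc
  set K : Set (ℝ × E) := Icc a b ×ˢ Metric.closedBall 0 (‖α‖ + 1)
  have hK : IsCompact K := isCompact_Icc.prod (isCompact_closedBall _ _)
  have huc : UniformContinuousOn (partialDeriv a b v) K :=
    hK.uniformContinuousOn_of_continuous ((contDiffOn_partialDeriv hab hv).continuousOn.mono
      (prod_mono le_rfl (subset_univ _)))
  rw [Metric.uniformContinuousOn_iff] at huc
  obtain ⟨δ, hδ, hd⟩ := huc c hc
  filter_upwards [Metric.ball_mem_nhds (0 : C(Icc a b, E)) (lt_min hδ one_pos)] with β hβ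
  rw [mem_ball_zero_iff] at hβ
  rw [ContinuousMap.norm_le _ (by positivity)]
  intro t
  have hβt : ‖β t‖ ≤ ‖β‖ := β.norm_coe_le_norm t
  have key : ∀ y ∈ Metric.ball (α t) (min δ 1),
      ‖partialDeriv a b v (t, y) - partialDeriv a b v (t, α t)‖ ≤ c := by
    intro y hy
    rw [Metric.mem_ball] at hy
    have h1 : (↑t, y) ∈ K := by
      refine ⟨t.2, ?_⟩
      rw [mem_closedBall_zero_iff]
      have h3 : ‖y‖ ≤ ‖α t‖ + dist y (α t) := by
        rw [dist_eq_norm]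
        calc ‖y‖ = ‖α t + (y - α t)‖ := by congr 1; abel
          _ ≤ _ := norm_add_le _ _
      have := α.norm_coe_le_norm t
      have := min_le_right δ 1
      linarith
    have h2 : (↑t, α t) ∈ K := by
      refine ⟨t.2, ?_⟩
      rw [mem_closedBall_zero_iff]
      have := α.norm_coe_le_norm t
      linarith
    have h3 := hd _ h1 _ h2 (by
      rw [Prod.dist_eq, dist_self]
      exact max_lt hδ (hy.trans_le (min_le_left _ _)))
    rw [dist_eq_norm] at h3
    exact h3.le
  have h4 := Convex.norm_image_sub_le_of_norm_hasFDerivWithin_le'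
    (f := fun y => v (t, y)) (f' := fun y => partialDeriv a b v (t, y))
    (φ := partialDeriv a b v (t, α t)) (C := c) (x := α t) (y := α t + β t)
    (fun y _ => (hasFDerivAt_partialDeriv hv t.2 y).hasFDerivWithinAt) key (convex_ball _ _)
    (Metric.mem_ball_self (lt_min hδ one_pos)) (by
      rw [Metric.mem_ball, dist_eq_norm, add_sub_cancel_left]; exact hβt.trans_lt hβ)
  rw [add_sub_cancel_left] at h4
  exact h4.trans (mul_le_mul_of_nonneg_left hβt hc.le)

/-- The derivative is again a superposition operator, namely that of the partial derivative of `v`,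
followed by the continuous linear map `pointwiseApply`. This allows induction on the order of
differentiability, with the target space varying. -/
theorem contDiff_superposition [FiniteDimensional ℝ E] (hab : a < b) {v : ℝ × E → F}
    (hv : ContDiffOn ℝ ∞ v (Icc a b ×ˢ univ)) :
    ContDiff ℝ ∞ (superposition v hv.continuousOn) := by
  rw [contDiff_infty]
  intro m
  induction m generalizing F with
  | zero =>
    exact contDiff_zero.2 (continuous_iff_continuousAt.2 fun α =>
      (hasFDerivAt_superposition hab hv α).continuousAt)
  | succ m ih =>
    refine contDiff_succ_iff_hasFDerivAt.2 ⟨_, ?_, hasFDerivAt_superposition hab hv⟩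
    exact (ContinuousLinearMap.contDiff (E := C(Icc a b, E →L[ℝ] F))
      (F := C(Icc a b, E) →L[ℝ] C(Icc a b, F)) (pointwiseApply a b E F)).comp (ih (contDiffOn_partialDeriv hab hv))

end Superposition

/-! ### Volterra operators -/

section Volterra

variable {E : Type} [NormedAddCommGroup E] [NormedSpace ℝ E] [CompleteSpace E] {a b : ℝ}

/-- A continuous curve on `[a, b]`, extended to the real line by constants. -/
def extendCurve (hab : a ≤ b) (β : C(Icc a b, E)) : ℝ → E := IccExtend hab β

lemma continuous_extendCurve (hab : a ≤ b) (β : C(Icc a b, E)) : Continuous (extendCurve hab β) :=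
  β.continuous.Icc_extend'

lemma extendCurve_of_mem (hab : a ≤ b) (β : C(Icc a b, E)) {t : ℝ} (ht : t ∈ Icc a b) :
    extendCurve hab β t = β ⟨t, ht⟩ := IccExtend_of_mem hab β ht

lemma norm_extendCurve_le (hab : a ≤ b) (β : C(Icc a b, E)) (t : ℝ) :
    ‖extendCurve hab β t‖ ≤ ‖β‖ := β.norm_coe_le_norm _

/-- The primitive vanishing at `t₀`. -/
def primitive (hab : a ≤ b) (t₀ : Icc a b) : C(Icc a b, E) →L[ℝ] C(Icc a b, E) :=
  LinearMap.mkContinuous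
    { toFun := fun β => ⟨fun t => ∫ s in (t₀ : ℝ)..t, extendCurve hab β s,
        (intervalIntegral.continuous_primitive
          (fun _ _ => (continuous_extendCurve hab β).intervalIntegrable _ _) _).comp
          continuous_subtype_val⟩
      map_add' := fun β β' => ContinuousMap.ext fun t => by
        change (∫ s in (t₀ : ℝ)..t, extendCurve hab (β + β') s) = _
        rw [show extendCurve hab (β + β') = fun s => extendCurve hab β s + extendCurve hab β' s
          from rfl, intervalIntegral.integral_add
          ((continuous_extendCurve hab β).intervalIntegrable _ _)
          ((continuous_extendCurve hab β').intervalIntegrable _ _)]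
        rfl
      map_smul' := fun c β => ContinuousMap.ext fun t => by
        change (∫ s in (t₀ : ℝ)..t, extendCurve hab (c • β) s) = _
        rw [show extendCurve hab (c • β) = fun s => c • extendCurve hab β s from rfl,
          intervalIntegral.integral_smul]
        rfl } (b - a) (by
    intro β
    rw [ContinuousMap.norm_le _ (mul_nonneg (sub_nonneg.2 hab) (norm_nonneg _))]
    intro t
    refine (intervalIntegral.norm_integral_le_of_norm_le_const
      (fun s _ => norm_extendCurve_le hab β s)).trans ?_
    rw [mul_comm]
    refine mul_le_mul_of_nonneg_right ?_ (norm_nonneg _)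
    rw [abs_le]
    constructor <;> linarith [t.2.1, t.2.2, t₀.2.1, t₀.2.2])

lemma primitive_apply (hab : a ≤ b) (t₀ : Icc a b) (β : C(Icc a b, E)) (t : Icc a b) :
    primitive hab t₀ β t = ∫ s in (t₀ : ℝ)..t, extendCurve hab β s := rfl

lemma hasDerivWithinAt_primitive (hab : a ≤ b) (t₀ : Icc a b) (β : C(Icc a b, E)) {t : ℝ}
    (ht : t ∈ Icc a b) : HasDerivWithinAt (extendCurve hab (primitive hab t₀ β))
      (extendCurve hab β t) (Icc a b) t := by
  have h := (intervalIntegral.integral_hasDerivAt_right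
    ((continuous_extendCurve hab β).intervalIntegrable t₀ t)
    ((continuous_extendCurve hab β).stronglyMeasurableAtFilter _ _)
    (continuous_extendCurve hab β).continuousAt).hasDerivWithinAt (s := Icc a b)
  refine h.congr (fun s hs => ?_) ?_
  · rw [extendCurve_of_mem hab _ hs]; rfl
  · rw [extendCurve_of_mem hab _ ht]; rfl

/-- The Volterra operator `β ↦ ∫ A β`. -/
def volterra (hab : a ≤ b) (t₀ : Icc a b) (A : C(Icc a b, E →L[ℝ] E)) :
    C(Icc a b, E) →L[ℝ] C(Icc a b, E) :=
  (primitive hab t₀).comp (pointwiseApply a b E E A)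

/-- Each application of the operator integrates the bound `|s - t₀| ^ m / m!` once more, which gives
the factorial decay of an iterated integral. -/
lemma norm_volterra_pow_apply_le (hab : a ≤ b) (t₀ : Icc a b) (A : C(Icc a b, E →L[ℝ] E)) (m : ℕ)
    (β : C(Icc a b, E)) (t : Icc a b) :
    ‖((volterra hab t₀ A) ^ m) β t‖ ≤ (‖A‖ * |(t : ℝ) - t₀|) ^ m / m.factorial * ‖β‖ := by
  induction m generalizing t with
  | zero => simpa using β.norm_coe_le_norm t
  | succ m ih =>
    rw [pow_succ']
    change ‖∫ s in (t₀ : ℝ)..t, extendCurve hab _ s‖ ≤ _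
    set B := ((volterra hab t₀ A) ^ m) β
    have h1 : ∀ s ∈ uIoc (t₀ : ℝ) t, ‖extendCurve hab (pointwiseApply a b E E A B) s‖ ≤
        (‖A‖ * ‖A‖ ^ m / m.factorial * ‖β‖) * |s - t₀| ^ m := by
      intro s hs
      have hsI : s ∈ Icc a b :=
        (ordConnected_Icc.uIcc_subset t₀.2 t.2) (uIoc_subset_uIcc hs)
      rw [extendCurve_of_mem hab _ hsI, pointwiseApply_apply]
      refine ((A _).le_opNorm _).trans ((mul_le_mul (A.norm_coe_le_norm _) (ih ⟨s, hsI⟩)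
        (norm_nonneg _) (norm_nonneg _)).trans (le_of_eq ?_))
      rw [mul_pow]
      ring
    refine (intervalIntegral.norm_integral_le_abs_of_norm_le
      ((MeasureTheory.ae_restrict_mem measurableSet_uIoc).mono h1)
      (Continuous.intervalIntegrable (by fun_prop) _ _)).trans (le_of_eq ?_)
    rw [intervalIntegral.integral_const_mul, abs_mul, abs_of_nonneg (by positivity)]
    have h2 : |∫ s in (t₀ : ℝ)..t, |s - t₀| ^ m| = |(t : ℝ) - t₀| ^ (m + 1) / (m + 1) := by
      rw [intervalIntegral.integral_comp_sub_right (fun s => |s| ^ m) (t₀ : ℝ), sub_self]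
      rcases le_total 0 ((t : ℝ) - t₀) with h | h
      · rw [intervalIntegral.integral_congr (g := fun s => s ^ m), integral_pow]
        · rw [abs_of_nonneg h, zero_pow (by simp), sub_zero, abs_of_nonneg]
          positivity
        · intro s hs
          rw [uIcc_of_le h] at hs
          simp only [abs_of_nonneg hs.1]
      · rw [intervalIntegral.integral_congr (g := fun s => (-s) ^ m),
          intervalIntegral.integral_comp_neg (fun s => s ^ m), integral_pow]
        · have h3 : 0 ≤ -((t : ℝ) - t₀) := by linarith
          rw [abs_of_nonpos h, neg_zero, zero_pow (by simp), zero_sub, neg_div, abs_neg,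
            abs_of_nonneg]
          positivity
        · intro s hs
          rw [uIcc_of_ge h] at hs
          simp only [abs_of_nonpos hs.2]
    rw [h2, Nat.factorial_succ]
    push_cast
    field_simp
    ring

/-- Write `T` for the Volterra operator. By the factorial decay some power `T ^ m` has norm less
than one, so `1 - T ^ m` is a unit. It is the product of `1 - T` and a geometric sum that commutes
with it, so both factors are units. No smallness of `A` or of the interval is needed. -/
theorem isUnit_one_sub_volterra (hab : a ≤ b) (t₀ : Icc a b) (A : C(Icc a b, E →L[ℝ] E)) :
    IsUnit (1 - volterra hab t₀ A) := by
  obtain ⟨m, hm⟩ := ((FloorSemiring.tendsto_pow_div_factorial_atTop (‖A‖ * (b - a))).eventually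
    (gt_mem_nhds one_half_pos)).exists
  have hpow : ‖(volterra hab t₀ A) ^ m‖ < 1 := by
    refine lt_of_le_of_lt (ContinuousLinearMap.opNorm_le_bound _ (by norm_num : (0:ℝ) ≤ 1 / 2)
      fun β => ?_) one_half_lt_one
    rw [ContinuousMap.norm_le _ (by positivity)]
    intro t
    refine (norm_volterra_pow_apply_le hab t₀ A m β t).trans ?_
    refine mul_le_mul_of_nonneg_right (le_trans ?_ hm.le) (norm_nonneg _)
    have : |(t : ℝ) - t₀| ≤ b - a := by
      rw [abs_le]
      constructor <;> linarith [t.2.1, t.2.2, t₀.2.1, t₀.2.2]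
    gcongr
  have hu : IsUnit (1 - (volterra hab t₀ A) ^ m) := 
    ⟨Units.oneSub ((volterra hab t₀ A) ^ m) hpow, Units.val_oneSub _ hpow⟩
  rw [← mul_neg_geom_sum] at hu
  exact (Commute.isUnit_mul_iff (Commute.sum_right _ _ _ fun i _ =>
    ((Commute.one_left _).sub_left (Commute.self_pow _ i)))).1 hu |>.1

end Volterra

/-! ### Solutions of ordinary differential equations -/

section Solutions

variable {E : Type} [NormedAddCommGroup E] [NormedSpace ℝ E] {a b : ℝ}

lemma eq_of_hasDerivWithinAt_eq {f g f' : ℝ → E} {s : Set ℝ} (hs : Convex ℝ s)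
    (hf : ∀ t ∈ s, HasDerivWithinAt f (f' t) s t) (hg : ∀ t ∈ s, HasDerivWithinAt g (f' t) s t)
    {t₀ t : ℝ} (ht₀ : t₀ ∈ s) (ht : t ∈ s) (h : f t₀ = g t₀) : f t = g t := by
  have := Convex.norm_image_sub_le_of_norm_hasDerivWithin_le (f := fun t => f t - g t)
    (f' := fun _ => 0) (C := 0) (fun t ht => ((hf t ht).sub (hg t ht)).congr_deriv (sub_self _)) (by simp) hs
    ht₀ ht
  rw [zero_mul, norm_le_zero_iff, h, sub_self, sub_zero, sub_eq_zero] at this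
  exact this

variable [CompleteSpace E]

/-- The restriction to `[a, b]` of a curve that is continuous there. -/
def restrictCurve {a b : ℝ} (f : ℝ → E) (hf : ContinuousOn f (Icc a b)) : C(Icc a b, E) :=
  ⟨fun t => f t, continuousOn_iff_continuous_domRestrict.1 hf⟩

lemma extendCurve_restrictCurve (hab : a ≤ b) {f : ℝ → E} (hf : ContinuousOn f (Icc a b)) {t : ℝ}
    (ht : t ∈ Icc a b) : extendCurve hab (restrictCurve f hf) t = f t :=
  extendCurve_of_mem hab _ ht

/-- This lemma and the following one exchange an initial value problem for an integral equation in
the Banach space of continuous curves. -/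
lemma eq_const_add_primitive (hab : a ≤ b) {β g : C(Icc a b, E)} (t₀ : Icc a b)
    (h : ∀ t ∈ Icc a b, HasDerivWithinAt (extendCurve hab β) (extendCurve hab g t) (Icc a b) t) :
    β = ContinuousMap.const _ (β t₀) + primitive hab t₀ g := by
  ext t
  have := eq_of_hasDerivWithinAt_eq (convex_Icc a b) h
    (g := fun t => β t₀ + extendCurve hab (primitive hab t₀ g) t)
    (fun t ht => (hasDerivWithinAt_primitive hab t₀ g ht).const_add _) t₀.2 t.2 (by
      rw [extendCurve_of_mem hab _ t₀.2, extendCurve_of_mem hab _ t₀.2, primitive_apply,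
        intervalIntegral.integral_same, add_zero])
  rw [extendCurve_of_mem hab _ t.2, extendCurve_of_mem hab _ t.2] at this
  exact this

lemma hasDerivWithinAt_const_add_primitive (hab : a ≤ b) {β g : C(Icc a b, E)} {t₀ : Icc a b}
    {z : E} (h : β = ContinuousMap.const _ z + primitive hab t₀ g) :
    β t₀ = z ∧
      ∀ t ∈ Icc a b, HasDerivWithinAt (extendCurve hab β) (extendCurve hab g t) (Icc a b) t := by
  constructor
  · rw [h]
    change z + primitive hab t₀ g t₀ = z
    rw [primitive_apply, intervalIntegral.integral_same, add_zero]
  · intro t ht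
    refine ((hasDerivWithinAt_primitive hab t₀ g ht).const_add z).congr_of_mem (fun s hs => ?_) ht
    rw [extendCurve_of_mem hab _ hs, extendCurve_of_mem hab _ hs, h]
    rfl

/-- As an integral equation the problem reads `(1 - T) β = w + ∫ g` with the Volterra operator `T`
of `A`, and `1 - T` is invertible. -/
theorem exists_linear_solution (hab : a ≤ b) {A : ℝ → E →L[ℝ] E} (hA : ContinuousOn A (Icc a b))
    {g : ℝ → E} (hg : ContinuousOn g (Icc a b)) {t₀ : ℝ} (ht₀ : t₀ ∈ Icc a b) (w : E) :
    ∃ f : ℝ → E, f t₀ = w ∧ ∀ t ∈ Icc a b, HasDerivWithinAt f (A t (f t) + g t) (Icc a b) t := by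
  set A' : C(Icc a b, E →L[ℝ] E) := ⟨fun t => A t, continuousOn_iff_continuous_domRestrict.1 hA⟩
  set g' := restrictCurve g hg
  obtain ⟨u, hu⟩ := isUnit_one_sub_volterra hab ⟨t₀, ht₀⟩ A'
  set y : C(Icc a b, E) := ContinuousMap.const _ w + primitive hab ⟨t₀, ht₀⟩ g'
  set β : C(Icc a b, E) := (↑u⁻¹ : C(Icc a b, E) →L[ℝ] C(Icc a b, E)) y
  have h1 : (1 - volterra hab ⟨t₀, ht₀⟩ A') β = y := by
    rw [← hu]
    change ((u : C(Icc a b, E) →L[ℝ] C(Icc a b, E)) * ↑u⁻¹) y = y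
    rw [Units.mul_inv]
    rfl
  have h2 : β = ContinuousMap.const _ w +
      primitive hab ⟨t₀, ht₀⟩ (pointwiseApply a b E E A' β + g') := by
    rw [map_add, ← add_assoc, add_right_comm]
    exact eq_add_of_sub_eq h1
  obtain ⟨h3, h4⟩ := hasDerivWithinAt_const_add_primitive hab h2
  refine ⟨extendCurve hab β, ?_, fun t ht => ?_⟩
  · rw [extendCurve_of_mem hab _ ht₀, h3]
  · have := h4 t ht
    rw [extendCurve_of_mem hab _ ht] at this
    rw [extendCurve_of_mem hab _ ht]
    exact this

/-- The difference of two solutions is in the kernel of the invertible operator `1 - T`. Initial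
values may be prescribed at any time `t₀`, so the lemma also gives uniqueness backwards in time. -/
theorem linear_solution_unique {A : ℝ → E →L[ℝ] E} (hA : ContinuousOn A (Icc a b))
    {f g h : ℝ → E} {t₀ t : ℝ} (ht₀ : t₀ ∈ Icc a b) (ht : t ∈ Icc a b)
    (hf : ∀ t ∈ Icc a b, HasDerivWithinAt f (A t (f t) + h t) (Icc a b) t)
    (hg : ∀ t ∈ Icc a b, HasDerivWithinAt g (A t (g t) + h t) (Icc a b) t)
    (heq : f t₀ = g t₀) : f t = g t := by
  have hab : a ≤ b := ht₀.1.trans ht₀.2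
  set A' : C(Icc a b, E →L[ℝ] E) := ⟨fun t => A t, continuousOn_iff_continuous_domRestrict.1 hA⟩
  have hd : ∀ t ∈ Icc a b, HasDerivWithinAt (fun t => f t - g t) (A t (f t - g t)) (Icc a b) t :=
    fun t ht => ((hf t ht).sub (hg t ht)).congr_deriv (by rw [map_sub]; abel)
  set β := restrictCurve (fun t => f t - g t) fun t ht => (hd t ht).continuousWithinAt
  have h1 : β = ContinuousMap.const _ (β ⟨t₀, ht₀⟩) +
      primitive hab ⟨t₀, ht₀⟩ (pointwiseApply a b E E A' β) := by
    apply eq_const_add_primitive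
    intro s hs
    rw [extendCurve_of_mem hab _ hs]
    exact (hd s hs).congr_of_mem (fun r hr => extendCurve_of_mem hab _ hr) hs
  have h2 : β ⟨t₀, ht₀⟩ = 0 := sub_eq_zero.2 heq
  rw [h2] at h1
  obtain ⟨u, hu⟩ := isUnit_one_sub_volterra hab ⟨t₀, ht₀⟩ A'
  have h3 : (u : C(Icc a b, E) →L[ℝ] C(Icc a b, E)) β = 0 := by
    rw [hu]
    change β - primitive hab ⟨t₀, ht₀⟩ (pointwiseApply a b E E A' β) = 0
    rw [sub_eq_zero]
    exact h1.trans (zero_add _)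
  have h4 : β = 0 := by
    have : ((↑u⁻¹ : C(Icc a b, E) →L[ℝ] C(Icc a b, E)) * u) β = 0 := by
      change (↑u⁻¹ : C(Icc a b, E) →L[ℝ] C(Icc a b, E)) (u.1 β) = 0
      rw [h3, map_zero]
    rwa [Units.inv_mul] at this
  exact sub_eq_zero.1 (congrArg (fun γ : C(Icc a b, E) => γ ⟨t, ht⟩) h4)

end Solutions

/-! ### Smooth dependence on initial values and the variational equation -/

section SmoothDependence

variable {E : Type} [NormedAddCommGroup E] [NormedSpace ℝ E] [FiniteDimensional ℝ E] {a b : ℝ}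

/-- The solutions with value `z` at time `t₀` are the curves `α` with `G α = const z`, where `G α =
α - ∫ v (t, α t)`. The map `G` is smooth, and its derivative is one minus a Volterra operator, hence
invertible. The local inverse of `G`, restricted to the constants, is the flow as a smooth map into
the space of curves. Differentiating `G (φ z) = const z` gives the variational equation. -/
theorem exists_smooth_flow_of_univ (hab : a < b) {v : ℝ × E → E}
    (hv : ContDiffOn ℝ ∞ v (Icc a b ×ˢ univ)) (c : C(Icc a b, E)) (t₀ : Icc a b)
    (hc : ∀ t ∈ Icc a b, HasDerivWithinAt (extendCurve hab.le c) (v (t, extendCurve hab.le c t))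
      (Icc a b) t) :
    ∃ N : Set E, IsOpen N ∧ c t₀ ∈ N ∧ ∃ φ : E → C(Icc a b, E), ContDiffOn ℝ ∞ φ N ∧
      φ (c t₀) = c ∧ ∀ z ∈ N, (φ z t₀ = z ∧ ∀ t ∈ Icc a b,
        HasDerivWithinAt (extendCurve hab.le (φ z)) (v (t, extendCurve hab.le (φ z) t))
          (Icc a b) t) ∧
        ∀ w : E, ∀ t ∈ Icc a b, HasDerivWithinAt (extendCurve hab.le (fderiv ℝ φ z w))
          (partialDeriv a b v (t, extendCurve hab.le (φ z) t)
            (extendCurve hab.le (fderiv ℝ φ z w) t)) (Icc a b) t := by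
  have hE : CompleteSpace E := FiniteDimensional.complete ℝ E
  set P := primitive (E := E) hab.le t₀
  set Sp := superposition v hv.continuousOn
  set G : C(Icc a b, E) → C(Icc a b, E) := fun α => α - P (Sp α) with hG
  have hGs : ContDiff ℝ ∞ G :=
    contDiff_id.sub (P.contDiff.comp (contDiff_superposition hab hv))
  set A : C(Icc a b, E) → C(Icc a b, E →L[ℝ] E) := fun α =>
    superposition (partialDeriv a b v) (contDiffOn_partialDeriv hab hv).continuousOn α
  have hGd : ∀ α, HasFDerivAt G (1 - volterra hab.le t₀ (A α)) α := fun α =>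
    (hasFDerivAt_id α).sub (P.hasFDerivAt.comp α (hasFDerivAt_superposition hab hv α))
  obtain ⟨u, hu⟩ := isUnit_one_sub_volterra hab.le t₀ (A c)
  obtain ⟨e, hce, -, heG, hes⟩ := exists_smooth_localInverse isOpen_univ hGs.contDiffOn
    (mem_univ c) (ContinuousLinearEquiv.ofUnit u) (by
      have := hGd c
      rw [← hu] at this
      exact this)
  set κ : E →L[ℝ] C(Icc a b, E) := ContinuousLinearMap.const ℝ (Icc a b)
  have hκ : ∀ z t, κ z t = z := fun _ _ => rfl
  have hGc : G c = κ (c t₀) := by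
    have := eq_const_add_primitive hab.le (g := Sp c) t₀ (fun t ht => by
      have h := hc t ht
      rw [extendCurve_of_mem hab.le _ ht] at h
      rw [extendCurve_of_mem hab.le _ ht]
      exact h)
    exact sub_eq_of_eq_add this
  set φ : E → C(Icc a b, E) := fun z => e.symm (κ z)
  have hN : IsOpen (κ ⁻¹' e.target) := e.open_target.preimage κ.continuous
  have hφ : ContDiffOn ℝ ∞ φ (κ ⁻¹' e.target) :=
    hes.comp κ.contDiff.contDiffOn fun _ h => h
  have hGφ : ∀ z ∈ κ ⁻¹' e.target, G (φ z) = κ z := fun z hz => by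
    rw [← heG]; exact e.right_inv hz
  refine ⟨κ ⁻¹' e.target, hN, ?_, φ, hφ, ?_, fun z hz => ⟨?_, fun w => ?_⟩⟩
  · rw [mem_preimage, ← hGc, ← heG]
    exact e.map_source hce
  · change e.symm (κ (c t₀)) = c
    rw [← hGc, ← heG, e.left_inv hce]
  · have h1 : φ z = ContinuousMap.const _ z + P (Sp (φ z)) := eq_add_of_sub_eq (hGφ z hz)
    obtain ⟨h2, h3⟩ := hasDerivWithinAt_const_add_primitive hab.le h1
    refine ⟨h2, fun t ht => ?_⟩
    have h4 := h3 t ht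
    rw [extendCurve_of_mem hab.le _ ht] at h4
    rw [extendCurve_of_mem hab.le _ ht]
    exact h4
  · have hφd : HasFDerivAt φ (fderiv ℝ φ z) z :=
      ((hφ.contDiffAt (hN.mem_nhds hz)).differentiableAt (by simp)).hasFDerivAt
    have h1 : HasFDerivAt (fun z => G (φ z)) _ z := (hGd (φ z)).comp z hφd
    have h2 : HasFDerivAt (fun z => G (φ z)) κ z :=
      κ.hasFDerivAt.congr_of_eventuallyEq (Filter.mem_of_superset (hN.mem_nhds hz) hGφ)
    have h3 := DFunLike.congr_fun (h1.unique h2) w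
    have h4 : fderiv ℝ φ z w = ContinuousMap.const _ w +
        P (pointwiseApply a b E E (A (φ z)) (fderiv ℝ φ z w)) := eq_add_of_sub_eq h3
    intro t ht
    have h5 := (hasDerivWithinAt_const_add_primitive hab.le h4).2 t ht
    rw [extendCurve_of_mem hab.le _ ht] at h5
    rw [extendCurve_of_mem hab.le _ ht, extendCurve_of_mem hab.le _ ht]
    exact h5

lemma exists_cutoff_vectorSpace {K U : Set E} (hK : IsCompact K) (hU : IsOpen U) (hKU : K ⊆ U) :
    ∃ (χ : E → ℝ) (W : Set E), ContDiff ℝ ∞ χ ∧ IsOpen W ∧ K ⊆ W ∧ W ⊆ U ∧ (∀ x ∈ W, χ x = 1) ∧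
      tsupport χ ⊆ U := by
  obtain ⟨K₁, hK₁, h1, h2⟩ := exists_compact_between hK hU hKU
  obtain ⟨K₂, hK₂, h3, h4⟩ := exists_compact_between hK₁ hU h2
  obtain ⟨f, hf, -, hf0, hf1⟩ := exists_contMDiff_zero_iff_one_iff_of_isClosed (n := ⊤) 𝓘(ℝ, E)
    (isOpen_interior (s := K₂)).isClosed_compl hK₁.isClosed
    (disjoint_left.2 fun x hx hx' => hx (h3 hx'))
  refine ⟨f, interior K₁, contMDiff_iff_contDiff.1 hf, isOpen_interior, h1, interior_subset.trans h2,
    fun x hx => (hf1 x).1 (interior_subset hx), ?_⟩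
  refine (closure_minimal (fun x hx => ?_) hK₂.isClosed).trans h4
  by_contra hcon
  exact hx ((hf0 x).1 fun h => hcon (interior_subset h))

/-- Smooth dependence of the solutions of an ordinary differential equation on the initial value,
together with the variational equation. -/
theorem exists_smooth_flow (hab : a < b) {U : Set E} (hU : IsOpen U) {v : ℝ × E → E}
    (hv : ContDiffOn ℝ ∞ v (Icc a b ×ˢ U)) {c : ℝ → E}
    (hc : ∀ t ∈ Icc a b, c t ∈ U ∧ HasDerivWithinAt c (v (t, c t)) (Icc a b) t) {t₀ : ℝ}
    (ht₀ : t₀ ∈ Icc a b) :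
    ∃ N : Set E, IsOpen N ∧ c t₀ ∈ N ∧ ∃ φ : E → ℝ → E,
      (∀ t ∈ Icc a b, ContDiffOn ℝ ∞ (fun z => φ z t) N) ∧
      (∀ t ∈ Icc a b, φ (c t₀) t = c t) ∧
      ∀ z ∈ N, φ z t₀ = z ∧ (∀ t ∈ Icc a b, φ z t ∈ U ∧
        HasDerivWithinAt (φ z) (v (t, φ z t)) (Icc a b) t) ∧
        ∀ w : E, ∀ t ∈ Icc a b, HasDerivWithinAt (fun s => fderiv ℝ (fun y => φ y s) z w)
          (fderiv ℝ (fun y => v (t, y)) (φ z t) (fderiv ℝ (fun y => φ y t) z w)) (Icc a b) t := by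
  have hcc : ContinuousOn c (Icc a b) := fun t ht => (hc t ht).2.continuousWithinAt
  have hK : IsCompact (c '' Icc a b) := isCompact_Icc.image_of_continuousOn hcc
  obtain ⟨χ, W, hχ, hW, hKW, hWU, hχ1, hχU⟩ := exists_cutoff_vectorSpace hK hU
    (by rintro _ ⟨t, ht, rfl⟩; exact (hc t ht).1)
  -- The superposition operator needs a field on all of `E`. The cut-off field agrees with `v` near
  -- the image of `c`.
  set v' : ℝ × E → E := fun q => χ q.2 • v q
  have hv' : ContDiffOn ℝ ∞ v' (Icc a b ×ˢ univ) := by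
    rintro ⟨t, x⟩ ⟨ht, -⟩
    by_cases hx : x ∈ U
    · have h1 : ContDiffWithinAt ℝ ∞ v' (Icc a b ×ˢ U) (t, x) :=
        ((hχ.comp contDiff_snd).contDiffOn.smul hv) (t, x) ⟨ht, hx⟩
      refine h1.mono_of_mem_nhdsWithin ?_
      rw [nhdsWithin_prod_eq]
      exact prod_mem_prod self_mem_nhdsWithin (mem_nhdsWithin_of_mem_nhds (hU.mem_nhds hx))
    · refine (contDiffAt_const (c := (0 : E))).congr_of_eventuallyEq ?_ |>.contDiffWithinAt
      have : univ ×ˢ (tsupport χ)ᶜ ∈ 𝓝 (t, x) := prod_mem_nhds univ_mem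
        ((isClosed_tsupport χ).isOpen_compl.mem_nhds fun h => hx (hχU h))
      filter_upwards [this] with q hq
      simp [v', image_eq_zero_of_notMem_tsupport hq.2]
  have hvv : ∀ t, ∀ x ∈ W, v' (t, x) = v (t, x) := fun t x hx => by simp [v', hχ1 x hx]
  have hcW : ∀ t ∈ Icc a b, c t ∈ W := fun t ht => hKW ⟨t, ht, rfl⟩
  obtain ⟨N, hN, hcN, φ, hφ, hφc, hφs⟩ := exists_smooth_flow_of_univ hab hv'
    (restrictCurve c hcc) ⟨t₀, ht₀⟩ (fun t ht => by
      rw [extendCurve_restrictCurve hab.le hcc ht, hvv t _ (hcW t ht)]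
      exact (hc t ht).2.congr_of_mem (fun s hs => extendCurve_restrictCurve hab.le hcc hs) ht)
  change c t₀ ∈ N at hcN
  change φ (c t₀) = _ at hφc
  obtain ⟨ε, hε, hth⟩ := hK.exists_thickening_subset_open hW hKW
  -- Initial values in `N'` have solutions uniformly within `ε` of `c`. These remain in `W`, where
  -- `χ = 1`, so they solve the original equation.
  set N' := N ∩ φ ⁻¹' Metric.ball (φ (c t₀)) ε
  have hN' : IsOpen N' := hφ.continuousOn.isOpen_inter_preimage hN Metric.isOpen_ball
  have hstay : ∀ z ∈ N', ∀ t ∈ Icc a b, extendCurve hab.le (φ z) t ∈ W := by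
    intro z hz t ht
    apply hth
    rw [Metric.mem_thickening_iff]
    refine ⟨c t, ⟨t, ht, rfl⟩, ?_⟩
    rw [extendCurve_of_mem hab.le _ ht]
    have h1 := (ContinuousMap.dist_apply_le_dist (f := φ z) (g := φ (c t₀)) ⟨t, ht⟩).trans_lt hz.2
    rw [hφc] at h1
    exact h1
  set ev : Icc a b → C(Icc a b, E) →L[ℝ] E := fun t => ContinuousMap.evalCLM ℝ t
  refine ⟨N', hN', ⟨hcN, Metric.mem_ball_self hε⟩, fun z => extendCurve hab.le (φ z), ?_, ?_, ?_⟩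
  · intro t ht
    refine ((ev ⟨t, ht⟩).contDiff.comp_contDiffOn (hφ.mono inter_subset_left)).congr fun z _ => ?_
    exact extendCurve_of_mem hab.le _ ht
  · intro t ht
    change extendCurve hab.le (φ (c t₀)) t = c t
    rw [hφc]
    exact extendCurve_restrictCurve hab.le hcc ht
  · intro z hz
    obtain ⟨⟨h1, h2⟩, h3⟩ := hφs z hz.1
    refine ⟨?_, fun t ht => ⟨hWU (hstay z hz t ht), ?_⟩, fun w t ht => ?_⟩
    · exact (extendCurve_of_mem hab.le _ ht₀).trans h1
    · have := h2 t ht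
      rwa [hvv t _ (hstay z hz t ht)] at this
    · have hφd : HasFDerivAt φ (fderiv ℝ φ z) z :=
        ((hφ.contDiffAt (hN.mem_nhds hz.1)).differentiableAt (by simp)).hasFDerivAt
      have h4 : ∀ s ∈ Icc a b, fderiv ℝ (fun y => extendCurve hab.le (φ y) s) z w =
          extendCurve hab.le (fderiv ℝ φ z w) s := by
        intro s hs
        have h5 : HasFDerivAt (fun y => ev ⟨s, hs⟩ (φ y)) _ z :=
          (ev ⟨s, hs⟩).hasFDerivAt.comp z hφd
        have h6 : (fun y => extendCurve hab.le (φ y) s) = fun y => ev ⟨s, hs⟩ (φ y) :=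
          funext fun y => extendCurve_of_mem hab.le _ hs
        rw [h6, h5.fderiv, extendCurve_of_mem hab.le _ hs]
        rfl
      have h7 : fderiv ℝ (fun y => v (t, y)) (extendCurve hab.le (φ z) t) =
          partialDeriv a b v' (t, extendCurve hab.le (φ z) t) := by
        refine HasFDerivAt.fderiv ((hasFDerivAt_partialDeriv hv' ht _).congr_of_eventuallyEq ?_)
        filter_upwards [hW.mem_nhds (hstay z hz t ht)] with y hy using (hvv t y hy).symm
      rw [h4 t ht, h7]
      exact (h3 w t ht).congr_of_mem (fun s hs => h4 s hs) ht

end SmoothDependence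

/-! ### Straightening an involutive family of vector fields -/

section Straightening

variable {E : Type} [NormedAddCommGroup E] [NormedSpace ℝ E] [FiniteDimensional ℝ E] {k : ℕ}

/-- The linear combination of the values at `z` of the vector fields `G i`, with coefficients `u`. -/
def combination (G : Fin k → E → E) (z : E) : (Fin k → ℝ) →L[ℝ] E :=
  ∑ i, (ContinuousLinearMap.proj (R := ℝ) (φ := fun _ : Fin k => ℝ) i).smulRight (G i z)

lemma combination_apply (G : Fin k → E → E) (z : E) (u : Fin k → ℝ) :
    combination G z u = ∑ i, u i • G i z := by
  simp [combination]

lemma range_combination (G : Fin k → E → E) (z : E) :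
    LinearMap.range (combination G z : (Fin k → ℝ) →ₗ[ℝ] E) =
      Submodule.span ℝ (range fun i => G i z) := by
  rw [← Fintype.range_linearCombination ℝ]
  congr 1
  ext u
  simp [combination_apply, Fintype.linearCombination_apply]

variable {U : Set E} {G : Fin k → E → E} {cf : Fin k → Fin k → Fin k → E → ℝ}

/-- Read `g i` as the value of the field `G i` and `L i` as its derivative. Differentiating a
combination of the fields along another one equals applying the linearisation of the latter, up to a
correction in the span of the fields whose coefficients are the structure functions. -/
lemma sum_bracket_expand (L : Fin k → E →L[ℝ] E) (g : Fin k → E) (c : Fin k → Fin k → Fin k → ℝ)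
    (h : ∀ i j, L j (g i) = L i (g j) + ∑ l, c i j l • g l) (u α : Fin k → ℝ) :
    ∑ j, α j • L j (∑ i, u i • g i) = (∑ i, u i • L i) (∑ j, α j • g j) +
      ∑ l, (∑ i, ∑ j, u i * α j * c i j l) • g l := by
  have h1 : ∑ j, α j • L j (∑ i, u i • g i) =
      ∑ i, ∑ j, (u i * α j) • (L i (g j) + ∑ l, c i j l • g l) := by
    rw [Finset.sum_comm]
    refine Finset.sum_congr rfl fun j _ => ?_
    rw [map_sum, Finset.smul_sum]
    refine Finset.sum_congr rfl fun i _ => ?_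
    rw [map_smul, smul_smul, h, mul_comm]
  have h2 : (∑ i, u i • L i) (∑ j, α j • g j) = ∑ i, ∑ j, (u i * α j) • L i (g j) := by
    rw [_root_.sum_apply]
    refine Finset.sum_congr rfl fun i _ => ?_
    rw [_root_.smul_apply, map_sum, Finset.smul_sum]
    refine Finset.sum_congr rfl fun j _ => ?_
    rw [map_smul, smul_smul]
  have h3 : ∑ l, (∑ i, ∑ j, u i * α j * c i j l) • g l =
      ∑ i, ∑ j, (u i * α j) • ∑ l, c i j l • g l := by
    simp only [Finset.sum_smul, Finset.smul_sum, smul_smul]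
    rw [Finset.sum_comm]
    exact Finset.sum_congr rfl fun i _ => Finset.sum_comm
  rw [h1, h2, h3, ← Finset.sum_add_distrib]
  refine Finset.sum_congr rfl fun i _ => ?_
  rw [← Finset.sum_add_distrib]
  exact Finset.sum_congr rfl fun j _ => smul_add _ _ _

/-- The derivative along a curve of a linear combination of the fields `G i`. -/
lemma hasDerivWithinAt_combination {I : Set ℝ} (hU : IsOpen U)
    (hG : ∀ i, ContDiffOn ℝ ∞ (G i) U)
    (hbr : ∀ a ∈ U, ∀ i j, fderiv ℝ (G j) a (G i a) - fderiv ℝ (G i) a (G j a) =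
      ∑ l, cf i j l a • G l a) {ζ : ℝ → E} {u : Fin k → ℝ} {t : ℝ} (hζ : ζ t ∈ U)
    (hd : HasDerivWithinAt ζ (combination G (ζ t) u) I t) {α : ℝ → Fin k → ℝ} {α' : Fin k → ℝ}
    (hα : HasDerivWithinAt α α' I t) :
    HasDerivWithinAt (fun s => combination G (ζ s) (α s))
      ((∑ i, u i • fderiv ℝ (G i) (ζ t)) (combination G (ζ t) (α t)) +
        combination G (ζ t) ((fun l => ∑ i, ∑ j, u i * α t j * cf i j l (ζ t)) + α')) I t := by
  have h1 : ∀ j, HasDerivWithinAt (fun s => α s j • G j (ζ s))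
      (α t j • fderiv ℝ (G j) (ζ t) (combination G (ζ t) u) + α' j • G j (ζ t)) I t := by
    intro j
    have h2 : HasFDerivAt (G j) (fderiv ℝ (G j) (ζ t)) (ζ t) :=
      (((hG j).contDiffAt (hU.mem_nhds hζ)).differentiableAt (by simp)).hasFDerivAt
    exact (hasDerivWithinAt_pi.1 hα j).smul (h2.comp_hasDerivWithinAt t hd)
  have h3 := HasDerivWithinAt.fun_sum fun j (_ : j ∈ Finset.univ) => h1 j
  have h4 : (fun s => combination G (ζ s) (α s)) = fun s => ∑ j, α s j • G j (ζ s) :=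
    funext fun s => combination_apply G _ _
  rw [h4]
  refine h3.congr_deriv ?_
  rw [map_add, ← add_assoc, Finset.sum_add_distrib, combination_apply _ _ α']
  congr 1
  have h5 : ∀ i j, fderiv ℝ (G j) (ζ t) (G i (ζ t)) =
      fderiv ℝ (G i) (ζ t) (G j (ζ t)) + ∑ l, cf i j l (ζ t) • G l (ζ t) := fun i j => by
    rw [← hbr _ hζ i j]; abel
  simp only [combination_apply]
  exact sum_bracket_expand _ _ (fun i j l => cf i j l (ζ t)) h5 u (α t)

/-- The matrix of the bracket with `∑ i, u i • G i` in terms of the structure functions `cf`. -/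
def structureMap (cf : Fin k → Fin k → Fin k → E → ℝ) (u : Fin k → ℝ) (z : E) :
    (Fin k → ℝ) →L[ℝ] Fin k → ℝ :=
  ∑ i, ∑ j, ∑ l, (u i * cf i j l z) •
    (ContinuousLinearMap.proj (R := ℝ) (φ := fun _ : Fin k => ℝ) j).smulRight (Pi.single l 1)

lemma structureMap_apply (u α : Fin k → ℝ) (z : E) :
    structureMap cf u z α = fun l => ∑ i, ∑ j, u i * α j * cf i j l z := by
  funext l
  simp only [structureMap, _root_.sum_apply, _root_.smul_apply, Finset.sum_apply, Pi.smul_apply,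
    ContinuousLinearMap.smulRight_apply, ContinuousLinearMap.proj_apply, smul_eq_mul]
  refine Finset.sum_congr rfl fun i _ => Finset.sum_congr rfl fun j _ => ?_
  rw [Finset.sum_eq_single l]
  · simp; ring
  · intro l' _ h
    simp [h.symm]
  · simp

lemma continuousOn_structureMap {I : Set ℝ} (hcf : ∀ i j l, ContinuousOn (cf i j l) U)
    {ζ : ℝ → E} (hζ : ContinuousOn ζ I) (hζU : ∀ t ∈ I, ζ t ∈ U) (u : Fin k → ℝ) :
    ContinuousOn (fun t => structureMap cf u (ζ t)) I := by
  refine continuousOn_finsetSum _ fun i _ => continuousOn_finsetSum _ fun j _ =>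
    continuousOn_finsetSum _ fun l _ => ?_
  exact (continuousOn_const.mul ((hcf i j l).comp hζ hζU)).smul continuousOn_const

lemma continuousOn_sum_fderiv {I : Set ℝ} (hU : IsOpen U) (hG : ∀ i, ContDiffOn ℝ ∞ (G i) U)
    {ζ : ℝ → E} (hζ : ContinuousOn ζ I) (hζU : ∀ t ∈ I, ζ t ∈ U) (u : Fin k → ℝ) :
    ContinuousOn (fun t => ∑ i, u i • fderiv ℝ (G i) (ζ t)) I := by
  refine continuousOn_finsetSum _ fun i _ => ?_
  exact (((hG i).fderiv_of_isOpen hU (m := ∞) (by simp)).continuousOn.comp hζ hζU).const_smul (u i)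

section Curve

variable (hU : IsOpen U) (hG : ∀ i, ContDiffOn ℝ ∞ (G i) U)
  (hcf : ∀ i j l, ContinuousOn (cf i j l) U)
  (hbr : ∀ a ∈ U, ∀ i j, fderiv ℝ (G j) a (G i a) - fderiv ℝ (G i) a (G j a) =
    ∑ l, cf i j l a • G l a) {ζ : ℝ → E} {u : Fin k → ℝ}
  (hζ : ∀ t ∈ Icc (0 : ℝ) 1, ζ t ∈ U ∧
    HasDerivWithinAt ζ (combination G (ζ t) u) (Icc 0 1) t)

include hU hG hcf hbr hζ

/-- Variations of an integral curve of `∑ i, u i • G i` by varying `u` stay in the span of the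
vector fields. -/
lemma variation_mem_span {w : ℝ → E} {u' : Fin k → ℝ} (hw0 : w 0 = 0)
    (hw : ∀ t ∈ Icc (0 : ℝ) 1, HasDerivWithinAt w ((∑ i, u i • fderiv ℝ (G i) (ζ t)) (w t) +
      combination G (ζ t) u') (Icc 0 1) t) :
    w 1 ∈ Submodule.span ℝ (range fun i => G i (ζ 1)) := by
  have hζc : ContinuousOn ζ (Icc 0 1) := fun t ht => (hζ t ht).2.continuousWithinAt
  -- The coefficients solve `α' = -B α + u'` with `B = structureMap cf u (ζ t)`. The term `-B α`
  -- cancels the bracket correction in `hasDerivWithinAt_combination`, so that the combination with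
  -- coefficients `α` solves the same linear equation as `w`, with the same initial value.
  obtain ⟨α, hα0, hα⟩ := exists_linear_solution (zero_le_one' ℝ)
    (A := fun t => -structureMap cf u (ζ t)) (g := fun _ => u')
    (continuousOn_structureMap hcf hζc (fun t ht => (hζ t ht).1) u).neg continuousOn_const
    (left_mem_Icc.2 zero_le_one) 0
  have h1 : w 1 = combination G (ζ 1) (α 1) := by
    refine linear_solution_unique (continuousOn_sum_fderiv hU hG hζc (fun t ht => (hζ t ht).1) u)
      (left_mem_Icc.2 zero_le_one) (right_mem_Icc.2 zero_le_one) hw (fun t ht => ?_)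
      (g := fun t => combination G (ζ t) (α t)) (by rw [hw0, hα0, map_zero])
    refine (hasDerivWithinAt_combination hU hG hbr (hζ t ht).1 (hζ t ht).2
      (hα t ht)).congr_deriv ?_
    rw [← structureMap_apply]
    congr 2
    rw [_root_.neg_apply]
    abel
  rw [h1, ← range_combination]
  exact ⟨α 1, rfl⟩

/-- The span of the vector fields does not grow along an integral curve. -/
lemma finrank_span_le_of_curve :
    Module.finrank ℝ (Submodule.span ℝ (range fun i => G i (ζ 1))) ≤
      Module.finrank ℝ (Submodule.span ℝ (range fun i => G i (ζ 0))) := by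
  have hζc : ContinuousOn ζ (Icc 0 1) := fun t ht => (hζ t ht).2.continuousWithinAt
  have h0 : (0 : ℝ) ∈ Icc (0 : ℝ) 1 := left_mem_Icc.2 zero_le_one
  have h1 : (1 : ℝ) ∈ Icc (0 : ℝ) 1 := right_mem_Icc.2 zero_le_one
  have hbc := continuousOn_structureMap hcf hζc (fun t ht => (hζ t ht).1) u
  -- The operators `T t` are the fundamental solution of `α' = -B α`. Along its solutions the
  -- combination of the fields solves a homogeneous linear equation, so relations among the fields
  -- at `ζ 0` are carried to relations at `ζ 1`. As `T 1` is injective, the kernel does not shrink,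
  -- and the rank does not grow.
  obtain ⟨T, hT0, hT⟩ := exists_linear_solution (zero_le_one' ℝ)
    (A := fun t => -ContinuousLinearMap.compL ℝ (Fin k → ℝ) (Fin k → ℝ) (Fin k → ℝ)
      (structureMap cf u (ζ t))) (g := fun _ => 0)
    (((ContinuousLinearMap.compL ℝ (Fin k → ℝ) (Fin k → ℝ)
      (Fin k → ℝ)).continuous.comp_continuousOn hbc).neg) continuousOn_const h0
    (ContinuousLinearMap.id ℝ (Fin k → ℝ))
  have hTα : ∀ α : Fin k → ℝ, ∀ t ∈ Icc (0 : ℝ) 1, HasDerivWithinAt (fun t => T t α)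
      (-(structureMap cf u (ζ t)) (T t α) + 0) (Icc 0 1) t := by
    intro α t ht
    have := (hT t ht).clm_apply (hasDerivWithinAt_const t (Icc (0 : ℝ) 1) α)
    refine this.congr_deriv ?_
    simp
  -- Uniqueness backwards in time, from time one to time zero.
  have hinj : ∀ α, T 1 α = 0 → α = 0 := by
    intro α hα
    have := linear_solution_unique (f := fun t => T t α) (g := fun _ => 0) (h := fun _ => 0)
      (A := fun t => -structureMap cf u (ζ t)) hbc.neg h1 h0 (hTα α)
      (fun t _ => by simpa using hasDerivWithinAt_const t (Icc (0 : ℝ) 1) (0 : Fin k → ℝ)) hα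
    simpa [hT0] using this
  have hker : ∀ α, combination G (ζ 0) α = 0 → combination G (ζ 1) (T 1 α) = 0 := by
    intro α hα
    refine linear_solution_unique (f := fun t => combination G (ζ t) (T t α)) (g := fun _ => 0)
      (h := fun _ => 0) (continuousOn_sum_fderiv hU hG hζc (fun t ht => (hζ t ht).1) u) h0 h1
      (fun t ht => ?_)
      (fun t _ => by simpa using hasDerivWithinAt_const t (Icc (0 : ℝ) 1) (0 : E)) ?_
    · refine (hasDerivWithinAt_combination hU hG hbr (hζ t ht).1 (hζ t ht).2
        (hTα α t ht)).congr_deriv ?_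
      rw [← structureMap_apply]
      congr 1
      rw [add_zero, add_neg_cancel, map_zero]
    · simp only [hT0]
      exact hα
  rw [← range_combination, ← range_combination]
  have e0 := LinearMap.finrank_range_add_finrank_ker (combination G (ζ 0) : (Fin k → ℝ) →ₗ[ℝ] E)
  have e1 := LinearMap.finrank_range_add_finrank_ker (combination G (ζ 1) : (Fin k → ℝ) →ₗ[ℝ] E)
  have e2 : Module.finrank ℝ (LinearMap.ker (combination G (ζ 0) : (Fin k → ℝ) →ₗ[ℝ] E)) ≤
      Module.finrank ℝ (LinearMap.ker (combination G (ζ 1) : (Fin k → ℝ) →ₗ[ℝ] E)) := by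
    refine LinearMap.finrank_le_finrank_of_injective
      (f := (T 1 : (Fin k → ℝ) →ₗ[ℝ] Fin k → ℝ).restrict fun α hα => hker α hα) ?_
    rw [← LinearMap.ker_eq_bot, LinearMap.ker_eq_bot']
    rintro ⟨α, hα⟩ h
    exact Subtype.ext (hinj α (congrArg Subtype.val h))
  omega

end Curve

lemma contDiffOn_combination (hG : ∀ i, ContDiffOn ℝ ∞ (G i) U) :
    ContDiffOn ℝ ∞ (combination G) U :=
  ContDiffOn.sum fun i _ => contDiffOn_const.smulRight (hG i)

/-- The flow of `∑ i, u i • G i` for unit time, as a function of `u` and the initial value. -/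
lemma exists_parametrised_flow (hU : IsOpen U) {a₀ : E} (ha₀ : a₀ ∈ U)
    (hG : ∀ i, ContDiffOn ℝ ∞ (G i) U) :
    ∃ N : Set ((Fin k → ℝ) × E), IsOpen N ∧ (0, a₀) ∈ N ∧ ∃ ζ : (Fin k → ℝ) × E → ℝ → E,
      (∀ t ∈ Icc (0 : ℝ) 1, ContDiffOn ℝ ∞ (fun p => ζ p t) N) ∧
      ∀ p ∈ N, ζ p 0 = p.2 ∧ (∀ t ∈ Icc (0 : ℝ) 1, ζ p t ∈ U ∧
        HasDerivWithinAt (ζ p) (combination G (ζ p t) p.1) (Icc 0 1) t) ∧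
        ∀ q : (Fin k → ℝ) × E, fderiv ℝ (fun p => ζ p 0) p q = q.2 ∧ ∀ t ∈ Icc (0 : ℝ) 1,
          HasDerivWithinAt (fun s => fderiv ℝ (fun p => ζ p s) p q)
            ((∑ i, p.1 i • fderiv ℝ (G i) (ζ p t)) (fderiv ℝ (fun p => ζ p t) p q) +
              combination G (ζ p t) q.1) (Icc 0 1) t := by
  have h0 : (0 : ℝ) ∈ Icc (0 : ℝ) 1 := left_mem_Icc.2 zero_le_one
  -- The parameter `u` becomes an unknown with zero derivative, so that smooth dependence on initial
  -- values includes dependence on `u`. For `u = 0` the field vanishes, and the constant curve at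
  -- `a₀` is the reference solution.
  set v : ℝ × ((Fin k → ℝ) × E) → (Fin k → ℝ) × E := fun r => (0, combination G r.2.2 r.2.1)
  have hv : ContDiffOn ℝ ∞ v (Icc 0 1 ×ˢ (univ ×ˢ U)) :=
    contDiffOn_const.prodMk (((contDiffOn_combination hG).comp (by fun_prop)
      fun r hr => hr.2.2).clm_apply (by fun_prop))
  obtain ⟨N, hN, haN, φ, hφs, -, hφ⟩ := exists_smooth_flow zero_lt_one (isOpen_univ.prod hU) hv
    (c := fun _ => (0, a₀)) (fun t _ => ⟨⟨trivial, ha₀⟩, by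
      have : v (t, (0, a₀)) = 0 := by simp [v]
      rw [this]
      exact hasDerivWithinAt_const _ _ _⟩) h0
  have hfst : ∀ p ∈ N, ∀ t ∈ Icc (0 : ℝ) 1, (φ p t).1 = p.1 := by
    intro p hp t ht
    obtain ⟨h1, h2, -⟩ := hφ p hp
    have := eq_of_hasDerivWithinAt_eq (convex_Icc (0 : ℝ) 1) (f := fun t => (φ p t).1)
      (g := fun _ => p.1) (f' := fun _ => 0) (fun t ht => (h2 t ht).2.fst)
      (fun t _ => hasDerivWithinAt_const _ _ _) h0 ht (by simp [h1])
    exact this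
  have hdiff : ∀ p ∈ N, ∀ t ∈ Icc (0 : ℝ) 1,
      HasFDerivAt (fun p => φ p t) (fderiv ℝ (fun p => φ p t) p) p := fun p hp t ht =>
    (((hφs t ht).contDiffAt (hN.mem_nhds hp)).differentiableAt (by simp)).hasFDerivAt
  have hdfst : ∀ p ∈ N, ∀ t ∈ Icc (0 : ℝ) 1, ∀ q, (fderiv ℝ (fun p => φ p t) p q).1 = q.1 := by
    intro p hp t ht q
    have h1 := (hdiff p hp t ht).fst
    have h2 : HasFDerivAt (fun p => (φ p t).1) (ContinuousLinearMap.fst ℝ (Fin k → ℝ) E) p :=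
      hasFDerivAt_fst.congr_of_eventuallyEq
        (Filter.mem_of_superset (hN.mem_nhds hp) fun p' hp' => hfst p' hp' t ht)
    exact DFunLike.congr_fun (h1.unique h2) q
  have hdsnd : ∀ p ∈ N, ∀ t ∈ Icc (0 : ℝ) 1, ∀ q,
      fderiv ℝ (fun p => (φ p t).2) p q = (fderiv ℝ (fun p => φ p t) p q).2 := by
    intro p hp t ht q
    rw [(hdiff p hp t ht).snd.fderiv]
    rfl
  refine ⟨N, hN, haN, fun p t => (φ p t).2, fun t ht => (hφs t ht).snd, fun p hp => ?_⟩
  obtain ⟨h1, h2, h3⟩ := hφ p hp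
  refine ⟨by simp [h1], fun t ht => ⟨(h2 t ht).1.2, ?_⟩, fun q => ⟨?_, fun t ht => ?_⟩⟩
  · have := (h2 t ht).2.snd
    simp only [v] at this
    rw [hfst p hp t ht] at this
    exact this
  · have h5 : HasFDerivAt (fun p => (φ p 0).2) (ContinuousLinearMap.snd ℝ (Fin k → ℝ) E) p :=
      hasFDerivAt_snd.congr_of_eventuallyEq
        (Filter.mem_of_superset (hN.mem_nhds hp) fun p' hp' => by simp [(hφ p' hp').1])
    rw [h5.fderiv]
    rfl
  · have h5 : HasDerivWithinAt (fun s => (fderiv ℝ (fun y => φ y s) p q).2)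
        (fderiv ℝ (fun y => v (t, y)) (φ p t) (fderiv ℝ (fun y => φ y t) p q)).2 (Icc 0 1) t :=
      (ContinuousLinearMap.snd ℝ (Fin k → ℝ) E).hasFDerivAt.comp_hasDerivWithinAt t (h3 q t ht)
    have hz : (φ p t).2 ∈ U := (h2 t ht).1.2
    have h6 : HasFDerivAt (fun y : (Fin k → ℝ) × E => combination G y.2 y.1)
        (∑ i, ((φ p t).1 i • (fderiv ℝ (G i) (φ p t).2).comp (ContinuousLinearMap.snd ℝ _ _) +
          ((ContinuousLinearMap.proj (R := ℝ) (φ := fun _ : Fin k => ℝ) i).comp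
            (ContinuousLinearMap.fst ℝ (Fin k → ℝ) E)).smulRight (G i (φ p t).2))) (φ p t) := by
      have h7 : (fun y : (Fin k → ℝ) × E => combination G y.2 y.1) =
          fun y => ∑ i, y.1 i • G i y.2 := funext fun y => combination_apply _ _ _
      rw [h7]
      refine HasFDerivAt.fun_sum fun i _ => ?_
      have h8 : HasFDerivAt (fun y : (Fin k → ℝ) × E => y.1 i)
          ((ContinuousLinearMap.proj (R := ℝ) (φ := fun _ : Fin k => ℝ) i).comp
            (ContinuousLinearMap.fst ℝ (Fin k → ℝ) E)) (φ p t) :=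
        ((ContinuousLinearMap.proj (R := ℝ) (φ := fun _ : Fin k => ℝ) i).comp
            (ContinuousLinearMap.fst ℝ (Fin k → ℝ) E)).hasFDerivAt
      have h9 : HasFDerivAt (fun y : (Fin k → ℝ) × E => G i y.2)
          ((fderiv ℝ (G i) (φ p t).2).comp (ContinuousLinearMap.snd ℝ _ _)) (φ p t) :=
        HasFDerivAt.comp (φ p t) ((((hG i).contDiffAt (hU.mem_nhds hz)).differentiableAt
          (by simp)).hasFDerivAt) hasFDerivAt_snd
      exact h8.smul h9
    have h10 : HasFDerivAt (fun y => v (t, y)) _ (φ p t) :=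
      (hasFDerivAt_const (0 : Fin k → ℝ) (φ p t)).prodMk h6
    rw [h10.fderiv] at h5
    refine (h5.congr_of_mem (fun s hs => hdsnd p hp s hs q) ht).congr_deriv ?_
    rw [hdsnd p hp t ht, combination_apply, ← hdfst p hp t ht q, hfst p hp t ht]
    simp only [ContinuousLinearMap.prod_apply, _root_.sum_apply, _root_.add_apply,
      _root_.smul_apply, ContinuousLinearMap.comp_apply, ContinuousLinearMap.coe_snd',
      ContinuousLinearMap.coe_fst', ContinuousLinearMap.smulRight_apply,
      ContinuousLinearMap.proj_apply, Finset.sum_add_distrib]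

/-- The projection onto `V` along `H`. -/
def projAlong {V H : Submodule ℝ E} (h : IsCompl V H) : E →L[ℝ] E :=
  LinearMap.toContinuousLinearMap (V.projection H h)

lemma projAlong_mem {V H : Submodule ℝ E} (h : IsCompl V H) (x : E) : projAlong h x ∈ V :=
  Submodule.projection_apply_mem h x

lemma projAlong_of_mem_left {V H : Submodule ℝ E} (h : IsCompl V H) {x : E} (hx : x ∈ V) :
    projAlong h x = x := Submodule.projection_apply_of_mem_left h hx

lemma projAlong_eq_zero_iff {V H : Submodule ℝ E} (h : IsCompl V H) {x : E} :
    projAlong h x = 0 ↔ x ∈ H := Submodule.projection_apply_eq_zero_iff h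

lemma sub_projAlong_mem {V H : Submodule ℝ E} (h : IsCompl V H) (x : E) : x - projAlong h x ∈ H :=
  Submodule.sub_projection_mem h x

/-- A linear choice of coefficients for the vectors in the span of the values at `a₀`. -/
lemma exists_coefficients {a₀ : E} {V H : Submodule ℝ E} (hVH : IsCompl V H)
    (hH : H = Submodule.span ℝ (range fun i => G i a₀)) :
    ∃ ρ : E →ₗ[ℝ] Fin k → ℝ, (∀ x ∈ V, ρ x = 0) ∧
      ∀ x, combination G a₀ (ρ x) = x - projAlong hVH x := by
  set A : (Fin k → ℝ) →ₗ[ℝ] E := (combination G a₀ : (Fin k → ℝ) →ₗ[ℝ] E)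
  obtain ⟨g, hg⟩ := LinearMap.exists_rightInverse_of_surjective A.rangeRestrict
    A.range_rangeRestrict
  have hAH : H = LinearMap.range A := by rw [hH, range_combination]
  subst hAH
  refine ⟨g.comp (Submodule.projectionOnto _ _ hVH.symm), fun x hx => ?_, fun x => ?_⟩
  · rw [LinearMap.comp_apply, (Submodule.projectionOnto_apply_eq_zero_iff hVH.symm).2 hx,
      map_zero]
  · have h2 := congrArg Subtype.val (LinearMap.congr_fun hg
      (Submodule.projectionOnto _ _ hVH.symm x))
    refine Eq.trans h2 ?_
    rw [LinearMap.id_apply, Submodule.coe_projectionOnto_apply,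
      Submodule.projection_eq_self_sub_projection]
    rfl

/-- Straightening of an involutive family of vector fields: there are coordinates in which the span
of the fields contains a fixed subspace `H` everywhere, and is equal to `H` along `H`. They can be
chosen to be the given ones on a complement `V`. -/
theorem exists_straightening (hU : IsOpen U) {a₀ : E} (ha₀ : a₀ ∈ U)
    (hG : ∀ i, ContDiffOn ℝ ∞ (G i) U) (hcf : ∀ i j l, ContinuousOn (cf i j l) U)
    (hbr : ∀ a ∈ U, ∀ i j, fderiv ℝ (G j) a (G i a) - fderiv ℝ (G i) a (G j a) =
      ∑ l, cf i j l a • G l a) {V H : Submodule ℝ E} (hVH : IsCompl V H)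
    (hH : H = Submodule.span ℝ (range fun i => G i a₀)) :
    ∃ Ψ : OpenPartialHomeomorph E E, a₀ ∈ Ψ.source ∧ Ψ a₀ = a₀ ∧ Ψ.target ⊆ U ∧
      ContDiffOn ℝ ∞ Ψ Ψ.source ∧ ContDiffOn ℝ ∞ Ψ.symm Ψ.target ∧
      (∀ x ∈ Ψ.source, x - a₀ ∈ V → Ψ x = x) ∧
      (∀ x ∈ Ψ.source, ∀ h ∈ H, fderiv ℝ Ψ x h ∈ Submodule.span ℝ (range fun i => G i (Ψ x))) ∧
      ∀ x ∈ Ψ.source, x - a₀ ∈ H → Module.finrank ℝ (Submodule.span ℝ (range fun i => G i (Ψ x))) ≤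
        Module.finrank ℝ H := by
  have h0 : (0 : ℝ) ∈ Icc (0 : ℝ) 1 := left_mem_Icc.2 zero_le_one
  have h1 : (1 : ℝ) ∈ Icc (0 : ℝ) 1 := right_mem_Icc.2 zero_le_one
  obtain ⟨ρ, hρV, hρA⟩ := exists_coefficients hVH hH
  set π := projAlong hVH
  set ρ' : E →L[ℝ] Fin k → ℝ := LinearMap.toContinuousLinearMap ρ
  have hρ' : ∀ x, ρ' x = ρ x := fun _ => rfl
  set θ : E →L[ℝ] (Fin k → ℝ) × E := ρ'.prod π
  -- The point `x` is encoded by the coefficients `ρ (x - a₀)` of its `H`-component and by the point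
  -- `a₀ + π (x - a₀)` of the transversal. The straightening `Φ` starts at that point and flows for
  -- unit time along the combination with these coefficients.
  set Θ : E → (Fin k → ℝ) × E := fun x => θ (x - a₀) + (0, a₀) with hΘ
  have hΘs : ContDiff ℝ ∞ Θ := by fun_prop
  have hΘd : ∀ x, HasFDerivAt Θ θ x := fun x =>
    (θ.hasFDerivAt.comp x ((hasFDerivAt_id x).sub_const a₀)).add_const _
  have hΘa : Θ a₀ = (0, a₀) := by simp [hΘ]
  obtain ⟨N, hN, haN, ζ, hζs, hζ⟩ := exists_parametrised_flow hU ha₀ hG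
  set Φ : E → E := fun x => ζ (Θ x) 1
  have hΩ : IsOpen (Θ ⁻¹' N) := hN.preimage hΘs.continuous
  have hΦs : ContDiffOn ℝ ∞ Φ (Θ ⁻¹' N) := (hζs 1 h1).comp hΘs.contDiffOn fun x hx => hx
  have hΦd : ∀ x ∈ Θ ⁻¹' N, HasFDerivAt Φ ((fderiv ℝ (fun p => ζ p 1) (Θ x)).comp θ) x :=
    fun x hx => HasFDerivAt.comp x ((((hζs 1 h1).contDiffAt (hN.mem_nhds hx)).differentiableAt
      (by simp)).hasFDerivAt) (hΘd x)
  have hconst : ∀ p ∈ N, p.1 = 0 → ∀ t ∈ Icc (0 : ℝ) 1, ζ p t = p.2 := by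
    intro p hp hp0 t ht
    obtain ⟨e1, e2, -⟩ := hζ p hp
    refine eq_of_hasDerivWithinAt_eq (convex_Icc (0 : ℝ) 1) (f' := fun _ => 0) (g := fun _ => p.2)
      (fun t ht => ?_) (fun t _ => hasDerivWithinAt_const _ _ _) h0 ht e1
    simpa [hp0] using (e2 t ht).2
  have haΩ : a₀ ∈ Θ ⁻¹' N := by rw [mem_preimage, hΘa]; exact haN
  have hV : ∀ x ∈ Θ ⁻¹' N, x - a₀ ∈ V → Φ x = x := by
    intro x hx hxV
    have e : Θ x = (0, x) := by
      change (ρ (x - a₀) + 0, projAlong hVH (x - a₀) + a₀) = (0, x)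
      rw [hρV _ hxV, projAlong_of_mem_left hVH hxV, add_zero, sub_add_cancel]
    have := hconst _ hx (by rw [e]) 1 h1
    rw [e] at this
    change ζ (Θ x) 1 = x
    rw [e, this]
  -- At `u = 0` the flow is constant, and the variational equation at `a₀` has the constant
  -- right-hand side `combination G a₀ (ρ ξ) = ξ - π ξ`. Starting from `π ξ`, its solution reaches
  -- `ξ` at time one.
  have hid : HasFDerivAt Φ (ContinuousLinearEquiv.refl ℝ E : E →L[ℝ] E) a₀ := by
    refine (hΦd a₀ haΩ).congr_fderiv (ContinuousLinearMap.ext fun ξ => ?_)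
    rw [hΘa]
    obtain ⟨e1, e2⟩ := (hζ (0, a₀) haN).2.2 (θ ξ)
    have e3 := eq_of_hasDerivWithinAt_eq (convex_Icc (0 : ℝ) 1)
      (g := fun t => π ξ + t • (ξ - π ξ)) (f' := fun _ => ξ - π ξ) (fun t ht => by
        have := e2 t ht
        rw [hconst (0, a₀) haN rfl t ht] at this
        refine this.congr_deriv ?_
        change _ + combination G a₀ (ρ ξ) = _
        simp [hρA])
      (fun t _ => by
        simpa using ((hasDerivWithinAt_id t (Icc (0 : ℝ) 1)).smul_const (ξ - π ξ)).const_add (π ξ))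
      h0 h1 (by rw [e1]; simp [θ])
    refine Eq.trans e3 ?_
    simp
  obtain ⟨Ψ, h2, h3, h4, h5⟩ := exists_smooth_localInverse hΩ hΦs haΩ _ hid
  have hΨ : (Ψ : E → E) = Φ := funext h4
  refine ⟨Ψ, h2, ?_, ?_, ?_, h5, ?_, ?_, ?_⟩
  · rw [hΨ]
    exact hV a₀ haΩ (by simp)
  · intro y hy
    rw [← Ψ.right_inv hy, hΨ]
    exact ((hζ _ (h3 (Ψ.map_target hy))).2.1 1 h1).1
  · rw [hΨ]
    exact hΦs.mono h3
  · rw [hΨ]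
    exact fun x hx => hV x (h3 hx)
  · rw [hΨ]
    intro x hx h hh
    rw [(hΦd x (h3 hx)).fderiv]
    obtain ⟨-, e1, e2⟩ := hζ _ (h3 hx)
    obtain ⟨e3, e4⟩ := e2 (θ h)
    -- For `h` in `H` the initial point does not vary, since `π h = 0`; only the coefficients do.
    exact variation_mem_span hU hG hcf hbr e1
      (e3.trans ((projAlong_eq_zero_iff hVH).2 hh)) e4
  · rw [hΨ]
    intro x hx hxH
    obtain ⟨e0, e1, -⟩ := hζ _ (h3 hx)
    have := finrank_span_le_of_curve hU hG hcf hbr e1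
    rw [e0] at this
    -- For `x - a₀` in `H` the flow line starts at `a₀`, where the span is `H`.
    have e : (Θ x).2 = a₀ := by
      change projAlong hVH (x - a₀) + a₀ = a₀
      rw [(projAlong_eq_zero_iff hVH).2 hxH, zero_add]
    rw [e, ← hH] at this
    exact this

end Straightening

variable {n : ℕ} {M : Type*} [TopologicalSpace M] [ChartedSpace (Eu n) M]
  [IsManifold (𝓡 n) ∞ M]

/-! ### Vector fields in charts -/

section Charts

/-- The derivative of a chart. -/
def chartDeriv (e : OpenPartialHomeomorph M (Eu n)) (z : M) : TangentSpace (𝓡 n) z →L[ℝ] Eu n :=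
  mfderiv (𝓡 n) 𝓘(ℝ, Eu n) e z

/-- The derivative of an inverse chart. -/
def chartSymmDeriv (e : OpenPartialHomeomorph M (Eu n)) (a : Eu n) :
    Eu n →L[ℝ] TangentSpace (𝓡 n) (e.symm a) :=
  mfderiv 𝓘(ℝ, Eu n) (𝓡 n) e.symm a

/-- The expression of a vector field in a chart. -/
def chartRep (e : OpenPartialHomeomorph M (Eu n)) (X : VF n M) (a : Eu n) : Eu n :=
  chartDeriv e (e.symm a) (X (e.symm a))

variable {e : OpenPartialHomeomorph M (Eu n)} (he : e ∈ IsManifold.maximalAtlas (𝓡 n) ∞ M)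

include he

lemma chart_mdifferentiable : e.MDifferentiable (𝓡 n) 𝓘(ℝ, Eu n) :=
  ⟨(contMDiffOn_of_mem_maximalAtlas he).mdifferentiableOn (by simp),
    (contMDiffOn_symm_of_mem_maximalAtlas he).mdifferentiableOn (by simp)⟩

lemma chart_contMDiffOn : ContMDiffOn (𝓡 n) 𝓘(ℝ, Eu n) ∞ e e.source :=
  contMDiffOn_of_mem_maximalAtlas he

lemma chart_symm_contMDiffOn : ContMDiffOn 𝓘(ℝ, Eu n) (𝓡 n) ∞ e.symm e.target :=
  contMDiffOn_symm_of_mem_maximalAtlas he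

lemma hasMFDerivAt_chart {z : M} (hz : z ∈ e.source) :
    HasMFDerivAt (𝓡 n) 𝓘(ℝ, Eu n) e z (chartDeriv e z) :=
  ((chart_mdifferentiable he).mdifferentiableAt hz).hasMFDerivAt

lemma hasMFDerivAt_chart_symm {a : Eu n} (ha : a ∈ e.target) :
    HasMFDerivAt 𝓘(ℝ, Eu n) (𝓡 n) e.symm a (chartSymmDeriv e a) :=
  ((chart_mdifferentiable he).mdifferentiableAt_symm ha).hasMFDerivAt

lemma chartDeriv_chartSymmDeriv {a : Eu n} (ha : a ∈ e.target) (w : Eu n) :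
    chartDeriv e (e.symm a) (chartSymmDeriv e a w) = w :=
  DFunLike.congr_fun ((chart_mdifferentiable he).comp_symm_deriv ha) w

lemma chartDeriv_injective {z : M} (hz : z ∈ e.source) : Function.Injective (chartDeriv e z) :=
  (chart_mdifferentiable he).mfderiv_injective hz

lemma chartDeriv_surjective {z : M} (hz : z ∈ e.source) : Function.Surjective (chartDeriv e z) :=
  (chart_mdifferentiable he).mfderiv_surjective hz

lemma contDiffOn_chartRep {A : Set ℝ} {B : Set M} {X : ℝ → VF n M}
    (hX : SmoothFamilyOn (A ×ˢ B) X) :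
    ContDiffOn ℝ ∞ (fun q : ℝ × Eu n => chartRep e (X q.1) q.2)
      (A ×ˢ (e.target ∩ e.symm ⁻¹' B)) := by
  have h1 : ContMDiffOn (𝓘(ℝ, ℝ).prod 𝓘(ℝ, Eu n)) (𝓘(ℝ, ℝ).prod (𝓡 n)) ∞
      (fun q : ℝ × Eu n => (q.1, e.symm q.2)) (A ×ˢ (e.target ∩ e.symm ⁻¹' B)) :=
    contMDiffOn_fst.prodMk ((chart_symm_contMDiffOn he).comp contMDiffOn_snd fun q hq => hq.2.1)
  have h2 := hX.comp h1 fun q hq => ⟨hq.1, hq.2.2⟩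
  have h3 := (chart_contMDiffOn he).contMDiffOn_tangentMapWithin (m := ∞) (by simp)
    e.open_source.uniqueMDiffOn
  have h4 := h3.comp h2 fun q hq => e.map_target hq.2.1
  have h5 : ContMDiffOn (𝓘(ℝ, ℝ).prod 𝓘(ℝ, Eu n)) 𝓘(ℝ, Eu n) ∞
      (fun q : ℝ × Eu n => chartRep e (X q.1) q.2) (A ×ˢ (e.target ∩ e.symm ⁻¹' B)) := by
    refine ((contMDiff_snd_tangentBundle_modelSpace (n := ∞) (Eu n)
      𝓘(ℝ, Eu n)).comp_contMDiffOn h4).congr fun q hq => ?_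
    have : mfderivWithin (𝓡 n) 𝓘(ℝ, Eu n) e e.source (e.symm q.2) =
        mfderiv (𝓡 n) 𝓘(ℝ, Eu n) e (e.symm q.2) :=
      mfderivWithin_of_isOpen e.open_source (e.map_target hq.2.1)
    change mfderiv (𝓡 n) 𝓘(ℝ, Eu n) e (e.symm q.2) _ =
      mfderivWithin (𝓡 n) 𝓘(ℝ, Eu n) e e.source (e.symm q.2) _
    rw [this]
    rfl
  rw [← modelWithCornersSelf_prod, chartedSpaceSelf_prod] at h5
  exact contMDiffOn_iff_contDiffOn.1 h5

lemma smoothFamilyOn_const {A : Set ℝ} {B : Set M} {X : VF n M} (hX : SmoothOn B X) :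
    SmoothFamilyOn (A ×ˢ B) (fun _ => X) :=
  ContMDiffOn.comp hX contMDiffOn_snd fun _ hq => hq.2

lemma contDiffOn_chartRep_const {B : Set M} {X : VF n M} (hX : SmoothOn B X) :
    ContDiffOn ℝ ∞ (chartRep e X) (e.target ∩ e.symm ⁻¹' B) := by
  have h1 := contDiffOn_chartRep he (smoothFamilyOn_const he (A := univ) hX)
  have h2 : ContDiff ℝ ∞ (fun a : Eu n => ((0 : ℝ), a)) := by fun_prop
  exact h1.comp h2.contDiffOn fun a ha => ⟨trivial, ha⟩

/-- Vector fields given by smooth functions in a chart. -/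
lemma smoothOn_of_chart {w : Eu n → Eu n} {W : Set (Eu n)} (hw : ContDiffOn ℝ ∞ w W)
    {X : VF n M} {B : Set M} (hB : B ⊆ e.source) (hBW : ∀ z ∈ B, e z ∈ W)
    (hX : ∀ z ∈ B, chartDeriv e z (X z) = w (e z)) : SmoothOn B X := by
  have h1 : ContMDiffOn 𝓘(ℝ, Eu n) (𝓘(ℝ, Eu n)).tangent ∞
      (fun a => (⟨a, w a⟩ : TangentBundle 𝓘(ℝ, Eu n) (Eu n))) W :=
    contMDiffOn_vectorSpace_iff_contDiffOn.2 hw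
  have h2 := h1.comp ((chart_contMDiffOn he).mono hB) hBW
  have h3 := (chart_symm_contMDiffOn he).contMDiffOn_tangentMapWithin (m := ∞) (by simp)
    e.open_target.uniqueMDiffOn
  have h4 := h3.comp h2 fun z hz => e.map_source (hB hz)
  refine h4.congr fun z hz => ?_
  have hz' : e z ∈ e.target := e.map_source (hB hz)
  have h5 : mfderivWithin 𝓘(ℝ, Eu n) (𝓡 n) e.symm e.target (e z) =
      mfderiv 𝓘(ℝ, Eu n) (𝓡 n) e.symm (e z) :=
    mfderivWithin_of_isOpen e.open_target hz'
  -- The equality `e.symm (e z) = z` cannot be rewritten inside a tangent fibre. Generalising the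
  -- base point makes it possible to eliminate it; the same device recurs below.
  have key : ∀ z' : M, z' = z → ∀ Y : TangentSpace (𝓡 n) z', chartDeriv e z' Y = w (e z) →
      (⟨z, X z⟩ : TangentBundle (𝓡 n) M) = ⟨z', Y⟩ := by
    rintro z' rfl Y hY
    congr 1
    exact chartDeriv_injective he (hB hz) ((hX _ hz).trans hY.symm)
  refine key _ (e.left_inv (hB hz)) _ ?_
  change chartDeriv e (e.symm (e z)) (mfderivWithin 𝓘(ℝ, Eu n) (𝓡 n) e.symm e.target (e z) _) = _
  rw [h5]
  exact chartDeriv_chartSymmDeriv he hz' _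

/-- Integral curves in charts. -/
lemma hasDerivWithinAt_chart_comp {X : VF n M} {c : ℝ → M} {s : Set ℝ} {t : ℝ}
    (hct : c t ∈ e.source) (hc : HasMFDerivWithinAt 𝓘(ℝ, ℝ) (𝓡 n) c s t
      ((1 : ℝ →L[ℝ] ℝ).smulRight (X (c t)))) :
    HasDerivWithinAt (e ∘ c) (chartRep e X (e (c t))) s t := by
  have h1 : HasMFDerivWithinAt 𝓘(ℝ, ℝ) 𝓘(ℝ, Eu n) (e ∘ c) s t _ :=
    HasMFDerivAt.comp_hasMFDerivWithinAt t (hasMFDerivAt_chart he hct) hc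
  have h2 : HasFDerivWithinAt (e ∘ c)
      ((chartDeriv e (c t)).comp ((1 : ℝ →L[ℝ] ℝ).smulRight (X (c t))) : ℝ →L[ℝ] Eu n) s t :=
    hasMFDerivWithinAt_iff_hasFDerivWithinAt.1 h1
  refine HasDerivWithinAt.congr_deriv (F := Eu n) h2.hasDerivWithinAt ?_
  have key : ∀ z' : M, z' = c t → chartDeriv e (c t) (X (c t)) = chartDeriv e z' (X z') := by
    rintro z' rfl; rfl
  refine Eq.trans ?_ (key _ (e.left_inv hct))
  change chartDeriv e (c t) ((1 : ℝ) • X (c t)) = _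
  rw [one_smul]

lemma hasMFDerivWithinAt_chart_symm_comp {X : VF n M} {c : ℝ → Eu n} {s : Set ℝ} {t : ℝ}
    (hct : c t ∈ e.target) (hc : HasDerivWithinAt c (chartRep e X (c t)) s t) :
    HasMFDerivWithinAt 𝓘(ℝ, ℝ) (𝓡 n) (e.symm ∘ c) s t
      ((1 : ℝ →L[ℝ] ℝ).smulRight (X (e.symm (c t)))) := by
  have h0 : HasFDerivWithinAt c ((1 : ℝ →L[ℝ] ℝ).smulRight (chartRep e X (c t))) s t :=
    hc.hasFDerivWithinAt
  have h1 : HasMFDerivWithinAt 𝓘(ℝ, ℝ) 𝓘(ℝ, Eu n) c s t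
      ((1 : ℝ →L[ℝ] ℝ).smulRight (chartRep e X (c t))) :=
    hasMFDerivWithinAt_iff_hasFDerivWithinAt.2 h0
  have h2 := HasMFDerivAt.comp_hasMFDerivWithinAt t (hasMFDerivAt_chart_symm he hct) h1
  have h3 : ((1 : ℝ →L[ℝ] ℝ).smulRight (X (e.symm (c t))) :
      ℝ →L[ℝ] TangentSpace (𝓡 n) (e.symm (c t))) =
      (chartSymmDeriv e (c t)).comp ((1 : ℝ →L[ℝ] ℝ).smulRight (chartRep e X (c t))) := by
    apply ContinuousLinearMap.ext
    intro r
    have h4 : X (e.symm (c t)) = chartSymmDeriv e (c t) (chartRep e X (c t)) :=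
      chartDeriv_injective he (e.map_target hct) (chartDeriv_chartSymmDeriv he hct _).symm
    change r • X (e.symm (c t)) = chartSymmDeriv e (c t) (r • chartRep e X (c t))
    rw [h4, ContinuousLinearMap.map_smul]
  rw [h3]
  exact h2

/-- Brackets in charts. -/
lemma chartRep_mlieBracket {O : Opens M} {X Y : VF n M} (hX : SmoothOn (O : Set M) X)
    (hY : SmoothOn (O : Set M) Y) {a : Eu n} (ha : a ∈ e.target) (haO : e.symm a ∈ O) :
    chartRep e (VectorField.mlieBracket (𝓡 n) X Y) a =
      fderiv ℝ (chartRep e Y) a (chartRep e X a) - fderiv ℝ (chartRep e X) a (chartRep e Y a) := by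
  have : IsManifold (𝓡 n) (minSmoothness ℝ 2) M := by
    rw [minSmoothness_of_isRCLikeNormedField]
    exact IsManifold.of_le (n := ∞) (by exact WithTop.coe_le_coe.2 (le_top : (2 : ℕ∞) ≤ ⊤))
  have : IsManifold (𝓡 n) (minSmoothness ℝ 3) M := by
    rw [minSmoothness_of_isRCLikeNormedField]
    exact IsManifold.of_le (n := ∞) (by exact WithTop.coe_le_coe.2 (le_top : (3 : ℕ∞) ≤ ⊤))
  -- The expression in a chart is the pullback along the inverse chart, and pullback commutes with
  -- brackets.
  have hpb : ∀ (Z : VF n M), ∀ b ∈ e.target,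
      VectorField.mpullback 𝓘(ℝ, Eu n) (𝓡 n) e.symm Z b = chartRep e Z b := by
    intro Z b hb
    have hinv : (mfderiv 𝓘(ℝ, Eu n) (𝓡 n) e.symm b).IsInvertible :=
      ⟨(chart_mdifferentiable he).symm.mfderiv hb, rfl⟩
    rw [VectorField.mpullback_apply]
    have h1 := chartDeriv_chartSymmDeriv he hb
      ((mfderiv 𝓘(ℝ, Eu n) (𝓡 n) e.symm b).inverse (Z (e.symm b)))
    refine h1.symm.trans (congrArg (chartDeriv e (e.symm b)) ?_)
    exact hinv.self_apply_inverse _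
  have hnear : ∀ Z : VF n M, VectorField.mpullback 𝓘(ℝ, Eu n) (𝓡 n) e.symm Z =ᶠ[𝓝 a]
      chartRep e Z := fun Z =>
    Filter.mem_of_superset (e.open_target.mem_nhds ha) fun b hb => hpb Z b hb
  have hd : ∀ Z : VF n M, SmoothOn (O : Set M) Z →
      MDifferentiableAt (𝓡 n) (𝓡 n).tangent (fun x => (⟨x, Z x⟩ : TangentBundle (𝓡 n) M))
        (e.symm a) := fun Z hZ =>
    (ContMDiffOn.contMDiffAt hZ (O.isOpen.mem_nhds haO)).mdifferentiableAt (by simp)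
  have h1 := VectorField.mpullback_mlieBracket (I := 𝓘(ℝ, Eu n)) (I' := 𝓡 n) (f := e.symm)
    (x₀ := a) (n := ∞) (hd X hX) (hd Y hY)
    ((chart_symm_contMDiffOn he).contMDiffAt (e.open_target.mem_nhds ha))
    (by rw [minSmoothness_of_isRCLikeNormedField]; exact WithTop.coe_le_coe.2 (le_top : (2 : ℕ∞) ≤ ⊤))
  rw [hpb _ a ha] at h1
  rw [h1, Filter.EventuallyEq.mlieBracket_vectorField_eq (hnear X) (hnear Y)]
  have h2 := congrFun (VectorField.mlieBracketWithin_eq_lieBracketWithin (𝕜 := ℝ) (E := Eu n)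
    (V := chartRep e X) (W := chartRep e Y) (s := univ)) a
  have h3 := congrFun (VectorField.mlieBracketWithin_univ (I := 𝓘(ℝ, Eu n))
    (V := chartRep e X) (W := chartRep e Y)) a
  have h4 := congrFun (VectorField.lieBracketWithin_univ (𝕜 := ℝ)
    (V := chartRep e X) (W := chartRep e Y)) a
  exact h3.symm.trans (h2.trans h4)

end Charts

/-! ### Gronwall estimates -/

section Gronwall

variable {E : Type*} [NormedAddCommGroup E] [NormedSpace ℝ E] {a b K : ℝ} {f f' : ℝ → E}

lemma norm_le_mul_exp_right (hf : ∀ t ∈ Icc a b, HasDerivWithinAt f (f' t) (Icc a b) t)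
    (hK : ∀ t ∈ Icc a b, ‖f' t‖ ≤ K * ‖f t‖) {s t : ℝ} (hs : s ∈ Icc a b) (ht : t ∈ Icc a b)
    (hst : s ≤ t) : ‖f t‖ ≤ ‖f s‖ * Real.exp (K * (t - s)) := by
  have hsub : Icc s t ⊆ Icc a b := Icc_subset_Icc hs.1 ht.2
  have h := norm_le_gronwallBound_of_norm_deriv_right_le (f := f) (f' := f') (δ := ‖f s‖) (K := K)
    (ε := 0) (a := s) (b := t) (fun r hr => ((hf r (hsub hr)).mono hsub).continuousWithinAt)
    (fun r hr => ((hf r (hsub (Ico_subset_Icc_self hr))).mono hsub).mono_of_mem_nhdsWithin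
      (Icc_mem_nhdsGE_of_mem hr)) le_rfl
    (fun r hr => by rw [add_zero]; exact hK r (hsub (Ico_subset_Icc_self hr))) t
    (right_mem_Icc.2 hst)
  rwa [gronwallBound_ε0] at h

/-- The estimate backwards in time is the forward estimate for the reflected curve `r ↦ f (-r)`. -/
lemma norm_le_mul_exp (hf : ∀ t ∈ Icc a b, HasDerivWithinAt f (f' t) (Icc a b) t)
    (hK : ∀ t ∈ Icc a b, ‖f' t‖ ≤ K * ‖f t‖) {s t : ℝ} (hs : s ∈ Icc a b) (ht : t ∈ Icc a b) :
    ‖f t‖ ≤ ‖f s‖ * Real.exp (K * |t - s|) := by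
  rcases le_total s t with hst | hst
  · rw [abs_of_nonneg (sub_nonneg.2 hst)]
    exact norm_le_mul_exp_right hf hK hs ht hst
  · have hmem : ∀ r ∈ Icc (-b) (-a), -r ∈ Icc a b := fun r hr =>
      ⟨by linarith [hr.2], by linarith [hr.1]⟩
    have h := norm_le_mul_exp_right (f := fun r => f (-r)) (f' := fun r => -f' (-r))
      (a := -b) (b := -a) (K := K) (s := -s) (t := -t) (fun r hr => by
        have h1 := (hf (-r) (hmem r hr)).scomp r (hasDerivAt_neg r).hasDerivWithinAt hmem
        simpa [Function.comp_def] using h1)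
      (fun r hr => by rw [norm_neg]; exact hK _ (hmem r hr))
      ⟨by linarith [hs.2], by linarith [hs.1]⟩ ⟨by linarith [ht.2], by linarith [ht.1]⟩
      (by linarith)
    simp only [neg_neg] at h
    rw [abs_of_nonpos (sub_nonpos.2 hst)]
    convert h using 3
    ring

lemma exists_lipschitzOnWith_of_contDiffOn {G : Type*} [NormedAddCommGroup G] [NormedSpace ℝ G]
    {g : E → G} {s : Set E} (hg : ContDiffOn ℝ ∞ g s) (hs : Convex ℝ s) (hc : IsCompact s) :
    ∃ K, LipschitzOnWith K g s := by
  refine LocallyLipschitzOn.exists_lipschitzOnWith_of_compact hc fun x hx => ?_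
  exact ((hg x hx).of_le (by exact_mod_cast le_top)).exists_lipschitzOnWith hs

end Gronwall

namespace SingularFoliation

variable {n : ℕ} {M : Type*} [TopologicalSpace M] [ChartedSpace (Eu n) M]
  [IsManifold (𝓡 n) ∞ M]

/-! ### Flow lines -/

section FlowLines

variable {A A' O : Set M} {X : ℝ → VF n M} {a b a' b' s t r : ℝ} {c c' γ : ℝ → M}

lemma IsFlowLine.symm (h : IsFlowLine A X a b c) : IsFlowLine A X b a c := by
  unfold IsFlowLine at h ⊢
  rwa [uIcc_comm]

lemma IsFlowLine.mono (h : IsFlowLine A X a b c) (hA : A ⊆ A') : IsFlowLine A' X a b c :=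
  fun t ht => ⟨hA (h t ht).1, (h t ht).2⟩

lemma IsFlowLine.subinterval (h : IsFlowLine A X a b c) (hs : uIcc a' b' ⊆ uIcc a b) :
    IsFlowLine A X a' b' c :=
  fun t ht => ⟨(h t (hs ht)).1, (h t (hs ht)).2.mono hs⟩

lemma IsFlowLine.continuousOn (h : IsFlowLine A X a b c) : ContinuousOn c (uIcc a b) :=
  fun t ht => (h t ht).2.continuousWithinAt

lemma IsFlowLine.congr (h : IsFlowLine A X a b c) (hc : ∀ t ∈ uIcc a b, c' t = c t) :
    IsFlowLine A X a b c' := by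
  intro t ht
  rw [hc t ht]
  exact ⟨(h t ht).1, (h t ht).2.congr_mono hc (hc t ht) subset_rfl⟩

lemma IsFlowLine.restrict (h : IsFlowLine A X a b c) (hc : ∀ t ∈ uIcc a b, c t ∈ A') :
    IsFlowLine A' X a b c :=
  fun t ht => ⟨hc t ht, (h t ht).2⟩

lemma IsFlowLine.union (h : IsFlowLine A X r s c) (h' : IsFlowLine A X s t c)
    (hs : s ∈ uIcc r t) : IsFlowLine A X r t c := by
  have key : ∀ {r t : ℝ}, IsFlowLine A X r s c → IsFlowLine A X s t c → s ∈ uIcc r t →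
      ∀ u ∈ uIcc r s, c u ∈ A ∧ HasMFDerivWithinAt 𝓘(ℝ, ℝ) (𝓡 n) c (uIcc r t) u
        ((1 : ℝ →L[ℝ] ℝ).smulRight (X u (c u))) := by
    intro r t h h' hs u hu
    refine ⟨(h u hu).1, ?_⟩
    have hun : uIcc r t ⊆ uIcc r s ∪ uIcc s t := uIcc_subset_uIcc_union_uIcc
    by_cases hus : u ∈ uIcc s t
    · exact ((h u hu).2.union (h' u hus).2).mono hun
    -- Away from the second interval, the large interval is locally contained in the first one.
    · refine (h u hu).2.mono_of_mem_nhdsWithin ?_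
      filter_upwards [self_mem_nhdsWithin, mem_nhdsWithin_of_mem_nhds
        (isClosed_Icc.isOpen_compl.mem_nhds hus)] with v hv hv'
      exact (hun hv).resolve_right hv'
  intro u hu
  rcases uIcc_subset_uIcc_union_uIcc (b := s) hu with hu' | hu'
  · exact key h h' hs u hu'
  · have := key h'.symm h.symm (by rwa [uIcc_comm]) u (by rwa [uIcc_comm])
    rwa [uIcc_comm] at this

/-- Two flow lines that meet at time `s` can be joined there. -/
lemma IsFlowLine.glue (h : IsFlowLine A X r s c) (h' : IsFlowLine A X s t c')
    (hs : s ∈ uIcc r t) (hcc : c s = c' s) :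
    ∃ c'', IsFlowLine A X r t c'' ∧ c'' r = c r ∧ c'' t = c' t := by
  classical
  set d : ℝ → M := fun u => if u ∈ uIcc r s then c u else c' u with hd
  have h1 : ∀ u ∈ uIcc r s, d u = c u := fun u hu => if_pos hu
  have h2 : ∀ u ∈ uIcc s t, d u = c' u := by
    intro u hu
    by_cases hu' : u ∈ uIcc r s
    · have : u = s := by
        rcases le_total r t with hrt | hrt
        · rw [uIcc_of_le hrt] at hs
          rw [uIcc_of_le hs.1] at hu'
          rw [uIcc_of_le hs.2] at hu
          exact le_antisymm hu'.2 hu.1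
        · rw [uIcc_of_ge hrt] at hs
          rw [uIcc_of_ge hs.2] at hu'
          rw [uIcc_of_ge hs.1] at hu
          exact le_antisymm hu.2 hu'.1
      rw [this, h1 s right_mem_uIcc, hcc]
    · exact if_neg hu'
  exact ⟨d, (h.congr h1).union (h'.congr h2) hs, h1 r left_mem_uIcc, h2 t right_mem_uIcc⟩

lemma IsFlowLine.chart {e : OpenPartialHomeomorph M (Eu n)}
    (he : e ∈ IsManifold.maximalAtlas (𝓡 n) ∞ M) (h : IsFlowLine A X a b c)
    (hc : ∀ t ∈ uIcc a b, c t ∈ e.source) : ∀ t ∈ uIcc a b,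
      e (c t) ∈ e.target ∩ e.symm ⁻¹' A ∧
      HasDerivWithinAt (fun u => e (c u)) (chartRep e (X t) (e (c t))) (uIcc a b) t := by
  intro t ht
  refine ⟨⟨e.map_source (hc t ht), ?_⟩, hasDerivWithinAt_chart_comp he (hc t ht) (h t ht).2⟩
  rw [mem_preimage, e.left_inv (hc t ht)]
  exact (h t ht).1

/-- This serves to localise in time, in particular at the end points of `[a, b]`: the smaller
interval is a relative neighbourhood of `t` and still has positive length, as the statements about
differential equations require. -/
lemma exists_uIcc_mem_nhdsWithin {P : ℝ → Prop} (hab : a < b) (ht : t ∈ Icc a b)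
    (hP : ∀ᶠ u in 𝓝[Icc a b] t, P u) : ∃ a' b', a' < b' ∧ t ∈ Icc a' b' ∧ Icc a' b' ⊆ Icc a b ∧
      Icc a' b' ∈ 𝓝[Icc a b] t ∧ ∀ u ∈ Icc a' b', P u := by
  obtain ⟨ε, hε, h⟩ := Metric.mem_nhdsWithin_iff.1 hP
  have hmem : ∀ u, u ∈ Icc (max a (t - ε / 2)) (min b (t + ε / 2)) ↔
      u ∈ Icc a b ∧ u ∈ Icc (t - ε / 2) (t + ε / 2) := by
    intro u
    simp only [mem_Icc, max_le_iff, le_min_iff]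
    tauto
  refine ⟨max a (t - ε / 2), min b (t + ε / 2), ?_, ?_, fun u hu => ((hmem u).1 hu).1, ?_, ?_⟩
  · have := ht.1; have := ht.2
    rw [max_lt_iff, lt_min_iff, lt_min_iff]
    refine ⟨⟨hab, by linarith⟩, by linarith, by linarith⟩
  · exact (hmem t).2 ⟨ht, by constructor <;> linarith⟩
  · filter_upwards [self_mem_nhdsWithin, mem_nhdsWithin_of_mem_nhds
      (Icc_mem_nhds (show t - ε / 2 < t by linarith) (show t < t + ε / 2 by linarith))] with u h1 h2
    exact (hmem u).2 ⟨h1, h2⟩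
  · intro u hu
    obtain ⟨h1, h2⟩ := (hmem u).1 hu
    refine h ⟨?_, h1⟩
    rw [Metric.mem_ball, Real.dist_eq, abs_lt]
    constructor <;> linarith [h2.1, h2.2]

variable [T2Space M]

/-- Flow lines are determined by their value at one time. -/
lemma IsFlowLine.unique_Icc (hab : a < b) (hO : IsOpen O) (hX : SmoothFamilyOn (Icc a b ×ˢ O) X)
    (h : IsFlowLine O X a b c) (h' : IsFlowLine O X a b c') (hs : s ∈ Icc a b) (ht : t ∈ Icc a b)
    (hcs : c s = c' s) : c t = c' t := by
  have hu : uIcc a b = Icc a b := uIcc_of_le hab.le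
  have hcont := h.continuousOn
  have hcont' := h'.continuousOn
  rw [hu] at hcont hcont'
  -- It is enough that agreement of the two curves is a locally constant property of time, since the
  -- interval is connected. Disagreement is open because `M` is Hausdorff; agreement is open by the
  -- Gronwall estimate in a chart.
  suffices H : ∀ x ∈ Icc a b, ∀ᶠ y in 𝓝[Icc a b] x, c x = c' x ↔ c y = c' y by
    refine isPreconnected_Icc.induction₂' (fun x y => c x = c' x → c y = c' y) ?_ ?_ hs ht hcs
    · intro x hx
      filter_upwards [H x hx] with y hy using ⟨hy.1, hy.2⟩
    · intro x y z _ _ _ h1 h2 h3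
      exact h2 (h1 h3)
  intro x hx
  by_cases hcx : c x = c' x
  swap
  · filter_upwards [((hcont x hx).tendsto.prodMk_nhds (hcont' x hx).tendsto).eventually
      (isClosed_diagonal.isOpen_compl.mem_nhds
        (show (c x, c' x) ∈ (diagonal M)ᶜ from hcx))] with y hy
    exact iff_of_false hcx hy
  set e := chartAt (Eu n) (c x) with he_def
  have he : e ∈ IsManifold.maximalAtlas (𝓡 n) ∞ M := IsManifold.chart_mem_maximalAtlas _
  have hxe : c x ∈ e.source := mem_chart_source _ _
  have hU : IsOpen (e.target ∩ e.symm ⁻¹' O) := e.isOpen_inter_preimage_symm hO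
  have hxU : e (c x) ∈ e.target ∩ e.symm ⁻¹' O := by
    refine ⟨e.map_source hxe, ?_⟩
    rw [mem_preimage, e.left_inv hxe]
    exact (h x (hu ▸ hx)).1
  obtain ⟨ε, hε, hball⟩ := Metric.nhds_basis_closedBall.mem_iff.1 (hU.mem_nhds hxU)
  obtain ⟨K, hK⟩ := exists_lipschitzOnWith_of_contDiffOn
    ((contDiffOn_chartRep he hX).mono (prod_mono subset_rfl hball))
    ((convex_Icc a b).prod (convex_closedBall _ _)) (isCompact_Icc.prod (isCompact_closedBall _ _))
  have hN : e.source ∩ e ⁻¹' Metric.ball (e (c x)) ε ∈ 𝓝 (c x) :=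
    (e.isOpen_inter_preimage Metric.isOpen_ball).mem_nhds ⟨hxe, Metric.mem_ball_self hε⟩
  have hN' : e.source ∩ e ⁻¹' Metric.ball (e (c x)) ε ∈ 𝓝 (c' x) := by rwa [← hcx]
  obtain ⟨a', b', hab', hx', hsub, hnhds, hP⟩ := exists_uIcc_mem_nhdsWithin hab hx
    (((hcont x hx).eventually hN).and ((hcont' x hx).eventually hN'))
  have hu' : uIcc a' b' = Icc a' b' := uIcc_of_le hab'.le
  have hc1 := (h.subinterval (a' := a') (b' := b') (by rwa [hu', hu])).chart he
    fun t ht => (hP t (hu' ▸ ht)).1.1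
  have hc2 := (h'.subinterval (a' := a') (b' := b') (by rwa [hu', hu])).chart he
    fun t ht => (hP t (hu' ▸ ht)).2.1
  rw [hu'] at hc1 hc2
  filter_upwards [hnhds] with y hy
  refine iff_of_true hcx ?_
  have := norm_le_mul_exp (f := fun u => e (c u) - e (c' u)) (K := K)
    (fun t ht => (hc1 t ht).2.sub (hc2 t ht).2) (fun t ht => ?_) hx' hy
  · simp only [hcx, sub_self, norm_zero, zero_mul, norm_le_zero_iff, sub_eq_zero] at this
    exact e.injOn (hP y hy).1.1 (hP y hy).2.1 this
  · have := hK.dist_le_mul (t, e (c t)) ⟨hsub ht, Metric.ball_subset_closedBall (hP t ht).1.2⟩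
      (t, e (c' t)) ⟨hsub ht, Metric.ball_subset_closedBall (hP t ht).2.2⟩
    simpa [Prod.dist_eq, dist_eq_norm] using this

lemma IsFlowLine.unique (hO : IsOpen O) (hX : SmoothFamilyOn (uIcc a b ×ˢ O) X)
    (h : IsFlowLine O X a b c) (h' : IsFlowLine O X a b c') (hs : s ∈ uIcc a b) (ht : t ∈ uIcc a b)
    (hcs : c s = c' s) : c t = c' t := by
  rcases lt_trichotomy a b with hab | hab | hab
  · rw [uIcc_of_lt hab] at hX hs ht
    exact h.unique_Icc hab hO hX h' hs ht hcs
  · subst hab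
    rw [uIcc_self, mem_singleton_iff] at hs ht
    rwa [ht, ← hs]
  · rw [uIcc_of_gt hab] at hX hs ht
    exact h.symm.unique_Icc hab hO hX h'.symm hs ht hcs

omit [T2Space M] in
lemma flow_self (y : M) : flow A X t t y = y := by
  unfold flow
  split_ifs with h
  · exact h.choose_spec.2
  · rfl

omit [T2Space M] in
/-- Either the flow does not move a point, or it moves it along a flow line. -/
lemma flow_cases (A : Set M) (X : ℝ → VF n M) (t s : ℝ) (y : M) :
    flow A X t s y = y ∨ ∃ c, IsFlowLine A X s t c ∧ c s = y ∧ c t = flow A X t s y := by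
  unfold flow
  split_ifs with h
  · exact Or.inr ⟨h.choose, h.choose_spec.1, h.choose_spec.2, rfl⟩
  · exact Or.inl rfl

lemma IsFlowLine.flow_eq (hO : IsOpen O) (hX : SmoothFamilyOn (uIcc s t ×ˢ O) X)
    (h : IsFlowLine O X s t c) : flow O X t s (c s) = c t := by
  have hex : ∃ c', IsFlowLine O X s t c' ∧ c' s = c s := ⟨c, h, rfl⟩
  unfold flow
  rw [dif_pos hex]
  exact hex.choose_spec.1.unique hO hX h left_mem_uIcc right_mem_uIcc hex.choose_spec.2

/-- The times may come in any order. If `s` lies between `r` and `t`, the curves are glued.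
Otherwise one leg retraces the other, both agree on the overlap by uniqueness, and a restriction of
the longer one is the required curve. -/
lemma IsFlowLine.exists_trans (hO : IsOpen O)
    (hX : SmoothFamilyOn (Icc a b ×ˢ O) X) (hr : r ∈ Icc a b) (hs : s ∈ Icc a b) (ht : t ∈ Icc a b)
    (h : IsFlowLine O X r s c) (h' : IsFlowLine O X s t c') (hcc : c s = c' s) :
    ∃ c'', IsFlowLine O X r t c'' ∧ c'' r = c r ∧ c'' t = c' t := by
  have hsm : ∀ {x y : ℝ}, x ∈ Icc a b → y ∈ Icc a b → SmoothFamilyOn (uIcc x y ×ˢ O) X :=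
    fun hx hy => ContMDiffOn.mono hX (prod_mono (uIcc_subset_Icc hx hy) subset_rfl)
  by_cases h1 : s ∈ uIcc r t
  · exact h.glue h' h1 hcc
  have hcases : t ∈ uIcc r s ∨ r ∈ uIcc s t := by
    simp only [mem_uIcc] at h1 ⊢
    rcases le_total r s with h2 | h2 <;> rcases le_total s t with h3 | h3 <;>
      rcases le_total r t with h4 | h4 <;> tauto
  rcases hcases with h2 | h2
  · have hsub : uIcc s t ⊆ uIcc r s := uIcc_subset_uIcc right_mem_uIcc h2
    refine ⟨c, h.subinterval (uIcc_subset_uIcc left_mem_uIcc h2), rfl, ?_⟩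
    exact (h.subinterval hsub).unique hO (hsm hs ht) h' left_mem_uIcc right_mem_uIcc hcc
  · have hsub : uIcc r s ⊆ uIcc s t := uIcc_subset_uIcc h2 left_mem_uIcc
    refine ⟨c', h'.subinterval (uIcc_subset_uIcc h2 right_mem_uIcc), ?_, rfl⟩
    exact (h'.subinterval hsub).unique hO (hsm hr hs) h right_mem_uIcc left_mem_uIcc hcc.symm

/-- Near a point of a flow line, the flow is defined and smooth. -/
lemma exists_flow_nhds (hab : a < b) (hO : IsOpen O) (hX : SmoothFamilyOn (Icc a b ×ˢ O) X)
    (hγ : IsFlowLine O X a b γ) (hs : s ∈ Icc a b) (ht : t ∈ Icc a b) :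
    ∃ N : Set M, IsOpen N ∧ γ s ∈ N ∧ N ⊆ O ∧ ContMDiffOn (𝓡 n) (𝓡 n) ∞ (flow O X t s) N ∧
      ∀ z ∈ N, ∃ c, IsFlowLine O X s t c ∧ c s = z ∧ c t = flow O X t s z := by
  have hu : uIcc a b = Icc a b := uIcc_of_le hab.le
  have hsm : ∀ {x y : ℝ}, x ∈ Icc a b → y ∈ Icc a b → SmoothFamilyOn (uIcc x y ×ˢ O) X :=
    fun hx hy => ContMDiffOn.mono hX (prod_mono (uIcc_subset_Icc hx hy) subset_rfl)
  -- By uniqueness, any smooth map that follows flow lines coincides with `flow`, so one may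
  -- construct such a map freely.
  suffices H : ∃ N : Set M, IsOpen N ∧ γ s ∈ N ∧ ∃ φ : M → M, ContMDiffOn (𝓡 n) (𝓡 n) ∞ φ N ∧
      φ (γ s) = γ t ∧ ∀ z ∈ N, ∃ c, IsFlowLine O X s t c ∧ c s = z ∧ c t = φ z by
    obtain ⟨N, hN, hsN, φ, hφ, -, hc⟩ := H
    have heq : ∀ z ∈ N, flow O X t s z = φ z := by
      intro z hz
      obtain ⟨c, h1, h2, h3⟩ := hc z hz
      rw [← h3, ← h2]
      exact h1.flow_eq hO (hsm hs ht)
    refine ⟨N, hN, hsN, ?_, hφ.congr heq, fun z hz => ?_⟩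
    · intro z hz
      obtain ⟨c, h1, h2, h3⟩ := hc z hz
      rw [← h2]
      exact (h1 s left_mem_uIcc).1
    · obtain ⟨c, h1, h2, h3⟩ := hc z hz
      exact ⟨c, h1, h2, h3.trans (heq z hz).symm⟩
  -- For nearby times the map comes from smooth dependence in a chart. Composition then makes the
  -- property transitive in time, and connectedness extends it to all pairs of times.
  refine isPreconnected_Icc.induction₂' (s := Icc a b) (fun s t => ∃ N : Set M, IsOpen N ∧ γ s ∈ N ∧
    ∃ φ : M → M, ContMDiffOn (𝓡 n) (𝓡 n) ∞ φ N ∧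
      φ (γ s) = γ t ∧ ∀ z ∈ N, ∃ c, IsFlowLine O X s t c ∧ c s = z ∧ c t = φ z) ?_ ?_ hs ht
  · intro x hx
    set e := chartAt (Eu n) (γ x) with he_def
    have he : e ∈ IsManifold.maximalAtlas (𝓡 n) ∞ M := IsManifold.chart_mem_maximalAtlas _
    have hxe : γ x ∈ e.source := mem_chart_source _ _
    have hcont := hγ.continuousOn
    rw [hu] at hcont
    obtain ⟨a', b', hab', hx', hsub, hnhds, hP⟩ := exists_uIcc_mem_nhdsWithin hab hx
      ((hcont x hx).eventually (e.open_source.mem_nhds hxe))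
    have hu' : uIcc a' b' = Icc a' b' := uIcc_of_le hab'.le
    have hU : IsOpen (e.target ∩ e.symm ⁻¹' O) := e.isOpen_inter_preimage_symm hO
    have hc1 := (hγ.subinterval (a' := a') (b' := b') (by rwa [hu', hu])).chart he
      fun t ht => hP t (hu' ▸ ht)
    rw [hu'] at hc1
    have key : ∀ s ∈ Icc a' b', ∀ t ∈ Icc a' b', ∃ N : Set M, IsOpen N ∧ γ s ∈ N ∧
        ∃ φ : M → M, ContMDiffOn (𝓡 n) (𝓡 n) ∞ φ N ∧
        φ (γ s) = γ t ∧ ∀ z ∈ N, ∃ c, IsFlowLine O X s t c ∧ c s = z ∧ c t = φ z := by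
      intro s hs t ht
      obtain ⟨N, hN, hsN, φ, h1, h2, h3⟩ := exists_smooth_flow hab' hU
        ((contDiffOn_chartRep he hX).mono (prod_mono hsub subset_rfl)) hc1 hs
      refine ⟨e.source ∩ e ⁻¹' N, e.isOpen_inter_preimage hN, ⟨hP s hs, hsN⟩,
        fun z => e.symm (φ (e z) t), ?_, ?_, ?_⟩
      · refine (chart_symm_contMDiffOn he).comp ((h1 t ht).contMDiffOn.comp
          ((chart_contMDiffOn he).mono inter_subset_left) fun z hz => hz.2) fun z hz => ?_
        exact ((h3 _ hz.2).2.1 t ht).1.1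
      · change e.symm (φ (e (γ s)) t) = γ t
        rw [h2 t ht, e.left_inv (hP t ht)]
      · intro z hz
        obtain ⟨h4, h5, -⟩ := h3 _ hz.2
        have hst : uIcc s t ⊆ Icc a' b' := uIcc_subset_Icc hs ht
        refine ⟨fun u => e.symm (φ (e z) u), fun u hu => ?_, ?_, rfl⟩
        · refine ⟨(h5 u (hst hu)).1.2, ?_⟩
          exact hasMFDerivWithinAt_chart_symm_comp he (h5 u (hst hu)).1.1
            ((h5 u (hst hu)).2.mono hst)
        · change e.symm (φ (e z) s) = z
          rw [h4, e.left_inv hz.1]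
    filter_upwards [hnhds] with y hy
    exact ⟨key x hx' y hy, key y hy x hx'⟩
  · rintro x y z hx hy hz ⟨N, hN, hxN, φ, hφ, hφγ, hc⟩ ⟨N', hN', hyN', φ', hφ', hφγ', hc'⟩
    refine ⟨N ∩ φ ⁻¹' N', hφ.continuousOn.isOpen_inter_preimage hN hN', ⟨hxN, ?_⟩, φ' ∘ φ,
      hφ'.comp (hφ.mono inter_subset_left) fun z hz => hz.2, ?_, ?_⟩
    · rwa [mem_preimage, hφγ]
    · rw [Function.comp_apply, hφγ, hφγ']
    · intro w hw
      obtain ⟨c, h1, h2, h3⟩ := hc w hw.1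
      obtain ⟨c', h1', h2', h3'⟩ := hc' _ hw.2
      obtain ⟨c'', h4, h5, h6⟩ := h1.exists_trans hO hX hx hy hz h1' (h3.trans h2'.symm)
      exact ⟨c'', h4, h5.trans h2, h6.trans h3'⟩

lemma IsFlowLine.flow_apply (hab : a ≤ b) (hO : IsOpen O) (hX : SmoothFamilyOn (Icc a b ×ˢ O) X)
    (hγ : IsFlowLine O X a b γ) (hs : s ∈ Icc a b) (ht : t ∈ Icc a b) :
    flow O X t s (γ s) = γ t := by
  have hst := uIcc_subset_Icc hs ht
  refine (hγ.subinterval ?_).flow_eq hO (ContMDiffOn.mono hX (prod_mono hst subset_rfl))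
  rwa [uIcc_of_le hab]

/-- The flow is transitive. -/
lemma flow_flow (hab : a < b) (hO : IsOpen O) (hX : SmoothFamilyOn (Icc a b ×ˢ O) X)
    (hγ : IsFlowLine O X a b γ) (hr : r ∈ Icc a b) (hs : s ∈ Icc a b) (ht : t ∈ Icc a b) :
    ∀ᶠ z in 𝓝 (γ r), flow O X t s (flow O X s r z) = flow O X t r z := by
  obtain ⟨N, hN, hrN, -, hφ, hc⟩ := exists_flow_nhds hab hO hX hγ hr hs
  obtain ⟨N', hN', hsN', -, -, hc'⟩ := exists_flow_nhds hab hO hX hγ hs ht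
  have hcont : ContinuousAt (flow O X s r) (γ r) :=
    hφ.continuousOn.continuousAt (hN.mem_nhds hrN)
  have h1 : ∀ᶠ z in 𝓝 (γ r), flow O X s r z ∈ N' := by
    apply hcont.eventually_mem
    rw [hγ.flow_apply hab.le hO hX hr hs]
    exact hN'.mem_nhds hsN'
  filter_upwards [h1, hN.mem_nhds hrN] with z hz hzN
  obtain ⟨c, h1, h2, h3⟩ := hc z hzN
  obtain ⟨c', h1', h2', h3'⟩ := hc' _ hz
  obtain ⟨c'', h4, h5, h6⟩ := h1.exists_trans hO hX hr hs ht h1' (h3.trans h2'.symm)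
  have h7 := h4.flow_eq hO (ContMDiffOn.mono hX (prod_mono (uIcc_subset_Icc hr ht) subset_rfl))
  rw [h5, h2, h6, h3'] at h7
  exact h7.symm

end FlowLines

end SingularFoliation

namespace SingularFoliation

variable {n : ℕ} {M : Type*} [TopologicalSpace M] [ChartedSpace (Eu n) M]
  [IsManifold (𝓡 n) ∞ M] {F : SingularFoliation n M}

/-! ### Leaf tangent spaces in charts -/

lemma mem_leafTangent {O : Opens M} {X : VF n M} (hX : X ∈ F.sec O) {x : M} (hx : x ∈ O) :
    X x ∈ F.leafTangent x :=
  ⟨O, X, hx, hX, rfl⟩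

lemma sum_mem_sec {O : Opens M} {ι : Type*} (s : Finset ι) {X : ι → VF n M} {f : ι → M → ℝ}
    (hf : ∀ i ∈ s, ContMDiffOn (𝓡 n) 𝓘(ℝ, ℝ) ∞ (f i) O) (hX : ∀ i ∈ s, X i ∈ F.sec O) :
    (fun z => ∑ i ∈ s, f i z • X i z) ∈ F.sec O := by
  classical
  induction s using Finset.induction_on with
  | empty => simpa using F.zero_mem O
  | insert i s hi ih =>
    simp only [Finset.sum_insert hi]
    exact F.add_mem (F.smul_mem (hf i (Finset.mem_insert_self i s))
      (hX i (Finset.mem_insert_self i s)))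
      (ih (fun j hj => hf j (Finset.mem_insert_of_mem hj))
        fun j hj => hX j (Finset.mem_insert_of_mem hj))

/-- Every leafwise tangent vector is a value of a globally defined section. -/
lemma exists_global_section [T2Space M] {x : M} {v : TangentSpace (𝓡 n) x}
    (hv : v ∈ F.leafTangent x) : ∃ X ∈ F.sec ⊤, X x = v := by
  obtain ⟨O, X, hx, hX, rfl⟩ := hv
  obtain ⟨χ, h1, h2, h3⟩ := exists_cutoff (n := n) (isCompact_singleton (x := x)) O.isOpen
    (singleton_subset_iff.2 hx)
  refine ⟨fun z => χ z • X z, ?_, ?_⟩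
  · apply F.glue
    intro z _
    by_cases hz : z ∈ O
    · exact ⟨O, hz, le_top, F.smul_mem h1.contMDiffOn hX⟩
    · refine ⟨⟨(tsupport χ)ᶜ, (isClosed_tsupport χ).isOpen_compl⟩, fun hz' => hz (h3 hz'), le_top,
        F.congr (F.zero_mem _) fun w hw => ?_⟩
      rw [image_eq_zero_of_notMem_tsupport hw, zero_smul]
  · simp only [(h2 x rfl).self_of_nhds, one_smul]

/-- A tangent vector of the leaf may be the value of a section defined on a set unrelated to `O`. It
is first made the value of a global section, whose restriction to `O` is a combination of the
generators. -/
lemma leafTangent_eq_span [T2Space M] {O : Opens M} {k : ℕ} {G : Fin k → VF n M}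
    (hG : ∀ i, G i ∈ F.sec O) (hgen : ∀ Y ∈ F.sec O, ∃ f : Fin k → M → ℝ,
      (∀ i, ContMDiffOn (𝓡 n) 𝓘(ℝ, ℝ) ∞ (f i) O) ∧ ∀ z ∈ O, Y z = ∑ i, f i z • G i z)
    {z : M} (hz : z ∈ O) : F.leafTangent z = Submodule.span ℝ (range fun i => G i z) := by
  apply le_antisymm
  · intro v hv
    obtain ⟨X, hX, rfl⟩ := exists_global_section hv
    obtain ⟨f, -, hf⟩ := hgen X (F.restrict le_top hX)
    rw [hf z hz]
    exact Submodule.sum_mem _ fun i _ => Submodule.smul_mem _ _ (Submodule.subset_span ⟨i, rfl⟩)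
  · rw [Submodule.span_le]
    rintro _ ⟨i, rfl⟩
    exact mem_leafTangent (hG i) hz

variable (F) in
/-- The image in a chart of the tangent space of the leaf. -/
def leafImage (e : OpenPartialHomeomorph M (Eu n)) (z : M) : Submodule ℝ (Eu n) :=
  (F.leafTangent z).map (chartDeriv e z : TangentSpace (𝓡 n) z →ₗ[ℝ] Eu n)

lemma chartDeriv_mem_leafImage {e : OpenPartialHomeomorph M (Eu n)} {z : M}
    {v : TangentSpace (𝓡 n) z} (hv : v ∈ F.leafTangent z) : chartDeriv e z v ∈ F.leafImage e z :=
  ⟨v, hv, rfl⟩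

lemma chartDeriv_mem_leafImage_iff {e : OpenPartialHomeomorph M (Eu n)}
    (he : e ∈ IsManifold.maximalAtlas (𝓡 n) ∞ M) {z : M} (hz : z ∈ e.source)
    {v : TangentSpace (𝓡 n) z} : chartDeriv e z v ∈ F.leafImage e z ↔ v ∈ F.leafTangent z := by
  refine ⟨?_, chartDeriv_mem_leafImage⟩
  rintro ⟨w, hw, h⟩
  rwa [← chartDeriv_injective he hz h]

lemma chartRep_apply {e : OpenPartialHomeomorph M (Eu n)} {z : M} (hz : z ∈ e.source)
    (X : VF n M) : chartRep e X (e z) = chartDeriv e z (X z) := by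
  have key : ∀ z' : M, z' = z → chartDeriv e z' (X z') = chartDeriv e z (X z) := by
    rintro z' rfl; rfl
  exact key _ (e.left_inv hz)

lemma leafImage_eq_span [T2Space M] {O : Opens M} {k : ℕ} {G : Fin k → VF n M}
    (hG : ∀ i, G i ∈ F.sec O) (hgen : ∀ Y ∈ F.sec O, ∃ f : Fin k → M → ℝ,
      (∀ i, ContMDiffOn (𝓡 n) 𝓘(ℝ, ℝ) ∞ (f i) O) ∧ ∀ z ∈ O, Y z = ∑ i, f i z • G i z)
    {e : OpenPartialHomeomorph M (Eu n)} {z : M} (hz : z ∈ O) (hze : z ∈ e.source) :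
    F.leafImage e z = Submodule.span ℝ (range fun i => chartRep e (G i) (e z)) := by
  unfold leafImage
  rw [leafTangent_eq_span hG hgen hz, Submodule.map_span, ← range_comp]
  congr 2
  funext i
  exact (chartRep_apply hze (G i)).symm

/-- The chart `e`, centred at `p`, is adapted to the foliation: all leaves contain the directions of
`H`, and the plaque through `p` is tangent to `H`. -/
structure IsAdapted (F : SingularFoliation n M) (p : M) (e : OpenPartialHomeomorph M (Eu n))
    (V H : Submodule ℝ (Eu n)) : Prop where
  mem_atlas : e ∈ IsManifold.maximalAtlas (𝓡 n) ∞ M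
  mem_source : p ∈ e.source
  isCompl : IsCompl V H
  le_leafImage : ∀ z ∈ e.source, H ≤ F.leafImage e z
  leafImage_le : ∀ z ∈ e.source, e z - e p ∈ H → F.leafImage e z ≤ H

variable [T2Space M]

/-- Every chart can be straightened to an adapted one, without changing it on a complement of the
leaf direction. -/
lemma exists_isAdapted {e₀ : OpenPartialHomeomorph M (Eu n)}
    (he₀ : e₀ ∈ IsManifold.maximalAtlas (𝓡 n) ∞ M) {p : M} (hp : p ∈ e₀.source)
    {V H : Submodule ℝ (Eu n)} (hVH : IsCompl V H) (hH : H = F.leafImage e₀ p) :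
    ∃ e, IsAdapted F p e V H ∧ e.source ⊆ e₀.source ∧ e p = e₀ p ∧
      ∀ z ∈ e.source, (e₀ z - e₀ p ∈ V ∨ e z - e₀ p ∈ V) → e z = e₀ z := by
  obtain ⟨O, hpO, k, G, hG, hgen⟩ := F.locally_fg p
  have hspan := fun z (hz : z ∈ O) (hze : z ∈ e₀.source) => leafImage_eq_span hG hgen hz hze
  -- Involutivity enters here: the brackets of the generators are combinations of the generators.
  choose cf hcf hbr using fun i j => hgen _ (F.lie_mem (hG i) (hG j))
  set U := e₀.target ∩ e₀.symm ⁻¹' O with hU_def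
  have hU : IsOpen U := e₀.isOpen_inter_preimage_symm O.isOpen
  have ha₀ : e₀ p ∈ U := ⟨e₀.map_source hp, by rwa [mem_preimage, e₀.left_inv hp]⟩
  obtain ⟨Ψ, h1, h2, h3, h4, h5, h6, h7, h8⟩ := exists_straightening (V := V) (H := H) hU ha₀
    (G := fun i => chartRep e₀ (G i)) (cf := fun i j l a => cf i j l (e₀.symm a))
    (fun i => contDiffOn_chartRep_const he₀ (F.smooth (hG i)))
    (fun i j l => (hcf i j l).continuousOn.comp (e₀.continuousOn_symm.mono inter_subset_left)
      fun a ha => ha.2)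
    (fun a ha i j => by
      rw [← chartRep_mlieBracket he₀ (F.smooth (hG i)) (F.smooth (hG j)) ha.1 ha.2]
      unfold chartRep
      rw [hbr i j _ ha.2, map_sum]
      exact Finset.sum_congr rfl fun l _ => (chartDeriv e₀ (e₀.symm a)).map_smul _ _)
    hVH (hH.trans (hspan p hpO hp))
  have hsrc : ∀ z, z ∈ e₀.source → e₀ z ∈ Ψ.target → e₀ z ∈ Ψ.source →
      z ∈ ((e₀.trans Ψ.symm).restr (e₀.source ∩ e₀ ⁻¹' Ψ.source)).source := by
    intro z hz1 hz2 hz3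
    rw [OpenPartialHomeomorph.restr_source' _ _ (e₀.isOpen_inter_preimage Ψ.open_source),
      OpenPartialHomeomorph.trans_source]
    exact ⟨⟨hz1, hz2⟩, hz1, hz3⟩
  -- The new chart is `Ψ⁻¹ ∘ e₀`. The further restriction to `e₀ ⁻¹' Ψ.source` is needed because `Ψ`
  -- is known to fix the points of the transversal only within its source.
  set e := (e₀.trans Ψ.symm).restr (e₀.source ∩ e₀ ⁻¹' Ψ.source) with he_def
  have hsrc' : ∀ z ∈ e.source, z ∈ e₀.source ∧ e₀ z ∈ Ψ.target ∧ e₀ z ∈ Ψ.source := by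
    intro z hz
    rw [OpenPartialHomeomorph.restr_source' _ _ (e₀.isOpen_inter_preimage Ψ.open_source),
      OpenPartialHomeomorph.trans_source] at hz
    exact ⟨hz.1.1, hz.1.2, hz.2.2⟩
  have he_apply : ∀ z, e z = Ψ.symm (e₀ z) := fun z => rfl
  have hmemΨ : ∀ z ∈ e.source, e z ∈ Ψ.source := fun z hz => Ψ.map_target (hsrc' z hz).2.1
  have hΨe : ∀ z ∈ e.source, Ψ (e z) = e₀ z := fun z hz => Ψ.right_inv (hsrc' z hz).2.1
  have hea : e p = e₀ p := by
    rw [he_apply]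
    nth_rw 1 [← h2]
    exact Ψ.left_inv h1
  have hpe : p ∈ e.source := hsrc p hp (by rw [← h2]; exact Ψ.map_source h1) h1
  have he : e ∈ IsManifold.maximalAtlas (𝓡 n) ∞ M := by
    apply OpenPartialHomeomorph.mem_maximalAtlas_of_contMDiffOn
    · exact (h5.contMDiffOn).comp ((chart_contMDiffOn he₀).mono fun z hz => (hsrc' z hz).1)
        fun z hz => (hsrc' z hz).2.1
    · have ht : ∀ x ∈ e.target, x ∈ Ψ.source ∧ Ψ x ∈ e₀.target := by
        intro x hx
        have hx' := hsrc' _ (e.map_target hx)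
        rw [← e.right_inv hx]
        refine ⟨hmemΨ _ (e.map_target hx), ?_⟩
        rw [hΨe _ (e.map_target hx)]
        exact e₀.map_source hx'.1
      exact (chart_symm_contMDiffOn he₀).comp (h4.contMDiffOn.mono fun x hx => (ht x hx).1)
        fun x hx => (ht x hx).2
  have hchain : ∀ z ∈ e.source, ∀ v : TangentSpace (𝓡 n) z,
      chartDeriv e₀ z v = fderiv ℝ Ψ (e z) (chartDeriv e z v) := by
    intro z hz v
    have hd : HasFDerivAt Ψ (fderiv ℝ Ψ (e z)) (e z) :=
      ((h4.contDiffAt (Ψ.open_source.mem_nhds (hmemΨ z hz))).differentiableAt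
        (by simp)).hasFDerivAt
    have hc : HasMFDerivAt (𝓡 n) 𝓘(ℝ, Eu n) (Ψ ∘ e) z _ :=
      HasMFDerivAt.comp z hd.hasMFDerivAt (hasMFDerivAt_chart he hz)
    have hev : e₀ =ᶠ[𝓝 z] Ψ ∘ e :=
      Filter.mem_of_superset (e.open_source.mem_nhds hz) fun w hw => (hΨe w hw).symm
    have := hasMFDerivAt_unique (hasMFDerivAt_chart he₀ (hsrc' z hz).1)
      (hc.congr_of_eventuallyEq hev)
    rw [this]
    rfl
  have hinj : ∀ z ∈ e.source, Function.Injective (fderiv ℝ Ψ (e z)) := by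
    intro z hz
    rw [injective_iff_map_eq_zero]
    intro w hw
    obtain ⟨v, rfl⟩ := chartDeriv_surjective he hz w
    rw [← hchain z hz] at hw
    rw [(injective_iff_map_eq_zero _).1 (chartDeriv_injective he₀ (hsrc' z hz).1) v hw, map_zero]
  have hO : ∀ z ∈ e.source, z ∈ O := by
    intro z hz
    have := (h3 (hsrc' z hz).2.1).2
    rwa [mem_preimage, e₀.left_inv (hsrc' z hz).1] at this
  have hle : ∀ z ∈ e.source, H ≤ F.leafImage e z := by
    intro z hz h hh
    have h9 := h7 (e z) (hmemΨ z hz) h hh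
    rw [hΨe z hz, ← hspan z (hO z hz) (hsrc' z hz).1] at h9
    obtain ⟨v, hv, hvh⟩ := h9
    refine ⟨v, hv, hinj z hz ?_⟩
    exact (hchain z hz v).symm.trans hvh
  refine ⟨e, ⟨he, hpe, hVH, hle, fun z hz hzH => ?_⟩, fun z hz => (hsrc' z hz).1, hea, ?_⟩
  · have h9 := h8 (e z) (hmemΨ z hz) (by rwa [← hea])
    rw [hΨe z hz, ← hspan z (hO z hz) (hsrc' z hz).1] at h9
    -- The derivative of `Ψ` is an injection that identifies the two images of the leaf tangent
    -- space. So the image under `e` has at most the dimension of `H`, and it contains `H`.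
    have h10 : F.leafImage e₀ z =
        (F.leafImage e z).map (fderiv ℝ Ψ (e z) : Eu n →ₗ[ℝ] Eu n) := by
      unfold leafImage
      rw [← Submodule.map_comp]
      congr 1
      exact LinearMap.ext fun v => hchain z hz v
    have h11 := (Submodule.equivMapOfInjective (fderiv ℝ Ψ (e z) : Eu n →ₗ[ℝ] Eu n)
      (hinj z hz) (F.leafImage e z)).finrank_eq
    rw [← h10] at h11
    exact (Submodule.eq_of_le_of_finrank_le (hle z hz) (h11.trans_le h9)).ge
  · rintro z hz (hzV | hzV)
    · have h9 := h6 (e₀ z) (hsrc' z hz).2.2 hzV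
      rw [he_apply]
      nth_rw 1 [← h9]
      exact Ψ.left_inv (hsrc' z hz).2.2
    · have h9 := h6 (e z) (hmemΨ z hz) hzV
      rw [← hΨe z hz, h9]

variable (F) in
lemma exists_isAdapted_at (p : M) : ∃ e V H, IsAdapted F p e V H := by
  obtain ⟨V, hV⟩ := (F.leafImage (chartAt (Eu n) p) p).exists_isCompl
  obtain ⟨e, he, -⟩ := exists_isAdapted (F := F) (IsManifold.chart_mem_maximalAtlas p)
    (mem_chart_source (Eu n) p) hV.symm rfl
  exact ⟨e, V, _, he⟩

end SingularFoliation

namespace SingularFoliation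

variable {n : ℕ} {M : Type*} [TopologicalSpace M] [ChartedSpace (Eu n) M]
  [IsManifold (𝓡 n) ∞ M] {F : SingularFoliation n M}

/-! ### First integrals -/

variable (F) in
/-- `f` is an `n`-tuple of first integrals on the open set `O`. -/
structure IsFirstIntegralOn (O : Set M) (f : M → Eu n) : Prop where
  isOpen : IsOpen O
  smooth : ContMDiffOn (𝓡 n) 𝓘(ℝ, Eu n) ∞ f O
  mfderiv_eq_zero : ∀ z ∈ O, ∀ v ∈ F.leafTangent z, mfderiv (𝓡 n) 𝓘(ℝ, Eu n) f z v = 0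

lemma isFirstIntegralAt_iff {x : M} {f : M → Eu n} :
    F.IsFirstIntegralAt x f ↔ ∃ O, x ∈ O ∧ F.IsFirstIntegralOn O f :=
  ⟨fun ⟨O, hx, h1, h2⟩ => ⟨O, hx, O.isOpen, h1, h2⟩,
    fun ⟨O, hx, h⟩ => ⟨⟨O, h.isOpen⟩, hx, h.smooth, h.mfderiv_eq_zero⟩⟩

lemma IsFirstIntegralOn.mono {O O' : Set M} {f : M → Eu n} (h : F.IsFirstIntegralOn O f)
    (hO' : IsOpen O') (hs : O' ⊆ O) : F.IsFirstIntegralOn O' f :=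
  ⟨hO', h.smooth.mono hs, fun z hz => h.mfderiv_eq_zero z (hs hz)⟩

lemma IsFirstIntegralOn.congr {O : Set M} {f g : M → Eu n} (h : F.IsFirstIntegralOn O f)
    (hfg : ∀ z ∈ O, g z = f z) : F.IsFirstIntegralOn O g := by
  refine ⟨h.isOpen, h.smooth.congr hfg, fun z hz v hv => ?_⟩
  have hev : g =ᶠ[𝓝 z] f := Filter.mem_of_superset (h.isOpen.mem_nhds hz) hfg
  have := h.mfderiv_eq_zero z hz v hv
  rw [← hev.mfderiv_eq] at this
  exact this

lemma IsFirstIntegralAt.congr {x : M} {f g : M → Eu n} (h : F.IsFirstIntegralAt x f)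
    (hfg : f =ᶠ[𝓝 x] g) : F.IsFirstIntegralAt x g := by
  rw [isFirstIntegralAt_iff] at h ⊢
  obtain ⟨O, hx, h⟩ := h
  obtain ⟨N, hN, hNo, hxN⟩ := mem_nhds_iff.1 hfg
  exact ⟨O ∩ N, ⟨hx, hxN⟩, (h.mono (h.isOpen.inter hNo) inter_subset_left).congr
    fun z hz => (hN hz.2).symm⟩

/-- The velocities form a family along the curve and need not come from a vector field, so that the
lemma applies both to flow lines and to straight segments in adapted charts. -/
lemma IsFirstIntegralOn.eq_along {O : Set M} {f : M → Eu n} (h : F.IsFirstIntegralOn O f)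
    {I : Set ℝ} (hI : Convex ℝ I) {c : ℝ → M} (w : ∀ t, TangentSpace (𝓡 n) (c t))
    (hc : ∀ t ∈ I, c t ∈ O ∧ w t ∈ F.leafTangent (c t) ∧
      HasMFDerivWithinAt 𝓘(ℝ, ℝ) (𝓡 n) c I t ((1 : ℝ →L[ℝ] ℝ).smulRight (w t)))
    {s t : ℝ} (hs : s ∈ I) (ht : t ∈ I) : f (c s) = f (c t) := by
  refine eq_of_hasDerivWithinAt_eq (f := fun _ => f (c s)) (g := fun t => f (c t))
    (f' := fun _ => 0) hI (fun t _ => hasDerivWithinAt_const _ _ _) (fun t ht => ?_) hs ht rfl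
  obtain ⟨h1, h2, h3⟩ := hc t ht
  let D : TangentSpace (𝓡 n) (c t) →L[ℝ] Eu n := mfderiv (𝓡 n) 𝓘(ℝ, Eu n) f (c t)
  have hf : HasMFDerivAt (𝓡 n) 𝓘(ℝ, Eu n) f (c t) D :=
    ((h.smooth.contMDiffAt (h.isOpen.mem_nhds h1)).mdifferentiableAt (by simp)).hasMFDerivAt
  have h4 : HasMFDerivWithinAt 𝓘(ℝ, ℝ) 𝓘(ℝ, Eu n) (f ∘ c) I t _ :=
    HasMFDerivAt.comp_hasMFDerivWithinAt t hf h3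
  have h5 : HasFDerivWithinAt (f ∘ c)
      (D.comp ((1 : ℝ →L[ℝ] ℝ).smulRight (w t)) : ℝ →L[ℝ] Eu n) I t :=
    hasMFDerivWithinAt_iff_hasFDerivWithinAt.1 h4
  refine HasDerivWithinAt.congr_deriv (F := Eu n) h5.hasDerivWithinAt ?_
  change D ((1 : ℝ) • w t) = 0
  rw [one_smul]
  exact h.mfderiv_eq_zero _ h1 _ h2

/-- First integrals are constant along flow lines. -/
lemma IsFirstIntegralOn.eq_flowLine {O : Set M} {f : M → Eu n} (h : F.IsFirstIntegralOn O f)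
    {A : Set M} {X : ℝ → VF n M} {a b : ℝ} {c : ℝ → M} (hc : IsFlowLine A X a b c)
    (hX : ∀ t ∈ uIcc a b, ∀ z ∈ A, X t z ∈ F.leafTangent z) (hcO : ∀ t ∈ uIcc a b, c t ∈ O)
    {s t : ℝ} (hs : s ∈ uIcc a b) (ht : t ∈ uIcc a b) : f (c s) = f (c t) :=
  h.eq_along (convex_Icc _ _) (fun t => X t (c t))
    (fun t ht => ⟨hcO t ht, hX t ht _ (hc t ht).1, (hc t ht).2⟩) hs ht

/-- In an adapted chart, first integrals do not depend on the leaf coordinates. -/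
lemma IsFirstIntegralOn.eq_of_sub_mem {O : Set M} {f : M → Eu n} (h : F.IsFirstIntegralOn O f)
    {p : M} {e : OpenPartialHomeomorph M (Eu n)} {V H : Submodule ℝ (Eu n)}
    (he : IsAdapted F p e V H) {C : Set (Eu n)} (hC : Convex ℝ C)
    (hCO : C ⊆ e.target ∩ e.symm ⁻¹' O) {a b : Eu n} (ha : a ∈ C) (hb : b ∈ C) (hab : b - a ∈ H) :
    f (e.symm a) = f (e.symm b) := by
  have hmem : ∀ t ∈ Icc (0 : ℝ) 1, a + t • (b - a) ∈ C := fun t ht =>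
    hC.add_smul_sub_mem ha hb ht
  have := h.eq_along (convex_Icc (0 : ℝ) 1) (c := fun t => e.symm (a + t • (b - a)))
    (fun t => chartSymmDeriv e (a + t • (b - a)) (b - a)) (fun t ht => ?_)
    (left_mem_Icc.2 zero_le_one) (right_mem_Icc.2 zero_le_one)
  · simpa using this
  have ht' := hCO (hmem t ht)
  refine ⟨ht'.2, ?_, ?_⟩
  · rw [← chartDeriv_mem_leafImage_iff he.mem_atlas (e.map_target ht'.1),
      chartDeriv_chartSymmDeriv he.mem_atlas ht'.1]
    exact he.le_leafImage _ (e.map_target ht'.1) hab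
  · have h1 : HasDerivAt (fun t : ℝ => a + t • (b - a)) (b - a) t := by
      simpa using ((hasDerivAt_id t).smul_const (b - a)).const_add a
    have h2 : HasFDerivWithinAt (fun t : ℝ => a + t • (b - a))
        ((1 : ℝ →L[ℝ] ℝ).smulRight (b - a)) (Icc 0 1) t := h1.hasDerivWithinAt.hasFDerivWithinAt
    have h3 : HasMFDerivWithinAt 𝓘(ℝ, ℝ) 𝓘(ℝ, Eu n) (fun t : ℝ => a + t • (b - a)) (Icc 0 1) t
        ((1 : ℝ →L[ℝ] ℝ).smulRight (b - a)) := hasMFDerivWithinAt_iff_hasFDerivWithinAt.2 h2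
    have h4 := HasMFDerivAt.comp_hasMFDerivWithinAt t
      (hasMFDerivAt_chart_symm he.mem_atlas ht'.1) h3
    have h5 : ((1 : ℝ →L[ℝ] ℝ).smulRight (chartSymmDeriv e (a + t • (b - a)) (b - a)) :
        ℝ →L[ℝ] TangentSpace (𝓡 n) (e.symm (a + t • (b - a)))) =
        (chartSymmDeriv e (a + t • (b - a))).comp ((1 : ℝ →L[ℝ] ℝ).smulRight (b - a)) := by
      apply ContinuousLinearMap.ext
      intro r
      exact ((chartSymmDeriv e (a + t • (b - a))).map_smul r (b - a)).symm
    rw [h5]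
    exact h4

/-! ### Flows of sections preserve the leaf tangent spaces -/

variable (F) in
/-- A time-dependent vector field on an open set that is tangent to the leaves. -/
structure IsLeafField (J : Set ℝ) (O : Set M) (X : ℝ → VF n M) : Prop where
  isOpen : IsOpen O
  smooth : SmoothFamilyOn (J ×ˢ O) X
  mem : ∀ t ∈ J, ∀ z ∈ O, X t z ∈ F.leafTangent z

lemma IsLeafField.mono {J J' : Set ℝ} {O O' : Set M} {X : ℝ → VF n M} (h : F.IsLeafField J O X)
    (hJ : J' ⊆ J) (hO' : IsOpen O') (hO : O' ⊆ O) : F.IsLeafField J' O' X :=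
  ⟨hO', ContMDiffOn.mono h.smooth (prod_mono hJ hO), fun t ht z hz => h.mem t (hJ ht) z (hO hz)⟩

variable (F) in
/-- The derivative of `φ` at `z` maps leafwise vectors to leafwise vectors. -/
def Preserves (φ : M → M) (z : M) : Prop :=
  ∀ v ∈ F.leafTangent z, mfderiv (𝓡 n) (𝓡 n) φ z v ∈ F.leafTangent (φ z)

lemma Preserves.congr {φ ψ : M → M} {z : M} (h : F.Preserves φ z) (hev : φ =ᶠ[𝓝 z] ψ) :
    F.Preserves ψ z := by
  intro v hv
  have key : ∀ {y y' : M} (w : Eu n), y = y' →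
      (w : TangentSpace (𝓡 n) y) ∈ F.leafTangent y →
      (w : TangentSpace (𝓡 n) y') ∈ F.leafTangent y' := by
    rintro y y' w rfl hw
    exact hw
  have h1 := key _ hev.self_of_nhds (h v hv)
  have h2 : (mfderiv (𝓡 n) (𝓡 n) φ z v : Eu n) = mfderiv (𝓡 n) (𝓡 n) ψ z v := by
    rw [hev.mfderiv_eq]
    rfl
  rw [h2] at h1
  exact h1

lemma Preserves.comp {φ ψ : M → M} {z : M} (hψ : F.Preserves ψ (φ z)) (hφ : F.Preserves φ z)
    (dψ : MDifferentiableAt (𝓡 n) (𝓡 n) ψ (φ z)) (dφ : MDifferentiableAt (𝓡 n) (𝓡 n) φ z) :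
    F.Preserves (ψ ∘ φ) z := by
  intro v hv
  have h := hψ _ (hφ v hv)
  rw [mfderiv_comp z dψ dφ]
  exact h

lemma preserves_id (z : M) : F.Preserves id z := by
  intro v hv
  rw [mfderiv_id]
  exact hv

/-- At a point of the central plaque the leafwise vectors are exactly the directions of `H`. Such a
vector is the velocity of a straight segment in the plaque. If `φ` maps the plaque to itself, the
image of the segment stays in the plaque, so its velocity lies in `H`, which consists of leafwise
directions everywhere in the chart. -/
lemma IsAdapted.preserves {p : M} {e : OpenPartialHomeomorph M (Eu n)} {V H : Submodule ℝ (Eu n)}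
    (he : IsAdapted F p e V H) {φ : M → M} {z : M} (hz : z ∈ e.source)
    (dφ : MDifferentiableAt (𝓡 n) (𝓡 n) φ z) (hφz : φ z ∈ e.source) (hpl : e z - e p ∈ H)
    (hloc : ∀ᶠ w in 𝓝 z, e w - e p ∈ H → e (φ w) - e p ∈ H) : F.Preserves φ z := by
  suffices key : ∀ a ∈ e.target, MDifferentiableAt (𝓡 n) (𝓡 n) φ (e.symm a) →
      φ (e.symm a) ∈ e.source → e (e.symm a) - e p ∈ H →
      (∀ᶠ w in 𝓝 (e.symm a), e w - e p ∈ H → e (φ w) - e p ∈ H) → F.Preserves φ (e.symm a) by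
    have := key (e z) (e.map_source hz)
    rw [e.left_inv hz] at this
    exact this dφ hφz hpl hloc
  clear hloc hpl hφz dφ hz
  intro a ha dφ hφz hpl hloc v hv
  have hz := e.map_target ha
  set h := chartDeriv e (e.symm a) v with hh
  have hH : h ∈ H := he.leafImage_le _ hz hpl (chartDeriv_mem_leafImage hv)
  have hv' : v = chartSymmDeriv e a h :=
    chartDeriv_injective he.mem_atlas hz (chartDeriv_chartSymmDeriv he.mem_atlas ha h).symm
  set π := projAlong he.isCompl with hπ
  have h1 : HasMFDerivAt 𝓘(ℝ, Eu n) 𝓘(ℝ, Eu n) (e ∘ φ ∘ e.symm) a _ :=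
    HasMFDerivAt.comp a (hasMFDerivAt_chart he.mem_atlas hφz)
      (HasMFDerivAt.comp a dφ.hasMFDerivAt (hasMFDerivAt_chart_symm he.mem_atlas ha))
  have h2 : HasFDerivAt (e ∘ φ ∘ e.symm) ((chartDeriv e (φ (e.symm a))).comp
      ((mfderiv (𝓡 n) (𝓡 n) φ (e.symm a)).comp (chartSymmDeriv e a)) : Eu n →L[ℝ] Eu n) a :=
    hasMFDerivAt_iff_hasFDerivAt.1 h1
  have h3 : HasDerivAt (fun u : ℝ => a + u • h) h 0 := by
    simpa using ((hasDerivAt_id (0 : ℝ)).smul_const h).const_add a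
  have h2' := h2
  have ha0 : a = a + (0 : ℝ) • h := by simp
  rw [ha0] at h2'
  have h4 := π.hasFDerivAt.comp_hasDerivAt (0 : ℝ)
    ((h2'.comp_hasDerivAt (0 : ℝ) h3).sub_const (e p))
  have hcont : Tendsto (fun u : ℝ => e.symm (a + u • h)) (𝓝 0) (𝓝 (e.symm a)) := by
    have h5 := h3.continuousAt.tendsto
    rw [← ha0] at h5
    exact (e.symm.continuousAt ha).tendsto.comp h5
  have htar : ∀ᶠ u in 𝓝 (0 : ℝ), a + u • h ∈ e.target := by
    have h5 := h3.continuousAt.tendsto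
    rw [← ha0] at h5
    exact h5.eventually (e.open_target.mem_nhds ha)
  have hzero : (⇑π ∘ fun u : ℝ => ((e ∘ φ ∘ e.symm) ∘ fun u : ℝ => a + u • h) u - e p) =ᶠ[𝓝 0]
      fun _ => (0 : Eu n) := by
    filter_upwards [hcont.eventually hloc, htar] with u hu htu
    rw [Function.comp_apply, projAlong_eq_zero_iff]
    apply hu
    rw [e.right_inv htu]
    rw [e.right_inv ha] at hpl
    have : a + u • h - e p = (a - e p) + u • h := by abel
    rw [this]
    exact H.add_mem hpl (H.smul_mem _ hH)
  have h6 := h4.unique ((hasDerivAt_const (0 : ℝ) (0 : Eu n)).congr_of_eventuallyEq hzero)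
  rw [← ha0, projAlong_eq_zero_iff] at h6
  rw [← chartDeriv_mem_leafImage_iff he.mem_atlas hφz, hv']
  exact he.le_leafImage _ hφz h6

variable [T2Space M]

/-- Flow lines of sections that meet the plaque of an adapted chart stay in it. -/
lemma IsAdapted.exists_plaque_nhds {p : M} {e : OpenPartialHomeomorph M (Eu n)}
    {V H : Submodule ℝ (Eu n)} (he : IsAdapted F p e V H) {O : Set M} {X : ℝ → VF n M} {a b : ℝ}
    (hX : F.IsLeafField (Icc a b) O X) (hp : p ∈ O) :
    ∃ N ⊆ O ∩ e.source, IsOpen N ∧ p ∈ N ∧ ∀ a' ∈ Icc a b, ∀ b' ∈ Icc a b, ∀ c,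
      IsFlowLine N X a' b' c → ∀ s ∈ uIcc a' b', ∀ t ∈ uIcc a' b',
        e (c s) - e p ∈ H → e (c t) - e p ∈ H := by
  set π := projAlong he.isCompl with hπ
  have hU : IsOpen (e.target ∩ e.symm ⁻¹' O) := e.isOpen_inter_preimage_symm hX.isOpen
  have hpU : e p ∈ e.target ∩ e.symm ⁻¹' O :=
    ⟨e.map_source he.mem_source, by rwa [mem_preimage, e.left_inv he.mem_source]⟩
  obtain ⟨ε, hε, hball⟩ := Metric.nhds_basis_closedBall.mem_iff.1 (hU.mem_nhds hpU)
  obtain ⟨K, hK⟩ := exists_lipschitzOnWith_of_contDiffOn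
    ((contDiffOn_chartRep he.mem_atlas hX.smooth).mono (prod_mono subset_rfl hball))
    ((convex_Icc a b).prod (convex_closedBall _ _)) (isCompact_Icc.prod (isCompact_closedBall _ _))
  have hcont : ContinuousAt (fun x : Eu n => x - π (x - e p)) (e p) := by fun_prop
  have hev : ∀ᶠ x in 𝓝 (e p), x ∈ Metric.closedBall (e p) ε ∧
      x - π (x - e p) ∈ Metric.closedBall (e p) ε := by
    have h1 : ∀ᶠ x in 𝓝 (e p), x ∈ Metric.closedBall (e p) ε := Metric.closedBall_mem_nhds _ hε
    refine h1.and (hcont.eventually_mem ?_)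
    simpa using Metric.closedBall_mem_nhds (e p) hε
  obtain ⟨B, hB, hBo, hpB⟩ := mem_nhds_iff.1 hev
  refine ⟨e.source ∩ e ⁻¹' B, fun z hz => ⟨?_, hz.1⟩, e.isOpen_inter_preimage hBo,
    ⟨he.mem_source, hpB⟩, ?_⟩
  · have := (hball (hB hz.2).1).2
    rwa [mem_preimage, e.left_inv hz.1] at this
  intro a' ha' b' hb' c hc s hs t ht hsH
  have hsub : uIcc a' b' ⊆ Icc a b := uIcc_subset_Icc ha' hb'
  have hchart := hc.chart he.mem_atlas fun t ht => (hc t ht).1.1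
  have hbound := norm_le_mul_exp (f := fun t => π (e (c t) - e p))
    (f' := fun t => π (chartRep e (X t) (e (c t)))) (a := a' ⊓ b') (b := a' ⊔ b') (K := ‖π‖ * K)
    (fun t ht => π.hasFDerivAt.comp_hasDerivWithinAt t ((hchart t ht).2.sub_const (e p)))
    (fun t ht => ?_) hs ht
  · rw [(projAlong_eq_zero_iff he.isCompl).2 hsH, norm_zero, zero_mul, norm_le_zero_iff] at hbound
    exact (projAlong_eq_zero_iff he.isCompl).1 hbound
  · obtain ⟨h1, h2⟩ := hB (hc t ht).1.2
    set x := e (c t) with hx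
    -- The point `y` is the projection of `x` to the central plaque. There the field is tangent to
    -- `H`, so its transverse part vanishes, and the distance from `x` to `y` is the norm of the
    -- transverse coordinate of `x`. The Lipschitz bound between `x` and `y` is therefore the
    -- Gronwall hypothesis for the transverse coordinate.
    set y := x - π (x - e p) with hy
    have hyt : y ∈ e.target := (hball h2).1
    have hyO : e.symm y ∈ O := (hball h2).2
    have h3 : π (chartRep e (X t) y) = 0 := by
      rw [projAlong_eq_zero_iff]
      refine he.leafImage_le _ (e.map_target hyt) ?_
        (chartDeriv_mem_leafImage (hX.mem t (hsub ht) _ hyO))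
      rw [e.right_inv hyt, hy, sub_right_comm]
      exact sub_projAlong_mem _ _
    have h4 := hK.dist_le_mul (t, x) ⟨hsub ht, h1⟩ (t, y) ⟨hsub ht, h2⟩
    have h5 : dist (t, x) (t, y) = ‖π (x - e p)‖ := by
      rw [Prod.dist_eq, dist_self, dist_eq_norm, hy, sub_sub_cancel]
      exact max_eq_right (norm_nonneg _)
    rw [h5, dist_eq_norm] at h4
    calc ‖π (chartRep e (X t) x)‖ = ‖π (chartRep e (X t) x - chartRep e (X t) y)‖ := by
          rw [map_sub, h3, sub_zero]
      _ ≤ ‖π‖ * (K * ‖π (x - e p)‖) := (π.le_opNorm _).trans (by gcongr)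
      _ = ‖π‖ * K * ‖π (x - e p)‖ := by ring

section Flow

variable {O O' : Set M} {X X' : ℝ → VF n M} {a b r s t : ℝ} {γ c : ℝ → M}

/-- For times close to `x` the base path remains in the plaque of a chart adapted at `γ x`, and the
flow maps this plaque to itself, so `IsAdapted.preserves` applies. Transitivity of the flow and
connectedness of the interval give the general case. -/
lemma IsLeafField.preserves_flow_Icc (hab : a < b) (hX : F.IsLeafField (Icc a b) O X)
    (hγ : IsFlowLine O X a b γ) (hs : s ∈ Icc a b) (ht : t ∈ Icc a b) :
    F.Preserves (flow O X t s) (γ s) := by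
  have hu : uIcc a b = Icc a b := uIcc_of_le hab.le
  refine isPreconnected_Icc.induction₂' (fun s t => F.Preserves (flow O X t s) (γ s)) ?_ ?_ hs ht
  · intro x hx
    have hxO : γ x ∈ O := (hγ x (hu ▸ hx)).1
    obtain ⟨e, V, H, he⟩ := F.exists_isAdapted_at (γ x)
    obtain ⟨N, hNO, hN, hxN, hinv⟩ := he.exists_plaque_nhds hX hxO
    have hcont := hγ.continuousOn
    rw [hu] at hcont
    obtain ⟨a', b', hab', hx', hsub, hnhds, hP⟩ := exists_uIcc_mem_nhdsWithin hab hx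
      ((hcont x hx).eventually (hN.mem_nhds hxN))
    have hu' : uIcc a' b' = Icc a' b' := uIcc_of_le hab'.le
    have hX' : F.IsLeafField (Icc a' b') N X := hX.mono hsub hN fun z hz => (hNO hz).1
    have hγ' : IsFlowLine N X a' b' γ := (hγ.subinterval (by rwa [hu', hu])).restrict
      fun t ht => hP t (hu' ▸ ht)
    have ha' : a' ∈ Icc a b := hsub (left_mem_Icc.2 hab'.le)
    have hb' : b' ∈ Icc a b := hsub (right_mem_Icc.2 hab'.le)
    have key : ∀ s ∈ Icc a' b', ∀ t ∈ Icc a' b', F.Preserves (flow O X t s) (γ s) := by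
      intro s hs t ht
      have hsm : SmoothFamilyOn (uIcc s t ×ˢ O) X :=
        ContMDiffOn.mono hX.smooth (prod_mono (uIcc_subset_Icc (hsub hs) (hsub ht)) subset_rfl)
      obtain ⟨N', hN', hsN', -, hφ, hlines⟩ := exists_flow_nhds hab' hN hX'.smooth hγ' hs ht
      have hplaque : ∀ t ∈ Icc a' b', e (γ t) - e (γ x) ∈ H := fun t ht =>
        hinv a' ha' b' hb' γ hγ' x (hu' ▸ hx') t (hu' ▸ ht) (by simp)
      have hfl : flow N X t s (γ s) = γ t := hγ'.flow_apply hab'.le hN hX'.smooth hs ht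
      have h1 : F.Preserves (flow N X t s) (γ s) := by
        refine he.preserves (hNO (hP s hs)).2
          ((hφ.contMDiffAt (hN'.mem_nhds hsN')).mdifferentiableAt (by simp)) ?_ (hplaque s hs) ?_
        · rw [hfl]
          exact (hNO (hP t ht)).2
        · filter_upwards [hN'.mem_nhds hsN'] with z hz hzH
          obtain ⟨c, h1, h2, h3⟩ := hlines z hz
          rw [← h3]
          exact hinv s (hsub hs) t (hsub ht) c h1 s left_mem_uIcc t right_mem_uIcc (by rwa [h2])
      refine h1.congr ?_
      filter_upwards [hN'.mem_nhds hsN'] with z hz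
      obtain ⟨c, h1, h2, h3⟩ := hlines z hz
      rw [← h3, ← h2]
      exact ((h1.mono fun z hz => (hNO hz).1).flow_eq hX.isOpen hsm).symm
    filter_upwards [hnhds] with y hy
    exact ⟨key x hx' y hy, key y hy x hx'⟩
  · intro x y z hx hy hz h1 h2
    have hxy := hγ.flow_apply hab.le hX.isOpen hX.smooth hx hy
    obtain ⟨N, hN, hxN, -, hφ, -⟩ := exists_flow_nhds hab hX.isOpen hX.smooth hγ hx hy
    obtain ⟨N', hN', hyN', -, hφ', -⟩ := exists_flow_nhds hab hX.isOpen hX.smooth hγ hy hz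
    rw [← hxy] at h2 hyN'
    exact (h2.comp h1 ((hφ'.contMDiffAt (hN'.mem_nhds hyN')).mdifferentiableAt (by simp))
      ((hφ.contMDiffAt (hN.mem_nhds hxN)).mdifferentiableAt (by simp))).congr
      (flow_flow hab hX.isOpen hX.smooth hγ hx hy hz)

/-- The flow of a section preserves the leaf tangent spaces. -/
lemma IsLeafField.preserves_flow (hX : F.IsLeafField (uIcc s t) O X)
    (hc : IsFlowLine O X s t c) : F.Preserves (flow O X t s) (c s) := by
  rcases lt_trichotomy s t with hst | hst | hst
  · rw [uIcc_of_lt hst] at hX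
    exact hX.preserves_flow_Icc hst hc (left_mem_Icc.2 hst.le) (right_mem_Icc.2 hst.le)
  · subst hst
    rw [show flow O X s s = id from funext fun y => flow_self y]
    exact preserves_id _
  · rw [uIcc_of_gt hst] at hX
    exact hX.preserves_flow_Icc hst hc.symm (right_mem_Icc.2 hst.le) (left_mem_Icc.2 hst.le)

/-- Transporting a first integral along the flow of a section gives a first integral. -/
lemma IsLeafField.isFirstIntegralAt_comp_flow (hab : a < b) (hX : F.IsLeafField (Icc a b) O X)
    (hγ : IsFlowLine O X a b γ) (hs : s ∈ Icc a b) (ht : t ∈ Icc a b) {σ : M → Eu n}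
    (hσ : F.IsFirstIntegralAt (γ s) σ) : F.IsFirstIntegralAt (γ t) (σ ∘ flow O X s t) := by
  rw [isFirstIntegralAt_iff] at hσ ⊢
  obtain ⟨B, hsB, hσ⟩ := hσ
  obtain ⟨N, hN, htN, -, hφ, hlines⟩ := exists_flow_nhds hab hX.isOpen hX.smooth hγ ht hs
  have hfl := hγ.flow_apply hab.le hX.isOpen hX.smooth ht hs
  refine ⟨N ∩ flow O X s t ⁻¹' B, ⟨htN, by rwa [mem_preimage, hfl]⟩,
    hφ.continuousOn.isOpen_inter_preimage hN hσ.isOpen,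
    hσ.smooth.comp (hφ.mono inter_subset_left) fun z hz => hz.2, fun z hz v hv => ?_⟩
  obtain ⟨c, h1, h2, -⟩ := hlines z hz.1
  have h3 : F.Preserves (flow O X s t) z := by
    rw [← h2]
    exact (hX.mono (uIcc_subset_Icc ht hs) hX.isOpen subset_rfl).preserves_flow h1
  rw [mfderiv_comp z ((hσ.smooth.contMDiffAt (hσ.isOpen.mem_nhds hz.2)).mdifferentiableAt (by simp))
    ((hφ.contMDiffAt (hN.mem_nhds hz.1)).mdifferentiableAt (by simp))]
  exact hσ.mfderiv_eq_zero _ hz.2 _ (h3 v hv)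

/-- A first integral does not change under the flow for a short time. -/
lemma IsLeafField.eventually_comp_flow_eq (hab : a < b) (hX : F.IsLeafField (Icc a b) O X)
    (hγ : IsFlowLine O X a b γ) (hr : r ∈ Icc a b) (hs : s ∈ Icc a b) {σ : M → Eu n}
    (hσ : F.IsFirstIntegralAt (γ r) σ) : ∀ᶠ t in 𝓝[Icc a b] s,
      σ ∘ flow O X r t =ᶠ[𝓝 (γ t)] σ ∘ flow O X r s := by
  have hu : uIcc a b = Icc a b := uIcc_of_le hab.le
  -- The germ transported to time `s` is a first integral on some open set `B`. For `t` close to `s`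
  -- the flow lines between the two times stay in `B`, where it is constant along them.
  obtain ⟨B, hsB, hτ⟩ := isFirstIntegralAt_iff.1 (hX.isFirstIntegralAt_comp_flow hab hγ hr hs hσ)
  have hN : IsOpen (O ∩ B) := hX.isOpen.inter hτ.isOpen
  have hcont := hγ.continuousOn
  rw [hu] at hcont
  obtain ⟨a', b', hab', hs', hsub, hnhds, hP⟩ := exists_uIcc_mem_nhdsWithin hab hs
    ((hcont s hs).eventually (hN.mem_nhds ⟨(hγ s (hu ▸ hs)).1, hsB⟩))
  have hu' : uIcc a' b' = Icc a' b' := uIcc_of_le hab'.le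
  have hX' : F.IsLeafField (Icc a' b') (O ∩ B) X := hX.mono hsub hN inter_subset_left
  have hγ' : IsFlowLine (O ∩ B) X a' b' γ := (hγ.subinterval (by rwa [hu', hu])).restrict
    fun t ht => hP t (hu' ▸ ht)
  filter_upwards [hnhds] with t ht
  obtain ⟨N', hN', htN', -, hφ, hlines⟩ := exists_flow_nhds hab' hN hX'.smooth hγ' ht hs'
  filter_upwards [hN'.mem_nhds htN', flow_flow hab hX.isOpen hX.smooth hγ (hsub ht) hs hr]
    with z hz hz'
  obtain ⟨c, h1, h2, -⟩ := hlines z hz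
  have h3 := (h1.mono inter_subset_left).flow_eq hX.isOpen (ContMDiffOn.mono hX.smooth
    (prod_mono (uIcc_subset_Icc (hsub ht) hs) subset_rfl))
  have h4 := hτ.eq_flowLine h1 (fun u hu z hz => hX'.mem u (uIcc_subset_Icc ht hs' hu) z hz)
    (fun u hu => (h1 u hu).1.2) left_mem_uIcc right_mem_uIcc
  rw [Function.comp_apply, ← hz', ← h2, h3]
  exact h4.symm

/-- Transport of first integrals depends on the base path only. -/
lemma IsLeafField.comp_flow_eventuallyEq (hab : a < b) (hX : F.IsLeafField (Icc a b) O X)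
    (hγ : IsFlowLine O X a b γ) (hX' : F.IsLeafField (Icc a b) O' X')
    (hγ' : IsFlowLine O' X' a b γ) (hr : r ∈ Icc a b) (ht : t ∈ Icc a b) {σ : M → Eu n}
    (hσ : F.IsFirstIntegralAt (γ r) σ) :
    σ ∘ flow O X r t =ᶠ[𝓝 (γ t)] σ ∘ flow O' X' r t := by
  have hu : uIcc a b = Icc a b := uIcc_of_le hab.le
  -- Agreement of the two transported germs is a locally constant property of time. Near time `x`
  -- both germs may be replaced by the ones transported to time `x`, so only the point at which they
  -- are compared still varies.
  suffices H : ∀ x ∈ Icc a b, ∀ᶠ y in 𝓝[Icc a b] x,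
      (σ ∘ flow O X r x =ᶠ[𝓝 (γ x)] σ ∘ flow O' X' r x ↔
        σ ∘ flow O X r y =ᶠ[𝓝 (γ y)] σ ∘ flow O' X' r y) by
    refine isPreconnected_Icc.induction₂' (fun x y =>
      σ ∘ flow O X r x =ᶠ[𝓝 (γ x)] σ ∘ flow O' X' r x →
        σ ∘ flow O X r y =ᶠ[𝓝 (γ y)] σ ∘ flow O' X' r y) ?_ ?_ hr ht ?_
    · intro x hx
      filter_upwards [H x hx] with y hy using ⟨hy.1, hy.2⟩
    · intro x y z _ _ _ h1 h2 h3
      exact h2 (h1 h3)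
    · filter_upwards with z
      simp only [Function.comp_apply, flow_self]
  intro x hx
  obtain ⟨B, hxB, hτ⟩ := isFirstIntegralAt_iff.1 (hX.isFirstIntegralAt_comp_flow hab hγ hr hx hσ)
  obtain ⟨B', hxB', hτ'⟩ :=
    isFirstIntegralAt_iff.1 (hX'.isFirstIntegralAt_comp_flow hab hγ' hr hx hσ)
  obtain ⟨e, V, H, he⟩ := F.exists_isAdapted_at (γ x)
  have hxO : γ x ∈ O := (hγ x (hu ▸ hx)).1
  obtain ⟨N, hNO, hN, hxN, hinv⟩ := he.exists_plaque_nhds hX hxO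
  have hcont := hγ.continuousOn
  rw [hu] at hcont
  have hU : IsOpen (e.target ∩ e.symm ⁻¹' (B ∩ B')) :=
    e.isOpen_inter_preimage_symm (hτ.isOpen.inter hτ'.isOpen)
  obtain ⟨ε, hε, hball⟩ := Metric.nhds_basis_ball.mem_iff.1 (hU.mem_nhds
    (show e (γ x) ∈ e.target ∩ e.symm ⁻¹' (B ∩ B') from ⟨e.map_source he.mem_source,
      by rw [mem_preimage, e.left_inv he.mem_source]; exact ⟨hxB, hxB'⟩⟩))
  have hW : IsOpen (e.source ∩ e ⁻¹' Metric.ball (e (γ x)) ε) :=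
    e.isOpen_inter_preimage Metric.isOpen_ball
  obtain ⟨a', b', hab', hx', hsub, hnhds, hP⟩ := exists_uIcc_mem_nhdsWithin hab hx
    ((hcont x hx).eventually ((hN.inter hW).mem_nhds
      ⟨hxN, he.mem_source, Metric.mem_ball_self hε⟩))
  have hu' : uIcc a' b' = Icc a' b' := uIcc_of_le hab'.le
  have hγN : IsFlowLine N X a' b' γ := (hγ.subinterval (by rwa [hu', hu])).restrict
    fun t ht => (hP t (hu' ▸ ht)).1
  have ha' : a' ∈ Icc a b := hsub (left_mem_Icc.2 hab'.le)
  have hb' : b' ∈ Icc a b := hsub (right_mem_Icc.2 hab'.le)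
  have hforward : ∀ᶠ y in 𝓝[Icc a b] x, σ ∘ flow O X r x =ᶠ[𝓝 (γ x)] σ ∘ flow O' X' r x →
      σ ∘ flow O X r x =ᶠ[𝓝 (γ y)] σ ∘ flow O' X' r x := by
    by_cases h : σ ∘ flow O X r x =ᶠ[𝓝 (γ x)] σ ∘ flow O' X' r x
    · filter_upwards [(hcont x hx).eventually (eventually_eventually_nhds.2 h)] with y hy _
      exact hy
    · exact Eventually.of_forall fun y h' => absurd h' h
  filter_upwards [hnhds, hX.eventually_comp_flow_eq hab hγ hr hx hσ,
    hX'.eventually_comp_flow_eq hab hγ' hr hx hσ, hforward] with y hy h1 h2 h3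
  refine ⟨fun h => (h1.trans (h3 h)).trans h2.symm, fun h => ?_⟩
  have h4 : σ ∘ flow O X r x =ᶠ[𝓝 (γ y)] σ ∘ flow O' X' r x := (h1.symm.trans h).trans h2
  have hH : e (γ y) - e (γ x) ∈ H :=
    hinv a' ha' b' hb' γ hγN x (hu' ▸ hx') y (hu' ▸ hy) (by simp)
  set h := e (γ y) - e (γ x) with hh
  have hye : γ y ∈ e.source := (hP y hy).2.1
  have hyball : e (γ y) ∈ Metric.ball (e (γ x)) ε := (hP y hy).2.2
  -- Agreement near `γ y` is brought back to `γ x` by the translation by `h` in the chart. As `h`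
  -- lies in `H`, neither first integral changes under it.
  have hshift : Tendsto (fun z => e z + h) (𝓝 (γ x)) (𝓝 (e (γ y))) := by
    have h5 := (e.continuousAt he.mem_source).tendsto.add_const h
    rwa [show e (γ x) + h = e (γ y) by rw [hh]; abel] at h5
  have hback : Tendsto (fun z => e.symm (e z + h)) (𝓝 (γ x)) (𝓝 (γ y)) := by
    have h5 := (e.symm.continuousAt (e.map_source hye)).tendsto.comp hshift
    rwa [e.left_inv hye] at h5
  filter_upwards [hback.eventually h4, hshift.eventually (Metric.isOpen_ball.mem_nhds hyball),
    hW.mem_nhds ⟨he.mem_source, Metric.mem_ball_self hε⟩] with z hz hz2 hz3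
  have e1 := hτ.eq_of_sub_mem he (convex_ball _ _) (fun w hw => ⟨(hball hw).1, (hball hw).2.1⟩)
    hz3.2 hz2 (by simpa using hH)
  have e2 := hτ'.eq_of_sub_mem he (convex_ball _ _) (fun w hw => ⟨(hball hw).1, (hball hw).2.2⟩)
    hz3.2 hz2 (by simpa using hH)
  rw [e.left_inv hz3.1] at e1 e2
  rw [e1, e2, hz]

end Flow

end SingularFoliation

namespace SingularFoliation

variable {n : ℕ} {M : Type*} [TopologicalSpace M] [ChartedSpace (Eu n) M]
  [IsManifold (𝓡 n) ∞ M] {F : SingularFoliation n M}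

/-! ### Reparametrised flow lines -/

section Reparametrisation

variable {A : Set M} {X Y : ℝ → VF n M} {a b a' b' m k : ℝ} {c : ℝ → M}

lemma IsFlowLine.congr_field (h : IsFlowLine A X a b c)
    (hXY : ∀ t ∈ uIcc a b, ∀ z ∈ A, X t z = Y t z) : IsFlowLine A Y a b c := by
  intro t ht
  rw [← hXY t ht _ (h t ht).1]
  exact h t ht

lemma IsFlowLine.comp_affine (h : IsFlowLine A X a b c)
    (hmaps : ∀ u ∈ uIcc a' b', m * u + k ∈ uIcc a b) :
    IsFlowLine A (fun u z => m • X (m * u + k) z) a' b' (fun u => c (m * u + k)) := by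
  intro u hu
  obtain ⟨h1, h2⟩ := h _ (hmaps u hu)
  refine ⟨h1, ?_⟩
  have h3 : HasDerivAt (fun u : ℝ => m * u + k) m u := by
    simpa using ((hasDerivAt_id u).const_mul m).add_const k
  have h4 : HasMFDerivWithinAt 𝓘(ℝ, ℝ) 𝓘(ℝ, ℝ) (fun u : ℝ => m * u + k) (uIcc a' b') u
      ((1 : ℝ →L[ℝ] ℝ).smulRight m) :=
    hasMFDerivWithinAt_iff_hasFDerivWithinAt.2 h3.hasDerivWithinAt.hasFDerivWithinAt
  have h5 := HasMFDerivWithinAt.comp (g := c) (u := uIcc a b) u h2 h4 hmaps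
  have h6 : ((1 : ℝ →L[ℝ] ℝ).smulRight (m • X (m * u + k) (c (m * u + k))) :
      ℝ →L[ℝ] TangentSpace (𝓡 n) (c (m * u + k))) =
      ((1 : ℝ →L[ℝ] ℝ).smulRight (X (m * u + k) (c (m * u + k)))).comp
        ((1 : ℝ →L[ℝ] ℝ).smulRight m) := by
    apply ContinuousLinearMap.ext
    intro r
    change r • m • X (m * u + k) (c (m * u + k)) = (r • m) • X (m * u + k) (c (m * u + k))
    rw [smul_assoc]
  rw [h6]
  exact h5

lemma smoothFamilyOn_comp_affine {J J' : Set ℝ} (hX : SmoothFamilyOn (J ×ˢ A) X)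
    (hmaps : ∀ u ∈ J', m * u + k ∈ J) :
    SmoothFamilyOn (J' ×ˢ A) (fun u z => m • X (m * u + k) z) := by
  have h1 : ContDiff ℝ ∞ (fun u : ℝ => m * u + k) := by fun_prop
  have h2 : ContMDiff (𝓘(ℝ, ℝ).prod (𝓡 n)) (𝓘(ℝ, ℝ).prod (𝓡 n)) ∞
      (fun w : ℝ × M => (m * w.1 + k, w.2)) :=
    (h1.contMDiff.comp contMDiff_fst).prodMk contMDiff_snd
  have h3 : SmoothFamilyOn (J' ×ˢ A) (fun u => X (m * u + k)) :=
    hX.comp h2.contMDiffOn fun w hw => ⟨hmaps _ hw.1, hw.2⟩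
  exact smoothFamilyOn_smul h3 (f := fun _ => m) contMDiffOn_const

lemma IsLeafField.comp_affine {J J' : Set ℝ} (hX : F.IsLeafField J A X)
    (hmaps : ∀ u ∈ J', m * u + k ∈ J) :
    F.IsLeafField J' A (fun u z => m • X (m * u + k) z) :=
  ⟨hX.isOpen, smoothFamilyOn_comp_affine hX.smooth hmaps,
    fun t ht z hz => Submodule.smul_mem _ _ (hX.mem _ (hmaps t ht) z hz)⟩

lemma isFlowLine_const_zero (A : Set M) {y : M} (hy : y ∈ A) (a b : ℝ) :
    IsFlowLine A (fun _ _ => 0 : ℝ → VF n M) a b fun _ => y := by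
  refine fun t _ => ⟨hy, ?_⟩
  rw [ContinuousLinearMap.smulRight_zero]
  exact hasMFDerivWithinAt_const _ _ _

lemma flow_zero [T2Space M] (A : Set M) (a b : ℝ) (y : M) :
    flow A (fun _ _ => 0 : ℝ → VF n M) a b y = y := by
  rcases flow_cases A (fun _ _ => 0 : ℝ → VF n M) a b y with h | ⟨c, h1, h2, h3⟩
  · exact h
  · rw [← h3]
    exact (h1.mono (subset_univ A)).unique isOpen_univ (smoothFamilyOn_zero _)
      (isFlowLine_const_zero univ (mem_univ y) b a) left_mem_uIcc right_mem_uIcc h2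

end Reparametrisation

/-! ### Transport along leafwise paths -/

lemma IsLift.isLeafField {c : ℝ≥0 → F.GermSpace} {d : ℝ≥0} {O : Opens M} {X : ℝ → VF n M}
    (h : F.IsLift c d O X) (T : ℝ) : F.IsLeafField (Icc 0 T) O X := by
  refine ⟨O.isOpen, ContMDiffOn.mono h.smooth (prod_mono (fun t ht => ht.1) subset_rfl),
    fun t ht z hz => ?_⟩
  have h1 := mem_leafTangent (h.mem t.toNNReal) hz
  rwa [Real.coe_toNNReal t ht.1] at h1

lemma IsLift.isFlowLine {c : ℝ≥0 → F.GermSpace} {d : ℝ≥0} {O : Opens M} {X : ℝ → VF n M}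
    (h : F.IsLift c d O X) {T : ℝ} (hT : 0 ≤ T) :
    IsFlowLine (O : Set M) X 0 T fun s => F.base (c s.toNNReal) := by
  intro t ht
  rw [uIcc_of_le hT] at ht ⊢
  exact ⟨h.base_mem _, (h.velocity t ht.1).mono fun s hs => hs.1⟩

section Transport

variable [T2Space M]

/-- This includes `a = b`, which occurs for paths of duration zero. -/
lemma IsLeafField.comp_flow_eventuallyEq_of_le {O O' : Set M} {X X' : ℝ → VF n M} {a b r t : ℝ}
    {γ : ℝ → M} (hab : a ≤ b) (hX : F.IsLeafField (Icc a b) O X)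
    (hγ : IsFlowLine O X a b γ) (hX' : F.IsLeafField (Icc a b) O' X')
    (hγ' : IsFlowLine O' X' a b γ) (hr : r ∈ Icc a b) (ht : t ∈ Icc a b) {σ : M → Eu n}
    (hσ : F.IsFirstIntegralAt (γ r) σ) :
    σ ∘ flow O X r t =ᶠ[𝓝 (γ t)] σ ∘ flow O' X' r t := by
  rcases hab.lt_or_eq with hab | rfl
  · exact hX.comp_flow_eventuallyEq hab hγ hX' hγ' hr ht hσ
  · rw [Icc_self, mem_singleton_iff] at hr ht
    subst hr
    subst ht
    filter_upwards with z
    simp only [Function.comp_apply, flow_self]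

/-- The base path of a leafwise path. -/
def LeafPath.basePath (P : F.LeafPath) (s : ℝ) : M := F.base (P.toFun s.toNNReal)

omit [T2Space M] in
lemma LeafPath.basePath_zero (P : F.LeafPath) : P.basePath 0 = P.src := by
  unfold LeafPath.basePath
  rw [Real.toNNReal_zero]
  rfl

omit [T2Space M] in
lemma LeafPath.basePath_dur (P : F.LeafPath) : P.basePath P.dur = P.tgt := by
  unfold LeafPath.basePath
  rw [Real.toNNReal_coe]
  rfl

omit [T2Space M] in
lemma germ_isFirstIntegralAt {u : M} {f : F.InvGerm u} {σ : M → Eu n}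
    (hf : f.1 = (σ : Filter.Germ (𝓝 u) (Eu n))) : F.IsFirstIntegralAt u σ := by
  obtain ⟨g, hg, hgf⟩ := f.2
  exact hg.congr (Filter.Germ.coe_eq.1 (hgf.trans hf))

section Lift

variable {P : F.LeafPath} {u v : M} (hu : P.src = u) (hv : P.tgt = v) {O : Opens M}
  {X : ℝ → VF n M} (hL : F.IsLift P.toFun P.dur O X)

include hu hv hL

lemma IsLift.isFirstIntegralAt {σ : M → Eu n} (hσ : F.IsFirstIntegralAt u σ) :
    F.IsFirstIntegralAt v (σ ∘ flow (O : Set M) X 0 P.dur) := by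
  have hd : (0 : ℝ) ≤ P.dur := P.dur.2
  rw [← hu, ← P.basePath_zero] at hσ
  rw [← hv, ← P.basePath_dur]
  -- The interval is prolonged to `[0, d + 1]` so that it has positive length even if `d = 0`; a
  -- lift is defined for all nonnegative times. The same is done below.
  exact (hL.isLeafField _).isFirstIntegralAt_comp_flow (by linarith)
    (hL.isFlowLine (T := P.dur + 1) (by linarith)) ⟨le_rfl, by linarith⟩ ⟨hd, by linarith⟩ hσ

omit hu hv in
lemma IsLift.exists_flow_nhds {s t : ℝ} (hs : s ∈ Icc (0 : ℝ) (P.dur + 1))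
    (ht : t ∈ Icc (0 : ℝ) (P.dur + 1)) : ∃ N : Set M, IsOpen N ∧ P.basePath s ∈ N ∧
      ContMDiffOn (𝓡 n) (𝓡 n) ∞ (flow (O : Set M) X t s) N ∧
      flow (O : Set M) X t s (P.basePath s) = P.basePath t := by
  have hd : (0 : ℝ) ≤ P.dur := P.dur.2
  have h1 := hL.isFlowLine (T := P.dur + 1) (by linarith)
  have h2 := hL.isLeafField (P.dur + 1)
  obtain ⟨N, hN, hsN, -, hφ, -⟩ :=
    SingularFoliation.exists_flow_nhds (by linarith) h2.isOpen h2.smooth h1 hs ht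
  exact ⟨N, hN, hsN, hφ, h1.flow_apply (by linarith) h2.isOpen h2.smooth hs ht⟩

lemma IsLift.flow_source_nhds : ∃ N : Set M, IsOpen N ∧ v ∈ N ∧
    ContMDiffOn (𝓡 n) (𝓡 n) ∞ (flow (O : Set M) X 0 P.dur) N ∧
      flow (O : Set M) X 0 P.dur v = u := by
  have hd : (0 : ℝ) ≤ P.dur := P.dur.2
  rw [← hu, ← hv, ← P.basePath_zero, ← P.basePath_dur]
  exact hL.exists_flow_nhds ⟨hd, by linarith⟩ ⟨le_rfl, by linarith⟩

lemma IsLift.flow_range_nhds : ∃ N : Set M, IsOpen N ∧ u ∈ N ∧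
    ContMDiffOn (𝓡 n) (𝓡 n) ∞ (flow (O : Set M) X P.dur 0) N ∧
      flow (O : Set M) X P.dur 0 u = v := by
  have hd : (0 : ℝ) ≤ P.dur := P.dur.2
  rw [← hu, ← hv, ← P.basePath_zero, ← P.basePath_dur]
  exact hL.exists_flow_nhds ⟨le_rfl, by linarith⟩ ⟨hd, by linarith⟩

lemma IsLift.tendsto_flow_source :
    Tendsto (flow (O : Set M) X 0 P.dur) (𝓝 v) (𝓝 u) := by
  obtain ⟨N, hN, hvN, hφ, h⟩ := hL.flow_source_nhds hu hv
  have := (hφ.continuousOn.continuousAt (hN.mem_nhds hvN)).tendsto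
  rwa [h] at this

lemma IsLift.tendsto_flow_range :
    Tendsto (flow (O : Set M) X P.dur 0) (𝓝 u) (𝓝 v) := by
  obtain ⟨N, hN, huN, hφ, h⟩ := hL.flow_range_nhds hu hv
  have := (hφ.continuousOn.continuousAt (hN.mem_nhds huN)).tendsto
  rwa [h] at this

omit hv in
lemma IsLift.flow_flow_eq :
    ∀ᶠ z in 𝓝 u, flow (O : Set M) X 0 P.dur (flow (O : Set M) X P.dur 0 z) = z := by
  have hd : (0 : ℝ) ≤ P.dur := P.dur.2
  have h1 := hL.isFlowLine (T := P.dur + 1) (by linarith)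
  have h2 := hL.isLeafField (P.dur + 1)
  have h3 := flow_flow (r := 0) (s := P.dur) (t := 0) (by linarith) h2.isOpen h2.smooth h1
    ⟨le_rfl, by linarith⟩ ⟨hd, by linarith⟩ ⟨le_rfl, by linarith⟩
  rw [← hu, ← P.basePath_zero]
  filter_upwards [h3] with z hz
  rw [hz, flow_self]

omit hu in
lemma IsLift.flow_flow_eq' :
    ∀ᶠ z in 𝓝 v, flow (O : Set M) X P.dur 0 (flow (O : Set M) X 0 P.dur z) = z := by
  have hd : (0 : ℝ) ≤ P.dur := P.dur.2
  have h1 := hL.isFlowLine (T := P.dur + 1) (by linarith)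
  have h2 := hL.isLeafField (P.dur + 1)
  have h3 := flow_flow (r := P.dur) (s := 0) (t := P.dur) (by linarith) h2.isOpen h2.smooth h1
    ⟨hd, by linarith⟩ ⟨le_rfl, by linarith⟩ ⟨hd, by linarith⟩
  rw [← hv, ← P.basePath_dur]
  filter_upwards [h3] with z hz
  rw [hz, flow_self]

lemma IsLift.comp_flow_eventuallyEq {O' : Set M} {X' : ℝ → VF n M}
    (hX' : F.IsLeafField (Icc 0 P.dur) O' X') (hγ' : IsFlowLine O' X' 0 P.dur P.basePath)
    {σ : M → Eu n} (hσ : F.IsFirstIntegralAt u σ) :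
    σ ∘ flow (O : Set M) X 0 P.dur =ᶠ[𝓝 v] σ ∘ flow O' X' 0 P.dur := by
  have hd : (0 : ℝ) ≤ P.dur := P.dur.2
  rw [← hu, ← P.basePath_zero] at hσ
  rw [← hv, ← P.basePath_dur]
  exact (hL.isLeafField _).comp_flow_eventuallyEq_of_le hd (hL.isFlowLine hd) hX' hγ' ⟨le_rfl, hd⟩
    ⟨hd, le_rfl⟩ hσ

end Lift

variable {x y z : F.PathCat}

/-- Transport may be computed with any lift and any representative. -/
lemma isTransport_iff_of_lift {p : x ⟶ y} {O : Opens M} {X : ℝ → VF n M}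
    (hL : F.IsLift p.1.toFun p.1.dur O X) {f : F.InvGerm x.pt} {g : F.InvGerm y.pt} {σ : M → Eu n}
    (hf : f.1 = (σ : Filter.Germ (𝓝 x.pt) (Eu n))) : IsTransport p f g ↔
      g.1 = ((σ ∘ flow (O : Set M) X 0 p.1.dur : M → Eu n) : Filter.Germ (𝓝 y.pt) (Eu n)) := by
  refine ⟨?_, fun h => ⟨O, X, σ, hL, hf, h⟩⟩
  rintro ⟨O', X', σ', hL', hf', hg⟩
  refine hg.trans (Filter.Germ.coe_eq.2 ?_)
  have h1 : σ' ∘ flow (O' : Set M) X' 0 p.1.dur =ᶠ[𝓝 y.pt] σ ∘ flow (O' : Set M) X' 0 p.1.dur :=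
    (hL'.tendsto_flow_source p.2.1 p.2.2).eventually (Filter.Germ.coe_eq.1 (hf'.symm.trans hf))
  exact h1.trans (hL'.comp_flow_eventuallyEq p.2.1 p.2.2 (hL.isLeafField _)
    (hL.isFlowLine p.1.dur.2) (germ_isFirstIntegralAt hf))

lemma exists_isTransport (p : x ⟶ y) (f : F.InvGerm x.pt) : ∃ g, IsTransport p f g := by
  obtain ⟨O, X, hL⟩ := p.1.exists_lift
  obtain ⟨σ, hσ, hf⟩ := f.2
  exact ⟨⟨_, σ ∘ flow (O : Set M) X 0 p.1.dur, hL.isFirstIntegralAt p.2.1 p.2.2 hσ, rfl⟩,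
    (isTransport_iff_of_lift hL hf.symm).2 rfl⟩

lemma isTransport_transport (p : x ⟶ y) (f : F.InvGerm x.pt) : IsTransport p f (transport p f) :=
  Classical.epsilon_spec (exists_isTransport p f)

lemma isTransport_iff (p : x ⟶ y) (f : F.InvGerm x.pt) (g : F.InvGerm y.pt) :
    IsTransport p f g ↔ transport p f = g := by
  obtain ⟨O, X, hL⟩ := p.1.exists_lift
  obtain ⟨σ, hσ, hf⟩ := f.2
  have h1 := (isTransport_iff_of_lift hL hf.symm).1 (isTransport_transport p f)
  refine ⟨fun h => ?_, fun h => h ▸ isTransport_transport p f⟩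
  exact Subtype.ext (h1.trans ((isTransport_iff_of_lift hL hf.symm).1 h).symm)

/-- Transport may be computed with any leafwise field that has the given base path. -/
lemma transport_coe_of_leafField {p : x ⟶ y} {O : Set M} {X : ℝ → VF n M}
    (hX : F.IsLeafField (Icc 0 p.1.dur) O X)
    (hγ : IsFlowLine O X 0 p.1.dur (LeafPath.basePath p.1))
    {f : F.InvGerm x.pt} {σ : M → Eu n} (hf : f.1 = (σ : Filter.Germ (𝓝 x.pt) (Eu n))) :
    (transport p f).1 =
      ((σ ∘ flow O X 0 p.1.dur : M → Eu n) : Filter.Germ (𝓝 y.pt) (Eu n)) := by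
  obtain ⟨O', X', hL⟩ := p.1.exists_lift
  refine ((isTransport_iff_of_lift hL hf).1 (isTransport_transport p f)).trans
    (Filter.Germ.coe_eq.2 ?_)
  exact hL.comp_flow_eventuallyEq p.2.1 p.2.2 hX hγ (germ_isFirstIntegralAt hf)

lemma LeafPath.basePath_concat_of_le (P Q : F.LeafPath) (h : P.tgt = Q.src) {s : ℝ}
    (hs : s ≤ P.dur) : (P.concat Q h).basePath s = P.basePath s := by
  have hs' : s.toNNReal ≤ P.dur := by rwa [Real.toNNReal_le_iff_le_coe]
  unfold LeafPath.basePath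
  rw [LeafPath.concat_apply, if_pos hs']

lemma LeafPath.basePath_concat_add (P Q : F.LeafPath) (h : P.tgt = Q.src) {s : ℝ}
    (hs : 0 ≤ s) : (P.concat Q h).basePath (s + P.dur) = Q.basePath s := by
  have hs' : (s + P.dur).toNNReal = s.toNNReal + P.dur := by
    rw [Real.toNNReal_add hs P.dur.coe_nonneg, Real.toNNReal_coe]
  unfold LeafPath.basePath
  rw [LeafPath.concat_apply_of_le _ _ _ (by rw [hs']; exact le_add_of_nonneg_left zero_le), hs',
    add_tsub_cancel_right]

/-- Transport is functorial. -/
lemma transport_comp (p : x ⟶ y) (q : y ⟶ z) (f : F.InvGerm x.pt) :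
    transport (p ≫ q) f = transport q (transport p f) := by
  obtain ⟨σ, hσ, hf⟩ := f.2
  obtain ⟨P, hP, hP'⟩ := p
  obtain ⟨Q, hQ, hQ'⟩ := q
  have hPQ : P.tgt = Q.src := hP'.trans hQ.symm
  set R := P.concat Q hPQ with hR
  have hRz : R.tgt = z.pt := (LeafPath.tgt_concat P Q hPQ).trans hQ'
  obtain ⟨O, X, hL⟩ := R.exists_lift
  obtain ⟨a, ha, ha0⟩ : ∃ a : ℝ, a = P.dur ∧ 0 ≤ a := ⟨_, rfl, P.dur.2⟩
  obtain ⟨b, hb, hb0⟩ : ∃ b : ℝ, b = Q.dur ∧ 0 ≤ b := ⟨_, rfl, Q.dur.2⟩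
  have hdur : (R.dur : ℝ) = a + b := by
    rw [ha, hb]
    exact NNReal.coe_add P.dur Q.dur
  have hX := hL.isLeafField (a + b + 1)
  have hγ : IsFlowLine (O : Set M) X 0 (a + b + 1) R.basePath := hL.isFlowLine (by linarith)
  -- A single lift `X` of the concatenation computes all three transports. It need not be a lift of
  -- `P`, since after time `a` it follows `Q`, but up to time `a` it is a leafwise field with the
  -- base path of `P`, which is enough.
  have h1 : (transport (x := x) (y := y) ⟨P, hP, hP'⟩ f).1 =
      ((σ ∘ flow (O : Set M) X 0 P.dur : M → Eu n) : Filter.Germ (𝓝 y.pt) (Eu n)) := by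
    refine transport_coe_of_leafField (x := x) (y := y) (hL.isLeafField P.dur) ?_ hf.symm
    refine (hL.isFlowLine P.dur.2).congr fun t ht => ?_
    rw [uIcc_of_le P.dur.2] at ht
    exact (P.basePath_concat_of_le Q hPQ ht.2).symm
  have hmaps : ∀ u ∈ uIcc 0 b, 1 * u + a ∈ uIcc 0 (a + b) := by
    intro u hu
    rw [uIcc_of_le hb0] at hu
    rw [uIcc_of_le (by linarith)]
    exact ⟨by linarith [hu.1], by linarith [hu.2]⟩
  -- The second half of `X`, shifted by `a`, is a leafwise field along the base path of `Q`.
  have hX' := (hL.isLeafField (a + b)).comp_affine (m := 1) (k := a) (J' := Icc 0 b)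
    fun u hu => ⟨by linarith [hu.1], by linarith [hu.2]⟩
  have hγ' : IsFlowLine (O : Set M) (fun u z => (1 : ℝ) • X (1 * u + a) z) 0 b Q.basePath := by
    refine ((hL.isFlowLine (T := a + b) (by linarith)).comp_affine hmaps).congr fun t ht => ?_
    rw [uIcc_of_le hb0] at ht
    rw [one_mul, ha]
    exact (P.basePath_concat_add Q hPQ ht.1).symm
  have h2 := transport_coe_of_leafField (x := y) (y := z) (p := ⟨Q, hQ, hQ'⟩) (hb ▸ hX')
    (hb ▸ hγ') h1
  have h3 := transport_coe_of_leafField (x := x) (y := z)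
    (p := ⟨R, (LeafPath.src_concat P Q hPQ).trans hP, hRz⟩) (hL.isLeafField _)
    (hL.isFlowLine R.dur.2) hf.symm
  refine Subtype.ext (h3.trans (Eq.trans ?_ h2.symm))
  apply Filter.Germ.coe_eq.2
  have hend : R.basePath (a + b) = z.pt := by rw [← hdur, ← hRz]; exact R.basePath_dur
  change σ ∘ flow (O : Set M) X 0 R.dur =ᶠ[𝓝 z.pt] (σ ∘ flow (O : Set M) X 0 P.dur) ∘
    flow (O : Set M) (fun u z => (1 : ℝ) • X (1 * u + a) z) 0 Q.dur
  rw [hdur, ← hend, ← ha, ← hb]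
  have hab1 : a + b ∈ Icc 0 (a + b + 1) := ⟨by linarith, by linarith⟩
  have ha1 : a ∈ Icc 0 (a + b + 1) := ⟨ha0, by linarith⟩
  obtain ⟨N, hN, hNz, -, -, hlines⟩ := exists_flow_nhds (s := a + b) (t := a) (by linarith)
    hX.isOpen hX.smooth hγ hab1 ha1
  filter_upwards [hN.mem_nhds hNz, flow_flow (r := a + b) (s := a) (t := 0) (by linarith)
    hX.isOpen hX.smooth hγ hab1 ha1 ⟨le_rfl, by linarith⟩] with w hw hw'
  obtain ⟨c, h3, h4, h5⟩ := hlines w hw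
  have h6 := h3.comp_affine (m := 1) (k := a) (a' := b) (b' := 0) (fun u hu => by
    rw [uIcc_of_ge hb0] at hu
    rw [uIcc_of_ge (by linarith)]
    exact ⟨by linarith [hu.1], by linarith [hu.2]⟩)
  have h7 := h6.flow_eq hX'.isOpen (by rw [uIcc_of_ge hb0]; exact hX'.smooth)
  rw [one_mul, mul_zero, zero_add, add_comm b a, h4, h5] at h7
  simp only [Function.comp_apply]
  rw [h7, hw']

end Transport

end SingularFoliation

namespace SingularFoliation

variable {n : ℕ} {M : Type*} [TopologicalSpace M] [ChartedSpace (Eu n) M]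
  [IsManifold (𝓡 n) ∞ M] {F : SingularFoliation n M}

/-! ### Reversed paths -/

/-- Concatenation of two time-dependent vector fields at time `d`. -/
def concatField (X Y : ℝ → VF n M) (d : ℝ) : ℝ → VF n M := fun t => if t ≤ d then X t else Y (t - d)

/-- The concatenation of good lifts is a lift of the concatenation. -/
lemma IsGoodLift.isLift_concat {p q : F.LeafPath} (hpq : p.tgt = q.src) {X Y : ℝ → VF n M}
    (hX : IsGoodLift p X) (hY : IsGoodLift q Y) :
    F.IsLift (concatFun p.toFun q.toFun p.dur) (p.dur + q.dur) ⊤ (concatField X Y p.dur) := by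
  obtain ⟨ε₁, hε₁, hXe⟩ := hX.zero_end
  obtain ⟨ε₂, hε₂, hce⟩ := hX.const_end
  obtain ⟨ε₃, hε₃, hYs⟩ := hY.zero_start
  obtain ⟨ε, hε, h1, h2⟩ : ∃ ε : ℝ, 0 < ε ∧ ε ≤ ε₁ ∧ ε ≤ ε₂ :=
    ⟨min ε₁ ε₂, lt_min hε₁ hε₂, min_le_left _ _, min_le_right _ _⟩
  set d := p.dur with hd
  set c := concatFun p.toFun q.toFun d with hc
  set W := concatField X Y d with hW
  have hc1 : ∀ s : ℝ, s ≤ d → c s.toNNReal = p.toFun s.toNNReal := by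
    intro s hs
    have : s.toNNReal ≤ d := by rwa [Real.toNNReal_le_iff_le_coe]
    simp [hc, concatFun, this]
  have hc2 : ∀ s : ℝ, d < s + ε → c s.toNNReal = q.toFun (s - d).toNNReal := by
    intro s hs
    by_cases hsd : s ≤ d
    · rw [hc1 s hsd, Real.toNNReal_of_nonpos (sub_nonpos.2 hsd), hY.germ_start, ← hpq]
      apply hce
      rw [Real.coe_toNNReal']
      have := le_max_left s 0
      linarith
    · have h3 : ¬ s.toNNReal ≤ d := by
        rw [Real.toNNReal_le_iff_le_coe]; exact hsd
      simp only [hc, concatFun, if_neg h3]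
      congr 1
      rw [NNReal.sub_def, Real.coe_toNNReal s (by have := d.2; linarith [not_le.1 hsd])]
  have hW1 : ∀ s : ℝ, s ≤ d → W s = X s := fun s hs => if_pos hs
  have hW2 : ∀ s : ℝ, d < s + ε → W s = Y (s - d) := by
    intro s hs
    by_cases hsd : s ≤ d
    · rw [hW1 s hsd, hXe s (by linarith), hYs (s - d) (by linarith)]
    · exact if_neg hsd
  have hγ1 : ∀ s : ℝ, s < d → (fun s : ℝ => F.base (c s.toNNReal)) =ᶠ[𝓝 s]
      fun s => F.base (p.toFun s.toNNReal) := by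
    intro s hs
    filter_upwards [Iio_mem_nhds hs] with r hr
    rw [hc1 r (le_of_lt hr)]
  have hγ2 : ∀ s : ℝ, d < s + ε → (fun s : ℝ => F.base (c s.toNNReal)) =ᶠ[𝓝 s]
      (fun s => F.base (q.toFun s.toNNReal)) ∘ fun s => s - d := by
    intro s hs
    filter_upwards [Ioi_mem_nhds (show (d : ℝ) - ε < s by linarith)] with r hr
    rw [hc2 r (by simpa [sub_lt_iff_lt_add] using hr)]
    rfl
  have hmem : ∀ t : ℝ≥0, W t ∈ F.sec ⊤ := by
    intro t
    by_cases ht : (t : ℝ) ≤ d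
    · rw [hW1 _ ht]; exact hX.mem t
    · have := hY.mem (t - d)
      rw [NNReal.coe_sub (by exact_mod_cast (not_le.1 ht).le)] at this
      rw [hW2 _ (by linarith)]
      exact this
  refine ⟨hmem, ?_, fun _ => trivial, ?_, ?_, ?_, ?_, ?_⟩
  · rintro ⟨t, x⟩ -
    apply ContMDiffAt.contMDiffWithinAt
    by_cases ht : t < d
    · have := hX.smooth (t, x) trivial
      rw [contMDiffWithinAt_univ] at this
      refine this.congr_of_eventuallyEq ?_
      filter_upwards [(isOpen_Iio.prod isOpen_univ).mem_nhds
        (show (t, x) ∈ Iio (d : ℝ) ×ˢ (univ : Set M) from ⟨ht, trivial⟩)] with w hw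
      rw [hW1 w.1 (le_of_lt hw.1)]
    · have h3 := hY.smooth (t - d, x) trivial
      rw [contMDiffWithinAt_univ] at h3
      have h4 : ContMDiff (𝓘(ℝ, ℝ).prod (𝓡 n)) (𝓘(ℝ, ℝ).prod (𝓡 n)) ∞
          (fun w : ℝ × M => (w.1 - (d : ℝ), w.2)) :=
        (contMDiff_fst.sub contMDiff_const).prodMk contMDiff_snd
      have h5 := ContMDiffAt.comp (t, x) h3 h4.contMDiffAt
      refine h5.congr_of_eventuallyEq ?_
      filter_upwards [(isOpen_Ioi.prod isOpen_univ).mem_nhds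
        (show (t, x) ∈ Ioi ((d : ℝ) - ε) ×ˢ (univ : Set M) from
          ⟨by simp only [mem_Ioi]; linarith, trivial⟩)] with w hw
      rw [hW2 w.1 (by have := hw.1; simp only [mem_Ioi] at this; linarith)]
      rfl
  · intro t _
    apply ContMDiffAt.contMDiffWithinAt
    by_cases ht : t < d
    · exact hX.base_smooth.contMDiffAt.congr_of_eventuallyEq (hγ1 t ht)
    · refine ContMDiffAt.congr_of_eventuallyEq ?_ (hγ2 t (by linarith))
      exact (hY.base_smooth.comp (contMDiff_id.sub contMDiff_const)).contMDiffAt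
  · intro t
    by_cases ht : (t : ℝ) ≤ d
    · have e := hc1 t ht
      rw [Real.toNNReal_coe] at e
      have e2 := hX.germ_eq t
      rw [← e] at e2
      refine e2.trans (F.germ_eq_germ.2 (.of_forall fun z => ?_))
      rw [hW1 _ ht]
    · have e := hc2 t (by linarith)
      rw [Real.toNNReal_coe] at e
      have e2 := hY.germ_eq ((t : ℝ) - d).toNNReal
      rw [← e] at e2
      refine e2.trans (F.germ_eq_germ.2 (.of_forall fun z => ?_))
      rw [hW2 _ (by linarith), Real.coe_toNNReal _ (by linarith)]
  · intro t ht0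
    apply HasMFDerivAt.hasMFDerivWithinAt
    by_cases ht : t < d
    · have := (hX.velocity t).congr_of_eventuallyEq (hγ1 t ht)
      rw [← hc1 t ht.le] at this
      rw [hW1 t ht.le]
      exact this
    · have hs : HasMFDerivAt 𝓘(ℝ, ℝ) 𝓘(ℝ, ℝ) (fun s : ℝ => s - d) t (ContinuousLinearMap.id ℝ ℝ) :=
        ((hasFDerivAt_id t).sub_const (d : ℝ)).hasMFDerivAt
      have h3 := (HasMFDerivAt.comp t (hY.velocity (t - d)) hs).congr_of_eventuallyEq
        (hγ2 t (by linarith))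
      rw [← hc2 t (by linarith)] at h3
      rw [hW2 t (by linarith)]
      exact h3
  · have e := hc1 0 d.2
    rw [Real.toNNReal_zero] at e
    rw [e, hX.germ_start]
    rfl
  · intro t ht
    have htd : d ≤ t := le_trans (le_add_of_nonneg_right (zero_le)) ht
    have htd' : (d : ℝ) ≤ t := by exact_mod_cast htd
    have e := hc2 t (by linarith)
    rw [Real.toNNReal_coe] at e
    rw [e, hY.germ_end]
    · rfl
    · rw [← NNReal.coe_le_coe, Real.coe_toNNReal _ (by linarith)]
      have : ((d + q.dur : ℝ≥0) : ℝ) ≤ t := by exact_mod_cast ht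
      push_cast at this
      linarith

section Reverse

variable {P : F.LeafPath} {X : ℝ → VF n M} (hX : IsGoodLift P X)

include hX

lemma IsGoodLift.reverse_mem (t : ℝ≥0) : (fun z => -X (P.dur - t) z) ∈ F.sec ⊤ := by
  obtain ⟨ε, hε, h0⟩ := hX.zero_start
  -- After time `P.dur` the reversed field involves `X` at negative times, where a good lift is
  -- zero.
  have h1 : X (P.dur - t) ∈ F.sec ⊤ := by
    by_cases ht : 0 ≤ (P.dur : ℝ) - t
    · have := hX.mem ((P.dur : ℝ) - t).toNNReal
      rwa [Real.coe_toNNReal _ ht] at this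
    · rw [h0 _ (by linarith)]
      exact F.zero_mem ⊤
  have h2 := F.smul_mem (f := fun _ => (-1 : ℝ)) contMDiffOn_const h1
  simpa using h2

lemma IsGoodLift.basePath_of_dur_le {s : ℝ} (hs : P.dur ≤ s) : P.basePath s = P.tgt := by
  unfold LeafPath.basePath
  rw [hX.germ_end _ (NNReal.le_toNNReal_of_coe_le hs)]
  rfl

/-- The germs along the reversed path. -/
def IsGoodLift.reverseFun (t : ℝ≥0) : F.GermSpace :=
  F.germ ⊤ (fun z => -X (P.dur - t) z) (hX.reverse_mem t) (P.basePath (P.dur - t)) trivial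

lemma IsGoodLift.base_reverseFun (s : ℝ) :
    F.base (hX.reverseFun s.toNNReal) = P.basePath (P.dur - s) := by
  change P.basePath (P.dur - s.toNNReal) = _
  rcases le_total 0 s with hs | hs
  · rw [Real.coe_toNNReal s hs]
  · rw [Real.toNNReal_of_nonpos hs, NNReal.coe_zero, sub_zero, hX.basePath_of_dur_le le_rfl,
      hX.basePath_of_dur_le (by linarith)]

lemma IsGoodLift.reverse_smooth : SmoothFamilyOn univ fun (t : ℝ) (z : M) => -X (P.dur - t) z := by
  have h1 : SmoothFamilyOn (univ ×ˢ univ) X := by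
    rw [univ_prod_univ]; exact hX.smooth
  have h2 := smoothFamilyOn_comp_affine (J' := univ) (m := -1) (k := P.dur) h1 fun _ _ => trivial
  rw [univ_prod_univ] at h2
  have h3 : (fun (t : ℝ) (z : M) => -X (P.dur - t) z) =
      fun (u : ℝ) (z : M) => (-1 : ℝ) • X (-1 * u + P.dur) z := by
    funext t z
    rw [show -1 * t + (P.dur : ℝ) = P.dur - t by ring]
    exact (neg_one_smul ℝ _).symm
  rw [h3]
  exact h2

lemma IsGoodLift.reverse_base_smooth :
    ContMDiff 𝓘(ℝ, ℝ) (𝓡 n) ∞ fun s : ℝ => F.base (hX.reverseFun s.toNNReal) := by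
  simp only [hX.base_reverseFun]
  have h1 : ContDiff ℝ ∞ (fun s : ℝ => (P.dur : ℝ) - s) := by fun_prop
  exact hX.base_smooth.comp h1.contMDiff

lemma IsGoodLift.reverse_velocity (t : ℝ) :
    HasMFDerivAt 𝓘(ℝ, ℝ) (𝓡 n) (fun s : ℝ => F.base (hX.reverseFun s.toNNReal)) t
      ((1 : ℝ →L[ℝ] ℝ).smulRight (-X (P.dur - t) (F.base (hX.reverseFun t.toNNReal)))) := by
  -- The base path occurs in the type of its velocity, so it is generalised before being replaced.
  suffices key : ∀ β : ℝ → M, (β = fun s => P.basePath (P.dur - s)) →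
      HasMFDerivAt 𝓘(ℝ, ℝ) (𝓡 n) β t ((1 : ℝ →L[ℝ] ℝ).smulRight (-X (P.dur - t) (β t))) from
    key _ (funext hX.base_reverseFun)
  rintro _ rfl
  have h1 : HasDerivAt (fun s : ℝ => (P.dur : ℝ) - s) (-1) t := by
    simpa using (hasDerivAt_id t).const_sub (P.dur : ℝ)
  have h2 : HasMFDerivAt 𝓘(ℝ, ℝ) 𝓘(ℝ, ℝ) (fun s : ℝ => (P.dur : ℝ) - s) t
      ((1 : ℝ →L[ℝ] ℝ).smulRight (-1 : ℝ)) := hasMFDerivAt_iff_hasFDerivAt.2 h1.hasFDerivAt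
  have h3 := HasMFDerivAt.comp (g := P.basePath) t (hX.velocity (P.dur - t)) h2
  have h4 : ((1 : ℝ →L[ℝ] ℝ).smulRight (-X (P.dur - t) (P.basePath (P.dur - t))) :
      ℝ →L[ℝ] TangentSpace (𝓡 n) (P.basePath (P.dur - t))) =
      ((1 : ℝ →L[ℝ] ℝ).smulRight (X (P.dur - t) (P.basePath (P.dur - t)))).comp
        ((1 : ℝ →L[ℝ] ℝ).smulRight (-1 : ℝ)) := by
    apply ContinuousLinearMap.ext
    intro r
    change r • -X (P.dur - t) (P.basePath (P.dur - t)) =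
      (r • (-1 : ℝ)) • X (P.dur - t) (P.basePath (P.dur - t))
    rw [smul_assoc, neg_one_smul]
  rw [h4]
  exact h3

lemma IsGoodLift.reverse_start : ∃ ε > 0, ∀ t : ℝ≥0, (t : ℝ) < ε →
    hX.reverseFun t = F.zeroGerm P.tgt := by
  obtain ⟨ε, hε, h0⟩ := hX.zero_end
  obtain ⟨ε', hε', h1⟩ := hX.const_end
  refine ⟨min ε ε', lt_min hε hε', fun t ht => ?_⟩
  have ht1 := ht.trans_le (min_le_left _ _)
  have ht2 := ht.trans_le (min_le_right _ _)
  have hb : P.basePath (P.dur - t) = P.tgt := by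
    unfold LeafPath.basePath
    rw [h1 _ (by have := Real.le_coe_toNNReal ((P.dur : ℝ) - t); linarith)]
    rfl
  unfold IsGoodLift.reverseFun
  simp only [hb]
  refine F.germ_eq_germ.2 (.of_forall fun z => ?_)
  rw [h0 _ (by linarith)]
  exact neg_zero

lemma IsGoodLift.reverse_end : ∃ ε > 0, ∀ t : ℝ≥0, (P.dur : ℝ) < t + ε →
    hX.reverseFun t = F.zeroGerm P.src := by
  obtain ⟨ε, hε, h0⟩ := hX.zero_start
  obtain ⟨ε', hε', h1⟩ := P.const_start
  refine ⟨min ε ε', lt_min hε hε', fun t ht => ?_⟩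
  have ht1 : (P.dur : ℝ) - t < ε := by linarith [min_le_left ε (ε' : ℝ)]
  have ht2 : (P.dur : ℝ) - t < ε' := by linarith [min_le_right ε (ε' : ℝ)]
  have hb : P.basePath (P.dur - t) = P.src := by
    unfold LeafPath.basePath
    rw [h1 _ (by
      rw [← NNReal.coe_lt_coe, Real.coe_toNNReal']
      exact max_lt ht2 hε')]
    rfl
  unfold IsGoodLift.reverseFun
  simp only [hb]
  refine F.germ_eq_germ.2 (.of_forall fun z => ?_)
  rw [h0 _ (by linarith)]
  exact neg_zero

lemma IsGoodLift.reverse_isLift :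
    F.IsLift hX.reverseFun P.dur ⊤ fun (t : ℝ) (z : M) => -X (P.dur - t) z where
  mem := hX.reverse_mem
  smooth := ContMDiffOn.mono hX.reverse_smooth (subset_univ _)
  base_mem _ := trivial
  base_smooth := hX.reverse_base_smooth.contMDiffOn
  germ_eq _ := rfl
  velocity t _ := (hX.reverse_velocity t).hasMFDerivWithinAt
  germ_start := by
    obtain ⟨ε, hε, h⟩ := hX.reverse_start
    rw [h 0 hε]
    rfl
  germ_end t ht := by
    obtain ⟨ε, hε, h⟩ := hX.reverse_end
    rw [h t (by have : (P.dur : ℝ) ≤ t := ht; linarith)]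
    rfl

/-- The reversed path. -/
def IsGoodLift.reverse : F.LeafPath where
  toFun := hX.reverseFun
  dur := P.dur
  dsmooth := hX.reverse_isLift.dsmooth
  const_start := by
    obtain ⟨ε, hε, h⟩ := hX.reverse_start
    refine ⟨ε.toNNReal, by simpa using hε, fun t ht => ?_⟩
    rw [h 0 hε, h t]
    rwa [← NNReal.coe_lt_coe, Real.coe_toNNReal _ hε.le] at ht
  const_end := by
    obtain ⟨ε, hε, h⟩ := hX.reverse_end
    refine ⟨ε.toNNReal, by simpa using hε, fun t ht => ?_⟩
    rw [h P.dur (by linarith), h t]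
    rwa [← NNReal.coe_lt_coe, NNReal.coe_add, Real.coe_toNNReal _ hε.le] at ht
  exists_lift := ⟨_, _, hX.reverse_isLift⟩

lemma IsGoodLift.src_reverse : hX.reverse.src = P.tgt := by
  obtain ⟨ε, hε, h⟩ := hX.reverse_start
  change F.base (hX.reverseFun 0) = _
  rw [h 0 hε]
  rfl

lemma IsGoodLift.tgt_reverse : hX.reverse.tgt = P.src := by
  obtain ⟨ε, hε, h⟩ := hX.reverse_end
  change F.base (hX.reverseFun P.dur) = _
  rw [h P.dur (by linarith)]
  rfl

lemma IsGoodLift.isGoodLift_reverse :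
    IsGoodLift hX.reverse fun (t : ℝ) (z : M) => -X (P.dur - t) z where
  mem := hX.reverse_mem
  smooth := hX.reverse_smooth
  base_smooth := hX.reverse_base_smooth
  germ_eq _ := rfl
  velocity := hX.reverse_velocity
  germ_start := hX.reverse_isLift.germ_start
  germ_end t ht := by
    obtain ⟨ε, hε, h⟩ := hX.reverse_end
    rw [hX.tgt_reverse]
    exact h t (by have : (P.dur : ℝ) ≤ t := ht; linarith)
  zero_start := by
    obtain ⟨ε, hε, h⟩ := hX.zero_end
    refine ⟨ε, hε, fun t ht => ?_⟩
    funext z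
    rw [h _ (by linarith)]
    exact neg_zero
  zero_end := by
    obtain ⟨ε, hε, h⟩ := hX.zero_start
    refine ⟨ε, hε, fun t ht => ?_⟩
    funext z
    change (P.dur : ℝ) < t + ε at ht
    rw [h _ (by linarith)]
    exact neg_zero
  const_end := by
    obtain ⟨ε, hε, h⟩ := hX.reverse_end
    refine ⟨ε, hε, fun t ht => ?_⟩
    rw [hX.tgt_reverse]
    exact h t ht

variable [T2Space M]

/-- Following a path and then its reverse, the flow returns to its starting point. -/
lemma IsGoodLift.flow_concat_reverse (w : M) :
    flow (univ : Set M) (concatField X (fun (t : ℝ) (z : M) => -X (P.dur - t) z) P.dur)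
      ((P.dur : ℝ) + P.dur) 0 w = w := by
  have hd : (0 : ℝ) ≤ P.dur := P.dur.2
  -- If no flow line exists, `flow` fixes the point by its default value. Otherwise the first half
  -- of the flow line and its second half run backwards are flow lines of `X` that meet at time
  -- `P.dur`, so they coincide.
  rcases flow_cases (univ : Set M)
    (concatField X (fun (t : ℝ) (z : M) => -X (P.dur - t) z) P.dur) ((P.dur : ℝ) + P.dur) 0 w
    with h | ⟨c, h1, h2, h3⟩
  · exact h
  rw [← h3, ← h2]
  have hu : uIcc (0 : ℝ) P.dur = Icc 0 (P.dur : ℝ) := uIcc_of_le hd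
  have hu' : uIcc (0 : ℝ) (P.dur + P.dur) = Icc 0 ((P.dur : ℝ) + P.dur) :=
    uIcc_of_le (by linarith)
  have hc1 : IsFlowLine univ X 0 P.dur c := by
    refine (h1.subinterval ?_).congr_field fun t ht z _ => ?_
    · rw [hu, hu']
      exact Icc_subset_Icc le_rfl (by linarith)
    · rw [hu] at ht
      simp only [concatField, if_pos ht.2]
  have hc2 : IsFlowLine univ X 0 P.dur fun t => c (-1 * t + (P.dur + P.dur)) := by
    refine (h1.comp_affine fun t ht => ?_).congr_field fun t ht z _ => ?_
    · rw [hu] at ht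
      rw [hu']
      exact ⟨by linarith [ht.2], by linarith [ht.1]⟩
    · rw [hu] at ht
      obtain ⟨ε, hε, h0⟩ := hX.zero_end
      -- At the junction `concatField` takes the value of its first field, without the sign of the
      -- reversed one. This is harmless, as `X` vanishes near the end time.
      rcases ht.2.lt_or_eq with hlt | heq
      · simp only [concatField]
        rw [if_neg (by linarith), show (P.dur : ℝ) - (-1 * t + (P.dur + P.dur) - P.dur) = t by ring]
        rw [smul_neg, neg_one_smul, neg_neg]
      · simp only [concatField]
        rw [if_pos (by linarith), h0 _ (by linarith), h0 _ (by linarith)]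
        exact smul_zero _
  have := hc1.unique isOpen_univ (ContMDiffOn.mono hX.smooth (subset_univ _)) hc2
    (s := P.dur) (t := 0) right_mem_uIcc left_mem_uIcc (by congr 1; ring)
  rw [this]
  congr 1
  ring

end Reverse

end SingularFoliation

namespace SingularFoliation

variable {n : ℕ} {M : Type*} [TopologicalSpace M] [ChartedSpace (Eu n) M]
  [IsManifold (𝓡 n) ∞ M] {F : SingularFoliation n M}

/-! ### Slices -/

/-- In the chart the curve lies in `V`, so its component along a complement of `V` vanishes
identically, and so does the derivative of that component. -/
lemma IsTangent.chartDeriv_mem {S : Set M} {y : M} {v : TangentSpace (𝓡 n) y}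
    (h : IsTangent S y v) {e : OpenPartialHomeomorph M (Eu n)}
    (he : e ∈ IsManifold.maximalAtlas (𝓡 n) ∞ M) (hy : y ∈ e.source) {V : Submodule ℝ (Eu n)}
    (hS : ∀ z ∈ e.source, z ∈ S ↔ e z ∈ V) : chartDeriv e y v ∈ V := by
  obtain ⟨c, ε, hε, -, hcS, rfl, hd⟩ := h
  obtain ⟨V', hV'⟩ := V.exists_isCompl
  set π := projAlong hV'.symm
  have h1 : HasMFDerivAt 𝓘(ℝ, ℝ) 𝓘(ℝ, Eu n) (e ∘ c) 0 _ :=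
    HasMFDerivAt.comp 0 (hasMFDerivAt_chart he hy) hd
  have h2 : HasFDerivAt (e ∘ c)
      ((chartDeriv e (c 0)).comp ((1 : ℝ →L[ℝ] ℝ).smulRight v) : ℝ →L[ℝ] Eu n) 0 :=
    hasMFDerivAt_iff_hasFDerivAt.1 h1
  have h3 := (π.hasFDerivAt.comp (0 : ℝ) h2).hasDerivAt
  have h4 : (⇑π ∘ e ∘ c) =ᶠ[𝓝 0] fun _ => (0 : Eu n) := by
    filter_upwards [hd.continuousAt.eventually (e.open_source.mem_nhds hy),
      Ioo_mem_nhds (neg_lt_zero.2 hε) hε] with t ht ht'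
    exact (projAlong_eq_zero_iff _).2 ((hS _ ht).1 (hcS t ht'))
  have h5 := h3.unique ((hasDerivAt_const (0 : ℝ) (0 : Eu n)).congr_of_eventuallyEq h4)
  have h6 : π (chartDeriv e (c 0) ((1 : ℝ) • v)) = 0 := h5
  rw [one_smul] at h6
  exact (projAlong_eq_zero_iff _).1 h6

/-- The required curve is a straight segment in the chart. -/
lemma isTangent_of_chartDeriv_mem {S : Set M} {e : OpenPartialHomeomorph M (Eu n)}
    (he : e ∈ IsManifold.maximalAtlas (𝓡 n) ∞ M) {V : Submodule ℝ (Eu n)}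
    (hS : ∀ z ∈ e.source, z ∈ S ↔ e z ∈ V) {y : M} (hy : y ∈ e.source) (hyS : y ∈ S)
    {v : TangentSpace (𝓡 n) y} (hv : chartDeriv e y v ∈ V) : IsTangent S y v := by
  suffices key : ∀ a ∈ e.target, e.symm a ∈ S → ∀ v : TangentSpace (𝓡 n) (e.symm a),
      chartDeriv e (e.symm a) v ∈ V → IsTangent S (e.symm a) v by
    have := key (e y) (e.map_source hy)
    rw [e.left_inv hy] at this
    exact this hyS v hv
  clear hv hyS hy
  intro a ha haS v hv
  set h := chartDeriv e (e.symm a) v with hh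
  have haV : a ∈ V := by
    have := (hS _ (e.map_target ha)).1 haS
    rwa [e.right_inv ha] at this
  have h1 : HasDerivAt (fun t : ℝ => a + t • h) h 0 := by
    simpa using ((hasDerivAt_id (0 : ℝ)).smul_const h).const_add a
  have ha0 : a + (0 : ℝ) • h = a := by simp
  have hcont : Continuous fun t : ℝ => a + t • h := by fun_prop
  obtain ⟨ε, hε, hball⟩ := Metric.mem_nhds_iff.1 (hcont.continuousAt.eventually
    (e.open_target.mem_nhds (show a + (0 : ℝ) • h ∈ e.target by rwa [ha0])))
  have hIoo : ∀ t ∈ Ioo (-ε) ε, a + t • h ∈ e.target := fun t ht => hball (by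
    rw [Metric.mem_ball, Real.dist_eq, sub_zero, abs_lt]; exact ht)
  have hcd : ContDiff ℝ ∞ fun t : ℝ => a + t • h := by fun_prop
  have hc0 : e.symm (a + (0 : ℝ) • h) = e.symm a := by rw [ha0]
  refine ⟨fun t => e.symm (a + t • h), ε, hε, ?_, fun t ht => ?_, hc0, ?_⟩
  · exact (chart_symm_contMDiffOn he).comp hcd.contMDiff.contMDiffOn hIoo
  · rw [hS _ (e.map_target (hIoo t ht)), e.right_inv (hIoo t ht)]
    exact V.add_mem haV (V.smul_mem _ hv)
  · have h2 : HasMFDerivAt 𝓘(ℝ, ℝ) 𝓘(ℝ, Eu n) (fun t : ℝ => a + t • h) 0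
        ((1 : ℝ →L[ℝ] ℝ).smulRight h) := hasMFDerivAt_iff_hasFDerivAt.2 h1.hasFDerivAt
    have h3 := HasMFDerivAt.comp (0 : ℝ) (hasMFDerivAt_chart_symm he
      (show a + (0 : ℝ) • h ∈ e.target by rwa [ha0])) h2
    have hcast : ∀ {y' y : M} (hyy : y' = y) (v : TangentSpace (𝓡 n) y),
        ((hyy ▸ v : TangentSpace (𝓡 n) y') : Eu n) = v := by
      rintro y' y rfl v
      rfl
    have h4 : (chartSymmDeriv e (a + (0 : ℝ) • h) h : Eu n) = v := by
      have h5 : ∀ b, b = a → (chartSymmDeriv e b h : Eu n) = v := by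
        rintro b rfl
        exact chartDeriv_injective he (e.map_target ha) (chartDeriv_chartSymmDeriv he ha h)
      exact h5 _ ha0
    have h6 : ((1 : ℝ →L[ℝ] ℝ).smulRight (hc0 ▸ v : TangentSpace (𝓡 n) (e.symm (a + (0 : ℝ) • h))) :
        ℝ →L[ℝ] TangentSpace (𝓡 n) (e.symm (a + (0 : ℝ) • h))) =
        (chartSymmDeriv e (a + (0 : ℝ) • h)).comp ((1 : ℝ →L[ℝ] ℝ).smulRight h) := by
      have h7 : (hc0 ▸ v : TangentSpace (𝓡 n) (e.symm (a + (0 : ℝ) • h))) =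
          chartSymmDeriv e (a + (0 : ℝ) • h) h := (hcast hc0 v).trans h4.symm
      rw [h7]
      apply ContinuousLinearMap.ext
      intro r
      exact ((chartSymmDeriv e (a + (0 : ℝ) • h)).map_smul r h).symm
    rw [h6]
    exact h3

variable [T2Space M]

/-- Around a slice there is an adapted chart in which the slice is linear. -/
lemma Slice.exists_chart {y : M} (S : F.Slice y) : ∃ e V H, IsAdapted F y e V H ∧
    ∀ z ∈ e.source, z ∈ S.carrier ↔ e z ∈ V := by
  obtain ⟨k, hk⟩ := S.embedded
  obtain ⟨e₀, he₀, hy, V, -, hV⟩ := hk y S.mem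
  have hyV : e₀ y ∈ V := (hV y hy).1 S.mem
  -- The two conditions on a slice at `y`, trivial intersection and spanning, say that the slice and
  -- the leaf have complementary tangent spaces.
  have hcompl : IsCompl V (F.leafImage e₀ y) := by
    refine IsCompl.of_eq ?_ ?_
    · rw [eq_bot_iff]
      rintro w ⟨hw, v, hv, rfl⟩
      have := S.inter v (isTangent_of_chartDeriv_mem he₀ hV hy S.mem hw) hv
      rw [this]
      exact (chartDeriv e₀ y).map_zero
    · rw [eq_top_iff]
      rintro w -
      obtain ⟨w, rfl⟩ := chartDeriv_surjective he₀ hy w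
      obtain ⟨v, hv, u, hu, rfl⟩ := S.span y S.mem w
      rw [ContinuousLinearMap.map_add]
      exact Submodule.add_mem_sup (hv.chartDeriv_mem he₀ hy hV) (chartDeriv_mem_leafImage hu)
  -- The straightening does not move the points of the transversal, so the slice remains the linear
  -- subspace `V` in the new chart.
  obtain ⟨e, he, hsrc, -, heq⟩ := exists_isAdapted he₀ hy hcompl rfl
  refine ⟨e, V, _, he, fun z hz => ?_⟩
  rw [hV z (hsrc hz)]
  constructor
  · intro h
    rwa [heq z hz (Or.inl (V.sub_mem h hyV))]
  · intro h
    rwa [← heq z hz (Or.inr (V.sub_mem h hyV))]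

/-- First integrals that agree on a slice agree near it. -/
lemma Slice.eventuallyEq_of_nhdsWithin {y : M} (S : F.Slice y) {τ τ' : M → Eu n}
    (hτ : F.IsFirstIntegralAt y τ) (hτ' : F.IsFirstIntegralAt y τ')
    (h : τ =ᶠ[𝓝[S.carrier] y] τ') : τ =ᶠ[𝓝 y] τ' := by
  obtain ⟨e, V, H, he, hS⟩ := S.exists_chart
  obtain ⟨B, hyB, hB⟩ := isFirstIntegralAt_iff.1 hτ
  obtain ⟨B', hyB', hB'⟩ := isFirstIntegralAt_iff.1 hτ'
  set π := projAlong he.isCompl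
  have hy := he.mem_source
  have hπy : π (e y) = e y := projAlong_of_mem_left he.isCompl ((hS y hy).1 S.mem)
  have hU : IsOpen (e.target ∩ e.symm ⁻¹' (B ∩ B')) :=
    e.isOpen_inter_preimage_symm (hB.isOpen.inter hB'.isOpen)
  obtain ⟨ε, hε, hball⟩ := Metric.nhds_basis_ball.mem_iff.1 (hU.mem_nhds
    (show e y ∈ e.target ∩ e.symm ⁻¹' (B ∩ B') from ⟨e.map_source hy,
      by rw [mem_preimage, e.left_inv hy]; exact ⟨hyB, hyB'⟩⟩))
  have hproj : Tendsto (fun z => π (e z)) (𝓝 y) (𝓝 (e y)) := by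
    have := (π.continuous.continuousAt (x := e y)).tendsto.comp (e.continuousAt hy).tendsto
    rwa [hπy] at this
  have hev1 := hproj.eventually (Metric.ball_mem_nhds (e y) hε)
  -- The map `z ↦ e.symm (π (e z))` retracts a neighbourhood of `y` onto the slice along the
  -- directions of `H`, which first integrals do not see.
  have hback : Tendsto (fun z => e.symm (π (e z))) (𝓝 y) (𝓝[S.carrier] y) := by
    refine tendsto_nhdsWithin_iff.2 ⟨?_, ?_⟩
    · have := (e.symm.continuousAt (e.map_source hy)).tendsto.comp hproj
      rwa [e.left_inv hy] at this
    · filter_upwards [hev1] with z hz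
      have hzt := (hball hz).1
      rw [hS _ (e.map_target hzt), e.right_inv hzt]
      exact projAlong_mem _ _
  filter_upwards [hback.eventually h, hev1, e.open_source.mem_nhds hy,
    (e.continuousAt hy).eventually (Metric.ball_mem_nhds (e y) hε)] with z h1 h2 h3 h4
  have hH : e z - π (e z) ∈ H := sub_projAlong_mem _ _
  have e1 := hB.eq_of_sub_mem he (convex_ball _ _) (fun w hw => ⟨(hball hw).1, (hball hw).2.1⟩)
    h2 h4 hH
  have e2 := hB'.eq_of_sub_mem he (convex_ball _ _) (fun w hw => ⟨(hball hw).1, (hball hw).2.2⟩)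
    h2 h4 hH
  rw [e.left_inv h3] at e1 e2
  rw [← e1, ← e2, h1]

/-! ### Flows that fix a point -/

/-- Flow lines that start near a zero of the vector field stay near it. -/
lemma exists_nhds_flowLine_mem {A : Set M} {W : ℝ → VF n M} {y : M}
    {e : OpenPartialHomeomorph M (Eu n)} (he : e ∈ IsManifold.maximalAtlas (𝓡 n) ∞ M)
    (hy : y ∈ e.source) (hyA : y ∈ A) {V : Submodule ℝ (Eu n)}
    (hV : ∀ᶠ z in 𝓝 y, z ∈ A ↔ e z ∈ V) (hW : SmoothFamilyOn (Icc (0 : ℝ) 1 ×ˢ A) W)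
    (hW0 : ∀ t ∈ Icc (0 : ℝ) 1, W t y = 0) {N : Set M} (hN : N ∈ 𝓝 y) :
    ∃ N' ∈ 𝓝 y, ∀ c, IsFlowLine A W 0 1 c → c 0 ∈ N' → ∀ t ∈ Icc (0 : ℝ) 1, c t ∈ N := by
  have hty := e.map_source hy
  have hsymm : Tendsto e.symm (𝓝 (e y)) (𝓝 y) := by
    have := (e.symm.continuousAt hty).tendsto
    rwa [e.left_inv hy] at this
  have hNV : ∀ᶠ z in 𝓝 y, z ∈ N ∧ (z ∈ A ↔ e z ∈ V) := (show ∀ᶠ z in 𝓝 y, z ∈ N from hN).and hV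
  have hnear : ∀ᶠ a in 𝓝 (e y), a ∈ e.target ∧ (e.symm a ∈ N ∧ (e.symm a ∈ A ↔ e (e.symm a) ∈ V)) :=
    (show ∀ᶠ a in 𝓝 (e y), a ∈ e.target from e.open_target.mem_nhds hty).and
      (hsymm.eventually hNV)
  obtain ⟨ε, hε, hball⟩ := Metric.nhds_basis_closedBall.mem_iff.1 hnear
  have hball : ∀ a ∈ Metric.closedBall (e y) ε,
      a ∈ e.target ∧ (e.symm a ∈ N ∧ (e.symm a ∈ A ↔ a ∈ V)) := by
    intro a ha
    obtain ⟨h1, h2, h3⟩ := hball ha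
    rw [e.right_inv h1] at h3
    exact ⟨h1, h2, h3⟩
  have heyV : e y ∈ V := hV.self_of_nhds.1 hyA
  -- The field is known to be smooth only on `A`, which may be a slice. The Lipschitz estimate is
  -- therefore made on the compact convex set of points of `V` in a ball.
  set C : Set (Eu n) := Metric.closedBall (e y) ε ∩ V with hC
  have hCc : IsCompact C :=
    (isCompact_closedBall _ _).inter_right (Submodule.closed_of_finiteDimensional V)
  have hCconv : Convex ℝ C := (convex_closedBall _ _).inter V.convex
  have hCsub : C ⊆ e.target ∩ e.symm ⁻¹' A := fun a ha =>
    ⟨(hball a ha.1).1, (hball a ha.1).2.2.2 ha.2⟩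
  obtain ⟨K, hK⟩ := exists_lipschitzOnWith_of_contDiffOn
    ((contDiffOn_chartRep he hW).mono (prod_mono subset_rfl hCsub))
    ((convex_Icc (0 : ℝ) 1).prod hCconv) (isCompact_Icc.prod hCc)
  have hvy : ∀ t ∈ Icc (0 : ℝ) 1, chartRep e (W t) (e y) = 0 := by
    intro t ht
    rw [chartRep_apply hy, hW0 t ht]
    exact (chartDeriv e y).map_zero
  -- In unit time the Gronwall factor is at most `exp K`, so curves that start within `δ` stay
  -- within `ε / 2` until they leave the ball of radius `ε`.
  set δ := ε / 2 * Real.exp (-K) with hδ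
  have hδ0 : 0 < δ := by positivity
  have hδε : δ ≤ ε / 2 := by
    have : Real.exp (-(K : ℝ)) ≤ 1 := Real.exp_le_one_iff.2 (neg_nonpos.2 K.2)
    rw [hδ]
    nlinarith
  set Q : Set M := e.source ∩ e ⁻¹' Metric.ball (e y) ε with hQ
  have hQo : IsOpen Q := e.isOpen_inter_preimage Metric.isOpen_ball
  refine ⟨e.source ∩ e ⁻¹' Metric.ball (e y) δ,
    (e.isOpen_inter_preimage Metric.isOpen_ball).mem_nhds ⟨hy, Metric.mem_ball_self hδ0⟩, ?_⟩
  intro c hc hc0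
  have hu : uIcc (0 : ℝ) 1 = Icc 0 1 := uIcc_of_le zero_le_one
  have hcont : ContinuousOn c (Icc 0 1) := hu ▸ hc.continuousOn
  suffices hall : ∀ t ∈ Icc (0 : ℝ) 1, c t ∈ Q by
    intro t ht
    obtain ⟨h1, h2⟩ := hall t ht
    have := (hball _ (Metric.ball_subset_closedBall h2)).2.1
    rwa [e.left_inv h1] at this
  by_contra! hex
  obtain ⟨t₁, ht₁, ht₁Q⟩ := hex
  -- The infimum of `T` is the first time at which the curve has left `Q`. Up to then it stays in
  -- the smaller ball, whose image in `M` is compact and hence closed, so at that time it is still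
  -- in `Q`.
  set T := Icc (0 : ℝ) 1 ∩ c ⁻¹' Qᶜ with hT
  have hTc : IsCompact T := isCompact_Icc.of_isClosed_subset
    (hcont.preimage_isClosed_of_isClosed isClosed_Icc hQo.isClosed_compl) inter_subset_left
  have hTmem : sInf T ∈ T := hTc.sInf_mem ⟨t₁, ht₁, ht₁Q⟩
  set s := sInf T with hs
  have hlt : ∀ t ∈ Icc (0 : ℝ) 1, t < s → c t ∈ Q := by
    intro t ht hts
    by_contra h
    exact absurd (csInf_le hTc.bddBelow (show t ∈ T from ⟨ht, h⟩)) (not_le.2 hts)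
  have hc0Q : c 0 ∈ Q := ⟨hc0.1, Metric.ball_subset_ball (by linarith) hc0.2⟩
  have hs0 : 0 < s := by
    rcases hTmem.1.1.lt_or_eq with h | h
    · exact h
    · exact absurd (h ▸ hc0Q) hTmem.2
  have hbound : ∀ t ∈ Ico 0 s, e (c t) ∈ Metric.closedBall (e y) (ε / 2) := by
    intro t ht
    have hsub : Icc 0 t ⊆ Icc (0 : ℝ) 1 := Icc_subset_Icc le_rfl (ht.2.le.trans hTmem.1.2)
    have hut : uIcc 0 t = Icc 0 t := uIcc_of_le ht.1
    have hQt : ∀ r ∈ Icc 0 t, c r ∈ Q := fun r hr => hlt r (hsub hr) (hr.2.trans_lt ht.2)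
    have hch := (hc.subinterval (a' := 0) (b' := t) (by rwa [hu, hut])).chart he
      fun r hr => (hQt r (hut ▸ hr)).1
    rw [hut] at hch
    have hb := norm_le_mul_exp (f := fun r => e (c r) - e y) (K := K)
      (fun r hr => (hch r hr).2.sub_const (e y)) (fun r hr => ?_) (left_mem_Icc.2 ht.1)
      (right_mem_Icc.2 ht.1)
    · rw [Metric.mem_closedBall, dist_eq_norm]
      have h1 : ‖e (c 0) - e y‖ ≤ δ := by
        have := hc0.2
        rw [mem_preimage, Metric.mem_ball, dist_eq_norm] at this
        exact this.le
      have h2 : Real.exp (K * |t - 0|) ≤ Real.exp K := by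
        apply Real.exp_le_exp.2
        rw [sub_zero, abs_of_nonneg ht.1]
        have := (hsub (right_mem_Icc.2 ht.1)).2
        have := K.2
        nlinarith
      calc ‖e (c t) - e y‖ ≤ δ * Real.exp K := hb.trans (by gcongr)
        _ = ε / 2 := by rw [hδ, mul_assoc, ← Real.exp_add, neg_add_cancel, Real.exp_zero, mul_one]
    · have hrball := Metric.ball_subset_closedBall (hQt r hr).2
      have hrC : e (c r) ∈ C := ⟨hrball, (hball _ hrball).2.2.1 (hch r hr).1.2⟩
      have := hK.dist_le_mul (r, e (c r)) ⟨hsub hr, hrC⟩ (r, e y)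
        ⟨hsub hr, Metric.mem_closedBall_self hε.le, heyV⟩
      simpa [Prod.dist_eq, dist_eq_norm, hvy r (hsub hr)] using this
  have hK0 : IsClosed (e.symm '' Metric.closedBall (e y) (ε / 2)) := by
    refine ((isCompact_closedBall _ _).image_of_continuousOn
      (e.continuousOn_symm.mono fun a ha => ?_)).isClosed
    exact (hball a (Metric.closedBall_subset_closedBall (by linarith) ha)).1
  have hcs : c s ∈ e.symm '' Metric.closedBall (e y) (ε / 2) := by
    have hcl : s ∈ closure (Ico 0 s) := by
      rw [closure_Ico hs0.ne]
      exact right_mem_Icc.2 hs0.le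
    have hmaps : MapsTo c (Ico 0 s) (e.symm '' Metric.closedBall (e y) (ε / 2)) := by
      intro t ht
      exact ⟨e (c t), hbound t ht,
        e.left_inv (hlt t ⟨ht.1, ht.2.le.trans hTmem.1.2⟩ ht.2).1⟩
    have h1 := ((hcont s hTmem.1).mono
      (show Ico 0 s ⊆ Icc 0 1 from fun t ht => ⟨ht.1, ht.2.le.trans hTmem.1.2⟩)).mem_closure hcl
      hmaps
    rwa [hK0.closure_eq] at h1
  obtain ⟨a, ha, hac⟩ := hcs
  refine hTmem.2 ?_
  have hat := (hball a (Metric.closedBall_subset_closedBall (by linarith) ha)).1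
  rw [← hac]
  refine ⟨e.map_target hat, ?_⟩
  rw [mem_preimage, e.right_inv hat]
  exact Metric.closedBall_subset_ball (by linarith) ha

/-- The time-one flow of a leafwise field that vanishes at `y` does not change first integrals
at `y`. -/
lemma IsFirstIntegralAt.eventually_flow_eq {A : Set M} {W : ℝ → VF n M} {y : M}
    {e : OpenPartialHomeomorph M (Eu n)} (he : e ∈ IsManifold.maximalAtlas (𝓡 n) ∞ M)
    (hy : y ∈ e.source) (hyA : y ∈ A) {V : Submodule ℝ (Eu n)}
    (hV : ∀ᶠ z in 𝓝 y, z ∈ A ↔ e z ∈ V) (hW : SmoothFamilyOn (Icc (0 : ℝ) 1 ×ˢ A) W)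
    (hW0 : ∀ t ∈ Icc (0 : ℝ) 1, W t y = 0)
    (hWF : ∀ t ∈ Icc (0 : ℝ) 1, ∀ z ∈ A, W t z ∈ F.leafTangent z) {τ : M → Eu n}
    (hτ : F.IsFirstIntegralAt y τ) : ∀ᶠ z in 𝓝 y, τ (flow A W 1 0 z) = τ z := by
  obtain ⟨B, hyB, hB⟩ := isFirstIntegralAt_iff.1 hτ
  obtain ⟨N, hN, hstay⟩ := exists_nhds_flowLine_mem he hy hyA hV hW hW0 (hB.isOpen.mem_nhds hyB)
  have hu : uIcc (0 : ℝ) 1 = Icc 0 1 := uIcc_of_le zero_le_one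
  filter_upwards [hN] with z hz
  -- Where no flow line exists, `flow` is the identity by default and there is nothing to show.
  rcases flow_cases A W 1 0 z with h | ⟨c, h1, h2, h3⟩
  · rw [h]
  · rw [← h3, ← h2]
    refine (hB.eq_flowLine h1 (by rwa [hu]) (fun t ht => ?_) left_mem_uIcc right_mem_uIcc).symm
    exact hstay c h1 (by rwa [h2]) t (hu ▸ ht)

lemma sum_smul_mem_leafTangent {k : ℕ} {f : Fin k → M → ℝ} {X : Fin k → VF n M} {O : Opens M}
    (hX : ∀ i, X i ∈ F.sec O) {z : M} (hz : z ∈ O) : ∑ i, f i z • X i z ∈ F.leafTangent z :=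
  Submodule.sum_mem _ fun i _ => Submodule.smul_mem _ _ (mem_leafTangent (hX i) hz)

/-! ### Equal holonomy implies equal transport; inverses up to holonomy -/

section Holonomy

variable {S : ∀ x, F.Slice x} {x y z : F.PathCat}

/-- Transported first integrals, restricted along the holonomy, are the original ones. -/
lemma IsHolGerm.eventually_transport {p : x ⟶ y} {h : M → M} (hh : IsHolGerm S p h)
    {σ τ : M → Eu n} {f : F.InvGerm x.pt} (hf : f.1 = (σ : Filter.Germ (𝓝 x.pt) (Eu n)))
    (hg : (transport p f).1 = (τ : Filter.Germ (𝓝 y.pt) (Eu n))) :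
    ∀ᶠ z in 𝓝 x.pt, τ (h z) = σ z := by
  obtain ⟨O, X, O', Z, hL, hyO', ⟨k, g, Y, hgY, hZ⟩, rfl, -⟩ := hh
  have hτ := germ_isFirstIntegralAt hg
  have h1 := Filter.Germ.coe_eq.1
    (hg.symm.trans ((isTransport_iff_of_lift hL hf).1 (isTransport_transport p f)))
  have hsec : Z ∈ F.sec O' := F.congr (sum_mem_sec Finset.univ (fun i _ => (hgY i).1)
    fun i _ => (hgY i).2.2) fun z hz => (hZ z hz).symm
  -- Here the field lives on an open set, so the linear model of its domain is the whole space.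
  have h2 := hτ.eventually_flow_eq (A := O') (W := fun _ => Z) (V := ⊤)
    (IsManifold.chart_mem_maximalAtlas y.pt) (mem_chart_source (Eu n) y.pt) hyO'
    (by filter_upwards [O'.isOpen.mem_nhds hyO'] with z hz using iff_of_true hz trivial)
    (smoothFamilyOn_const (IsManifold.chart_mem_maximalAtlas y.pt) (F.smooth hsec))
    (fun t _ => by
      rw [hZ _ hyO']
      exact Finset.sum_eq_zero fun i _ => by rw [(hgY i).2.1, zero_smul])
    fun t _ z hz => mem_leafTangent hsec hz
  have ht := hL.tendsto_flow_range p.2.1 p.2.2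
  filter_upwards [ht.eventually h1, ht.eventually h2, hL.flow_flow_eq p.2.1] with z h3 h4 h5
  rw [Function.comp_apply, h4, h3, Function.comp_apply, h5]

/-- An element of `exp (I_y F|_S)` moves points along leaves by a field that vanishes at `y`. The
field is defined on the slice only, which is linear in an adapted chart. -/
lemma IsExp.eventually_eq {y : M} {S : F.Slice y} {ψ : M → M} (hψ : F.IsExp S.carrier y ψ)
    {τ : M → Eu n} (hτ : F.IsFirstIntegralAt y τ) : ∀ᶠ z in 𝓝 y, τ (ψ z) = τ z := by
  obtain ⟨O, W, hyO, hW, hWt, rfl⟩ := hψ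
  obtain ⟨e, V, H, he, hS⟩ := S.exists_chart
  refine hτ.eventually_flow_eq he.mem_atlas he.mem_source (show y ∈ S.carrier ∩ (O : Set M) from ⟨S.mem, hyO⟩)
    (V := V) ?_ hW ?_ ?_
  · filter_upwards [O.isOpen.mem_nhds hyO, e.open_source.mem_nhds he.mem_source] with z hz hz'
    rw [← hS z hz']
    exact and_iff_left hz
  · intro t ht
    obtain ⟨k, f, X, h1, h2⟩ := hWt t ht
    rw [h2 y ⟨S.mem, hyO⟩]
    exact Finset.sum_eq_zero fun i _ => by rw [(h1 i).2.1, zero_smul]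
  · intro t ht z hz
    obtain ⟨k, f, X, h1, h2⟩ := hWt t ht
    rw [h2 z hz]
    exact sum_smul_mem_leafTangent (fun i => (h1 i).2.2.1) hz.2

/-- Paths with the same holonomy have the same transport. -/
lemma HolRel.transport_eq {p q : x ⟶ y} (h : F.HolRel S p q) : transport p = transport q := by
  obtain ⟨h, h', ψ, hh, hh', hψ, heq⟩ := h
  funext f
  obtain ⟨σ, hσ, hf⟩ := f.2
  obtain ⟨τ, hτ, hg⟩ := (transport p f).2
  obtain ⟨τ', hτ', hg'⟩ := (transport q f).2
  have h1 := hh.eventually_transport hf.symm hg.symm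
  have h2 := hh'.eventually_transport hf.symm hg'.symm
  obtain ⟨-, -, -, -, -, -, -, -, hmap⟩ := hh'
  have h3 : ∀ᶠ z in 𝓝[(S x.pt).carrier] x.pt, τ (h' z) = τ' (h' z) := by
    have h4 : ∀ᶠ z in 𝓝[(S x.pt).carrier] x.pt, τ (ψ (h' z)) = τ (h' z) := by
      have h5 : ∀ᶠ w in 𝓝[(S y.pt).carrier] y.pt, τ (ψ w) = τ w :=
        nhdsWithin_le_nhds (hψ.eventually_eq hτ)
      rw [← hmap] at h5
      exact h5
    filter_upwards [h4, heq, nhdsWithin_le_nhds h1, nhdsWithin_le_nhds h2] with z e1 e2 e3 e4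
    rw [← e1, e4, ← e3, e2]
    rfl
  -- The image of `h'` is a full neighbourhood of `y` in the slice, so agreement along `h'` is
  -- agreement on the slice.
  have h6 : τ =ᶠ[𝓝[(S y.pt).carrier] y.pt] τ' := by
    have h7 : ∀ᶠ w in Filter.map h' (𝓝[(S x.pt).carrier] x.pt), τ w = τ' w := h3
    rw [hmap] at h7
    exact h7
  exact Subtype.ext (hg.symm.trans ((Filter.Germ.coe_eq.2
    ((S y.pt).eventuallyEq_of_nhdsWithin hτ hτ' h6)).trans hg'))

lemma isExp_id (S : Set M) (y : M) : F.IsExp S y id := by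
  refine ⟨⊤, fun _ _ => 0, trivial, smoothFamilyOn_zero _, fun t _ =>
    ⟨0, Fin.elim0, Fin.elim0, fun i => i.elim0, fun z _ => by simp⟩, ?_⟩
  funext z
  exact (flow_zero _ _ _ _).symm

lemma isHolGerm_of_flow_eq_id {p : x ⟶ x} {O : Opens M} {X : ℝ → VF n M}
    (hL : F.IsLift p.1.toFun p.1.dur O X) (hid : ∀ z, flow (O : Set M) X p.1.dur 0 z = z) :
    IsHolGerm S p id := by
  refine ⟨O, X, ⊤, fun _ => 0, hL, trivial, ⟨0, Fin.elim0, Fin.elim0, fun i => i.elim0,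
    fun z _ => by simp⟩, ?_, Filter.map_id⟩
  funext z
  rw [Function.comp_apply, hid]
  exact (flow_zero _ _ _ _).symm

lemma isHolGerm_id (x : F.PathCat) : IsHolGerm S (𝟙 x) id := by
  obtain ⟨O, X, hL⟩ := (𝟙 x : x ⟶ x).1.exists_lift
  exact isHolGerm_of_flow_eq_id hL fun z => flow_self z

/-- Every path has an inverse up to holonomy. -/
lemma exists_holRel_inverse (p : x ⟶ y) : ∃ q : y ⟶ x, F.HolRel S (p ≫ q) (𝟙 x) := by
  obtain ⟨P, hP, hP'⟩ := p
  obtain ⟨X, hX⟩ := P.exists_goodLift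
  refine ⟨⟨hX.reverse, hX.src_reverse.trans hP', hX.tgt_reverse.trans hP⟩, id, id, id, ?_,
    isHolGerm_id x, isExp_id _ _, EventuallyEq.rfl⟩
  -- This explicit lift has a flow that fixes every point, so the identity is a holonomy germ of the
  -- concatenation, with `Z = 0`.
  have hL := hX.isLift_concat hX.src_reverse.symm hX.isGoodLift_reverse
  refine isHolGerm_of_flow_eq_id (O := ⊤) hL fun z => ?_
  exact hX.flow_concat_reverse z

end Holonomy

end SingularFoliation

/-! ### Smooth coefficients in constant rank -/

section ConstantRank

variable {E : Type} [NormedAddCommGroup E] [NormedSpace ℝ E] [FiniteDimensional ℝ E] {k : ℕ}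
  {U : Set E} {G : Fin k → E → E}

/-- If the span of the values of the vector fields `G i` has constant dimension, then its elements
are linear combinations of the values, with coefficients that depend smoothly on the point. -/
lemma exists_smooth_coefficients (hU : IsOpen U) {a₀ : E} (ha₀ : a₀ ∈ U)
    (hG : ∀ i, ContDiffOn ℝ ∞ (G i) U)
    (hr : ∀ a ∈ U, Module.finrank ℝ (Submodule.span ℝ (range fun i => G i a)) =
      Module.finrank ℝ (Submodule.span ℝ (range fun i => G i a₀))) :
    ∃ N : Set E, IsOpen N ∧ a₀ ∈ N ∧ N ⊆ U ∧ ∃ c : E → E →L[ℝ] Fin k → ℝ, ContDiffOn ℝ ∞ c N ∧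
      ∀ a ∈ N, ∀ w ∈ Submodule.span ℝ (range fun i => G i a), ∑ i, c a w i • G i a = w := by
  set H := Submodule.span ℝ (range fun i => G i a₀) with hH
  obtain ⟨V, hVH⟩ := H.exists_isCompl
  obtain ⟨ρ, -, hρ⟩ := exists_coefficients hVH.symm hH
  set ρ' : E →L[ℝ] Fin k → ℝ := LinearMap.toContinuousLinearMap ρ
  -- The operator `T a` sends `H` into the span of the fields at `a` and is the identity at `a₀`.
  -- Near `a₀` it is invertible, and by constancy of the rank it maps `H` onto that span. Hence `ρ ∘
  -- (T a)⁻¹` gives the coefficients, and inversion is smooth.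
  set T : E → E →L[ℝ] E := fun a => (combination G a).comp ρ' + projAlong hVH.symm with hT
  have hTs : ContDiffOn ℝ ∞ T U :=
    ((contDiffOn_combination hG).clm_comp contDiffOn_const).add contDiffOn_const
  have hTa : T a₀ = 1 := by
    ext1 x
    change combination G a₀ (ρ x) + projAlong hVH.symm x = x
    rw [hρ, sub_add_cancel]
  refine ⟨U ∩ T ⁻¹' {f | IsUnit f}, hTs.continuousOn.isOpen_inter_preimage hU Units.isOpen,
    ⟨ha₀, by rw [mem_preimage, hTa]; exact isUnit_one⟩, inter_subset_left,
    fun a => ρ'.comp (Ring.inverse (T a)), ?_, ?_⟩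
  · refine contDiffOn_const.clm_comp fun a ha => ?_
    obtain ⟨u, hu⟩ := ha.2
    exact (hu ▸ contDiffAt_ringInverse ℝ u).comp_contDiffWithinAt a
      ((hTs a ha.1).mono inter_subset_left)
  · intro a ha w hw
    have h2 : ∀ x, Ring.inverse (T a) (T a x) = x :=
      fun x => DFunLike.congr_fun (Ring.inverse_mul_cancel _ ha.2) x
    have hTH : ∀ x ∈ H, T a x = combination G a (ρ x) := by
      intro x hx
      change combination G a (ρ x) + projAlong hVH.symm x = _
      rw [(projAlong_eq_zero_iff hVH.symm).2 hx, add_zero]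
    have hinj : Function.Injective (T a) := fun x y hxy => by rw [← h2 x, hxy, h2]
    have hmap : H.map (T a : E →ₗ[ℝ] E) = Submodule.span ℝ (range fun i => G i a) := by
      apply Submodule.eq_of_le_of_finrank_eq
      · rintro _ ⟨x, hx, rfl⟩
        rw [← range_combination]
        exact ⟨ρ x, (hTH x hx).symm⟩
      · rw [hr a ha.1]
        exact (Submodule.equivMapOfInjective (T a : E →ₗ[ℝ] E) hinj H).finrank_eq.symm
    rw [← hmap] at hw
    obtain ⟨x, hx, rfl⟩ := hw
    rw [← combination_apply]
    change combination G a (ρ (Ring.inverse (T a) (T a x))) = T a x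
    rw [h2, hTH x hx]

end ConstantRank

namespace SingularFoliation

variable {n : ℕ} {M : Type*} [TopologicalSpace M] [ChartedSpace (Eu n) M]
  [IsManifold (𝓡 n) ∞ M] {F : SingularFoliation n M}

/-! ### Regular foliations -/

lemma finrank_leafImage {e : OpenPartialHomeomorph M (Eu n)}
    (he : e ∈ IsManifold.maximalAtlas (𝓡 n) ∞ M) {z : M} (hz : z ∈ e.source) :
    Module.finrank ℝ (F.leafImage e z) = Module.finrank ℝ (F.leafTangent z) :=
  (Submodule.equivMapOfInjective (chartDeriv e z : TangentSpace (𝓡 n) z →ₗ[ℝ] Eu n)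
    (chartDeriv_injective he hz) (F.leafTangent z)).finrank_eq.symm

lemma IsRegular.finrank_leafImage_eq {q : ℕ} (hF : F.IsRegular q)
    {e e' : OpenPartialHomeomorph M (Eu n)} (he : e ∈ IsManifold.maximalAtlas (𝓡 n) ∞ M)
    (he' : e' ∈ IsManifold.maximalAtlas (𝓡 n) ∞ M) {z z' : M} (hz : z ∈ e.source)
    (hz' : z' ∈ e'.source) :
    Module.finrank ℝ (F.leafImage e z) = Module.finrank ℝ (F.leafImage e' z') := by
  rw [finrank_leafImage he hz, finrank_leafImage he' hz']
  have := hF z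
  have := hF z'
  omega

/-- The vector field with the expression `w` in the chart `e`. -/
def chartField (e : OpenPartialHomeomorph M (Eu n)) (w : Eu n → Eu n) : VF n M := fun z =>
  Function.invFun (chartDeriv e z) (w (e z))

lemma chartDeriv_chartField {e : OpenPartialHomeomorph M (Eu n)}
    (he : e ∈ IsManifold.maximalAtlas (𝓡 n) ∞ M) (w : Eu n → Eu n) {z : M} (hz : z ∈ e.source) :
    chartDeriv e z (chartField e w z) = w (e z) :=
  Function.invFun_eq (chartDeriv_surjective he hz _)

variable [T2Space M]

/-- A smooth vector field tangent to the leaves of a regular foliation is a section. -/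
lemma IsRegular.mem_sec {q : ℕ} (hF : F.IsRegular q) {O : Opens M} {X : VF n M}
    (hX : SmoothOn (O : Set M) X) (hmem : ∀ z ∈ O, X z ∈ F.leafTangent z) : X ∈ F.sec O := by
  apply F.glue
  intro p hp
  obtain ⟨O₁, hpO₁, k, G, hG, hgen⟩ := F.locally_fg p
  set e := chartAt (Eu n) p
  have he : e ∈ IsManifold.maximalAtlas (𝓡 n) ∞ M := IsManifold.chart_mem_maximalAtlas p
  have hpe : p ∈ e.source := mem_chart_source (Eu n) p
  have hspan := fun z (hz : z ∈ O₁) (hze : z ∈ e.source) => leafImage_eq_span hG hgen hz hze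
  have hU : IsOpen (e.target ∩ e.symm ⁻¹' (O ⊓ O₁ : Opens M)) :=
    e.isOpen_inter_preimage_symm (O ⊓ O₁).isOpen
  have hmemU : ∀ z ∈ e.source, z ∈ O → z ∈ O₁ → e z ∈ e.target ∩ e.symm ⁻¹' (O ⊓ O₁ : Opens M) :=
    fun z hz h h' => ⟨e.map_source hz, by rw [mem_preimage, e.left_inv hz]; exact ⟨h, h'⟩⟩
  -- Regularity gives constant rank, so the coefficients of `X` with respect to the generators can
  -- be chosen smoothly.
  obtain ⟨N, hN, hpN, hNU, c, hc, hcw⟩ := exists_smooth_coefficients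
    (G := fun i => chartRep e (G i)) hU (hmemU p hpe hp hpO₁)
    (fun i => (contDiffOn_chartRep_const he (F.smooth (hG i))).mono
      fun a ha => ⟨ha.1, ha.2.2⟩) (fun a ha => by
        have h1 := hspan (e.symm a) ha.2.2 (e.map_target ha.1)
        rw [e.right_inv ha.1] at h1
        rw [← h1, ← hspan p hpO₁ hpe]
        exact hF.finrank_leafImage_eq he he (e.map_target ha.1) hpe)
  have hX' : ContDiffOn ℝ ∞ (chartRep e X) N :=
    (contDiffOn_chartRep_const he hX).mono fun a ha => ⟨(hNU ha).1, (hNU ha).2.1⟩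
  have hmemN : ∀ z ∈ e.source ∩ e ⁻¹' N, z ∈ O ∧ z ∈ O₁ := by
    intro z hz
    have := (hNU hz.2).2
    rwa [mem_preimage, e.left_inv hz.1] at this
  refine ⟨⟨e.source ∩ e ⁻¹' N, e.isOpen_inter_preimage hN⟩, ⟨hpe, hpN⟩, fun z hz => (hmemN z hz).1,
    F.congr (sum_mem_sec Finset.univ (X := G)
      (f := fun i z => c (e z) (chartRep e X (e z)) i) (fun i _ => ?_)
      fun i _ => F.restrict (fun z hz => (hmemN z hz).2) (hG i)) fun z hz => ?_⟩
  · have h1 : ContDiffOn ℝ ∞ (fun a => c a (chartRep e X a) i) N :=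
      contDiffOn_pi.1 (hc.clm_apply hX') i
    exact h1.contMDiffOn.comp ((chart_contMDiffOn he).mono inter_subset_left) fun z hz => hz.2
  · apply chartDeriv_injective he hz.1
    have hX1 : chartRep e X (e z) ∈ Submodule.span ℝ (range fun i => chartRep e (G i) (e z)) := by
      rw [← hspan z (hmemN z hz).2 hz.1, chartRep_apply hz.1]
      exact chartDeriv_mem_leafImage (hmem z (hmemN z hz).1)
    have h2 := hcw (e z) hz.2 _ hX1
    rw [map_sum, ← chartRep_apply hz.1 X, ← h2]
    refine Finset.sum_congr rfl fun i _ => ?_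
    rw [chartRep_apply hz.1 (G i), h2]
    exact (chartDeriv e z).map_smul _ _

/-- The inclusion of `H` in the image of the leaf tangent space holds throughout the chart. In the
regular case both have the same dimension, so every plaque, and not only the central one, is
parallel to `H`. -/
lemma IsAdapted.leafImage_eq {q : ℕ} (hF : F.IsRegular q) {p : M}
    {e : OpenPartialHomeomorph M (Eu n)} {V H : Submodule ℝ (Eu n)} (he : IsAdapted F p e V H)
    {z : M} (hz : z ∈ e.source) : F.leafImage e z = H := by
  have h0 : F.leafImage e p = H := le_antisymm
    (he.leafImage_le p he.mem_source (by rw [sub_self]; exact H.zero_mem))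
    (he.le_leafImage p he.mem_source)
  refine (Submodule.eq_of_le_of_finrank_eq (he.le_leafImage z hz) ?_).symm
  rw [← h0]
  exact hF.finrank_leafImage_eq he.mem_atlas he.mem_atlas he.mem_source hz

/-- The transverse coordinates of a chart adapted to a regular foliation are first integrals. -/
lemma IsAdapted.isFirstIntegralAt {q : ℕ} (hF : F.IsRegular q) {p : M}
    {e : OpenPartialHomeomorph M (Eu n)} {V H : Submodule ℝ (Eu n)} (he : IsAdapted F p e V H) :
    F.IsFirstIntegralAt p (projAlong he.isCompl ∘ e) := by
  refine ⟨⟨e.source, e.open_source⟩, he.mem_source, ?_, fun z hz v hv => ?_⟩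
  · exact (projAlong he.isCompl).contDiff.contMDiff.comp_contMDiffOn (chart_contMDiffOn he.mem_atlas)
  · have h1 : HasMFDerivAt (𝓡 n) 𝓘(ℝ, Eu n) (projAlong he.isCompl ∘ e) z
        ((projAlong he.isCompl).comp (chartDeriv e z)) :=
      HasMFDerivAt.comp z (projAlong he.isCompl).hasMFDerivAt (hasMFDerivAt_chart he.mem_atlas hz)
    rw [h1.mfderiv]
    refine (projAlong_eq_zero_iff he.isCompl).2 ?_
    rw [← he.leafImage_eq hF hz]
    exact chartDeriv_mem_leafImage hv

end SingularFoliation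

/-! ### Local diffeomorphisms between transversals -/

section Transverse

variable {E : Type} [NormedAddCommGroup E] [NormedSpace ℝ E] [FiniteDimensional ℝ E]

/-- A local diffeomorphism whose derivative maps `H₁` to `H` induces a local diffeomorphism between
complements `V₁` and `V`, the projection of its restriction. -/
lemma exists_transverse_homeomorph {Θ : E → E} {Ω : Set E} (hΩ : IsOpen Ω)
    (hΘ : ContDiffOn ℝ ∞ Θ Ω) {a : E} (ha : a ∈ Ω) {V₁ H₁ V H : Submodule ℝ E}
    (h₁ : IsCompl V₁ H₁) (h : IsCompl V H) (haV : a ∈ V₁) {D : E →L[ℝ] E}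
    (hD : HasFDerivAt Θ D a) (hinj : Function.Injective D) (hDH : ∀ ξ ∈ H₁, D ξ ∈ H)
    (hdim : Module.finrank ℝ H₁ = Module.finrank ℝ H) :
    ∃ g : OpenPartialHomeomorph E E, a ∈ g.source ∧ ContDiffOn ℝ ∞ g.symm g.target ∧
      (∀ x ∈ g.source, projAlong h₁ x ∈ Ω) ∧ (∀ x, g x ∈ V ↔ x ∈ V₁) ∧
      ∀ x ∈ V₁, g x = projAlong h (Θ x) := by
  set π₁ := projAlong h₁
  set π := projAlong h
  have hπa : π₁ a = a := projAlong_of_mem_left h₁ haV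
  -- The map of interest, `π ∘ Θ` on `V₁`, is extended to `E` by the linear map `D` in the
  -- directions of `H₁`. The extension has an invertible derivative at `a`, so the inverse function
  -- theorem applies without passing to subspaces.
  set Γ : E → E := fun x => π (Θ (π₁ x)) + D (x - π₁ x) with hΓ
  have hopen : IsOpen (π₁ ⁻¹' Ω) := hΩ.preimage π₁.continuous
  have hΓs : ContDiffOn ℝ ∞ Γ (π₁ ⁻¹' Ω) := by
    refine ContDiffOn.add ?_ ?_
    · exact π.contDiff.comp_contDiffOn (hΘ.comp π₁.contDiff.contDiffOn fun x hx => hx)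
    · exact (D.contDiff.comp (contDiff_id.sub π₁.contDiff)).contDiffOn
  set Γ' : E →L[ℝ] E := (π.comp D).comp π₁ + D.comp (ContinuousLinearMap.id ℝ E - π₁) with hΓ'
  have hΓd : HasFDerivAt Γ Γ' a := by
    refine HasFDerivAt.add ?_ ?_
    · rw [← hπa] at hD
      exact (π.hasFDerivAt.comp _ hD).comp a π₁.hasFDerivAt
    · exact D.hasFDerivAt.comp a ((hasFDerivAt_id a).sub π₁.hasFDerivAt)
  have hmap : H₁.map (D : E →ₗ[ℝ] E) = H := by
    apply Submodule.eq_of_le_of_finrank_eq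
    · rintro _ ⟨ξ, hξ, rfl⟩
      exact hDH ξ hξ
    · rw [← hdim]
      exact (Submodule.equivMapOfInjective (D : E →ₗ[ℝ] E) hinj H₁).finrank_eq.symm
  -- As `D` is injective and maps `H₁` into `H`, a nonzero vector of `H₁` contributes a nonzero part
  -- along `H`, which no vector of `V` can cancel.
  have hsplit : ∀ v ∈ V, ∀ ξ ∈ H₁, v + D ξ ∈ V → ξ = 0 := by
    intro v hv ξ hξ hs
    have h3 : D ξ ∈ V := by simpa using V.sub_mem hs hv
    have h4 : D ξ = 0 := Submodule.disjoint_def.1 h.disjoint _ h3 (hDH ξ hξ)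
    exact hinj (h4.trans D.map_zero.symm)
  have hΓinj : Function.Injective (Γ' : E →ₗ[ℝ] E) := by
    rw [← LinearMap.ker_eq_bot, LinearMap.ker_eq_bot']
    intro ξ hξ
    have h0 : π (D (π₁ ξ)) + D (ξ - π₁ ξ) = 0 := hξ
    have h3 : ξ - π₁ ξ = 0 := hsplit _ (projAlong_mem h _) _ (sub_projAlong_mem h₁ ξ)
      (by rw [h0]; exact V.zero_mem)
    rw [h3, D.map_zero, add_zero, projAlong_eq_zero_iff, ← hmap] at h0
    obtain ⟨η, hη, hηξ⟩ := h0
    have h4 : η = π₁ ξ := hinj hηξ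
    rw [sub_eq_zero.1 h3]
    exact Submodule.disjoint_def.1 h₁.disjoint _ (projAlong_mem h₁ ξ) (h4 ▸ hη)
  obtain ⟨g, hag, hgΩ, hg, hgs⟩ := exists_smooth_localInverse hopen hΓs
    (show a ∈ π₁ ⁻¹' Ω by rwa [mem_preimage, hπa])
    (LinearEquiv.ofInjectiveEndo (Γ' : E →ₗ[ℝ] E) hΓinj).toContinuousLinearEquiv hΓd
  have hgV : ∀ x ∈ V₁, g x = π (Θ x) := by
    intro x hx
    rw [hg]
    change π (Θ (π₁ x)) + D (x - π₁ x) = _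
    rw [show π₁ x = x from projAlong_of_mem_left h₁ hx, sub_self, D.map_zero, add_zero]
  refine ⟨g, hag, hgs, hgΩ, fun x => ⟨fun hx => ?_, fun hx => ?_⟩, hgV⟩
  · rw [hg] at hx
    have := hsplit _ (projAlong_mem h _) _ (sub_projAlong_mem h₁ x) hx
    rw [sub_eq_zero.1 this]
    exact projAlong_mem h₁ x
  · rw [hgV x hx]
    exact projAlong_mem h _

end Transverse

namespace SingularFoliation

variable {n : ℕ} {M : Type*} [TopologicalSpace M] [ChartedSpace (Eu n) M]
  [IsManifold (𝓡 n) ∞ M] {F : SingularFoliation n M} [T2Space M]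

/-- A displacement along the plaques of a regular foliation that depends on the plaque only is the
time-one flow of a section. -/
lemma IsAdapted.exists_vanishingSec {q : ℕ} (hF : F.IsRegular q) {y : M}
    {e : OpenPartialHomeomorph M (Eu n)} {V H : Submodule ℝ (Eu n)} (he : IsAdapted F y e V H)
    {A : Eu n → Eu n} {B : Set (Eu n)} (hB : IsOpen B) (hA : ContDiffOn ℝ ∞ A B)
    (hyB : projAlong he.isCompl (e y) ∈ B) (hAy : A (projAlong he.isCompl (e y)) = 0)
    (hAH : ∀ s, A s ∈ H) :
    ∃ (O : Opens M) (Z : VF n M), y ∈ O ∧ F.VanishingSec y O Z ∧ ∀ᶠ z in 𝓝 y,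
      flow (O : Set M) (fun _ => Z) 1 0 z = e.symm (e z + A (projAlong he.isCompl (e z))) := by
  set π := projAlong he.isCompl
  have heA := he.mem_atlas
  -- The field `w` takes values in `H` and depends on the projection to `V` only, so it is constant
  -- along its own integral curves. Its flow for unit time is the translation by `w b`.
  set w : Eu n → Eu n := fun b => A (π b) with hw_def
  have hBo : IsOpen (π ⁻¹' B) := hB.preimage π.continuous
  have hw : ContDiffOn ℝ ∞ w (π ⁻¹' B) := hA.comp π.contDiff.contDiffOn fun b hb => hb
  have hπw : ∀ b, π (w b) = 0 := fun b => (projAlong_eq_zero_iff he.isCompl).2 (hAH _)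
  set O : Opens M := ⟨e.source ∩ e ⁻¹' (π ⁻¹' B), e.isOpen_inter_preimage hBo⟩ with hO
  have hyO : y ∈ O := ⟨he.mem_source, hyB⟩
  set ε := EuclideanSpace.basisFun (Fin n) ℝ
  set Z := chartField e w
  have hZ : ∀ z ∈ e.source, chartDeriv e z (Z z) = w (e z) :=
    fun z hz => chartDeriv_chartField heA w hz
  have hZs : SmoothOn (O : Set M) Z :=
    smoothOn_of_chart heA hw (fun z hz => hz.1) (fun z hz => hz.2) fun z hz => hZ z hz.1
  -- The generators are the constant fields `ε i - π (ε i)`, which are parallel to `H` and hence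
  -- sections by regularity. The coefficients are the coordinates of `w`, which vanish at `y`.
  refine ⟨O, Z, hyO, ⟨n, fun i z => ε.repr (w (e z)) i,
    fun i => chartField e fun _ => ε i - π (ε i), fun i => ⟨?_, ?_, ?_⟩, fun z hz => ?_⟩, ?_⟩
  · have h1 : ContDiff ℝ ∞ fun b : Eu n => ε.repr b i := by
      exact contDiff_euclidean.1 (contDiff_id (E := Eu n)) i
    exact (h1.comp_contDiffOn hw).contMDiffOn.comp
      ((chart_contMDiffOn heA).mono inter_subset_left) fun z hz => hz.2
  · change ε.repr (A (π (e y))) i = 0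
    rw [hAy, map_zero]
    rfl
  · refine hF.mem_sec (smoothOn_of_chart heA (W := univ) (w := fun _ => ε i - π (ε i))
      contDiffOn_const (fun z hz => hz.1) (fun z hz => trivial)
      fun z hz => chartDeriv_chartField heA _ hz.1) fun z hz => ?_
    rw [← chartDeriv_mem_leafImage_iff heA hz.1, chartDeriv_chartField heA _ hz.1,
      he.leafImage_eq hF hz.1]
    exact sub_projAlong_mem he.isCompl _
  · apply chartDeriv_injective heA hz.1
    have h1 : w (e z) - π (w (e z)) = ∑ i, ε.repr (w (e z)) i • (ε i - π (ε i)) := by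
      conv_lhs => rw [← ε.sum_repr (w (e z))]
      simp only [map_sum, map_smul, smul_sub, Finset.sum_sub_distrib]
    rw [hπw, sub_zero] at h1
    rw [hZ z hz.1, h1, map_sum]
    refine Finset.sum_congr rfl fun i _ => ?_
    refine Eq.trans ?_ ((chartDeriv e z).map_smul _ _).symm
    rw [chartDeriv_chartField heA _ hz.1]
  · obtain ⟨r, hr, hball⟩ := Metric.isOpen_iff.1 e.open_target _ (e.map_source he.mem_source)
    have hcont : ContinuousAt e y := e.continuousAt he.mem_source
    have hwc : ContinuousAt w (e y) := hw.continuousOn.continuousAt (hBo.mem_nhds hyB)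
    have h1 : ∀ᶠ z in 𝓝 y, e z + w (e z) ∈ Metric.ball (e y) r := by
      have h2 : ContinuousAt (fun z => e z + w (e z)) y := hcont.add (hwc.comp hcont)
      apply h2.eventually
      have h3 : e y + w (e y) = e y := by
        rw [show w (e y) = 0 from hAy, add_zero]
      simp only [h3]
      exact Metric.ball_mem_nhds _ hr
    filter_upwards [h1, hcont.eventually (Metric.ball_mem_nhds _ hr), O.isOpen.mem_nhds hyO]
      with z hz1 hz2 hzO
    set b := e z
    have hseg : ∀ t ∈ uIcc (0 : ℝ) 1, b + t • w b ∈ e.target := by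
      intro t ht
      rw [uIcc_of_le zero_le_one] at ht
      apply hball
      have := (convex_ball (e y) r).add_smul_mem hz2 hz1 ht
      exact this
    have hπseg : ∀ t : ℝ, π (b + t • w b) = π b := by
      intro t
      rw [map_add, map_smul, hπw, smul_zero, add_zero]
    have hline : IsFlowLine (O : Set M) (fun _ => Z) 0 1 (e.symm ∘ fun t : ℝ => b + t • w b) := by
      intro t ht
      have ht' := hseg t ht
      refine ⟨⟨e.map_target ht', ?_⟩, ?_⟩
      · change π (e (e.symm (b + t • w b))) ∈ B
        rw [e.right_inv ht', hπseg]
        exact hzO.2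
      · refine hasMFDerivWithinAt_chart_symm_comp heA ht' ?_
        have h3 : chartRep e Z (b + t • w b) = w b := by
          unfold chartRep
          rw [hZ _ (e.map_target ht'), e.right_inv ht']
          change A (π (b + t • w b)) = A (π b)
          rw [hπseg]
        rw [h3]
        have h4 := ((hasDerivAt_id t).smul_const (w b)).const_add b
        rw [one_smul] at h4
        exact h4.hasDerivWithinAt
    have h5 := hline.flow_eq O.isOpen (smoothFamilyOn_const heA hZs)
    simp only [Function.comp_apply, zero_smul, add_zero, one_smul] at h5
    rwa [e.left_inv hzO.1] at h5

/-! ### Holonomy in the regular case, computed in adapted charts -/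

section Holonomy

variable {P : F.LeafPath} {u v : M} (hu : P.src = u) (hv : P.tgt = v) {O : Opens M}
  {X : ℝ → VF n M} (hL : F.IsLift P.toFun P.dur O X)

include hu hv hL

lemma IsLift.isFirstIntegralAt_source {σ : M → Eu n} (hσ : F.IsFirstIntegralAt v σ) :
    F.IsFirstIntegralAt u (σ ∘ flow (O : Set M) X P.dur 0) := by
  have hd : (0 : ℝ) ≤ P.dur := P.dur.2
  rw [← hv, ← P.basePath_dur] at hσ
  rw [← hu, ← P.basePath_zero]
  exact (hL.isLeafField _).isFirstIntegralAt_comp_flow (by linarith)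
    (hL.isFlowLine (T := P.dur + 1) (by linarith)) ⟨hd, by linarith⟩ ⟨le_rfl, by linarith⟩ hσ

lemma IsLift.preserves_flow : F.Preserves (flow (O : Set M) X P.dur 0) u := by
  have hd : (0 : ℝ) ≤ P.dur := P.dur.2
  rw [← hu, ← P.basePath_zero]
  exact (hL.isLeafField _).preserves_flow_Icc (by linarith)
    (hL.isFlowLine (T := P.dur + 1) (by linarith)) ⟨le_rfl, by linarith⟩ ⟨hd, by linarith⟩

lemma IsLift.mfderiv_flow_injective :
    Function.Injective (mfderiv (𝓡 n) (𝓡 n) (flow (O : Set M) X P.dur 0) u) := by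
  obtain ⟨N, hN, huN, hφ, hφu⟩ := hL.flow_range_nhds hu hv
  obtain ⟨N', hN', hvN', hψ, -⟩ := hL.flow_source_nhds hu hv
  have d1 := (hφ.contMDiffAt (hN.mem_nhds huN)).mdifferentiableAt (by simp)
  have d2 : MDifferentiableAt (𝓡 n) (𝓡 n) (flow (O : Set M) X 0 P.dur)
      (flow (O : Set M) X P.dur 0 u) :=
    (hψ.contMDiffAt (by rw [hφu]; exact hN'.mem_nhds hvN')).mdifferentiableAt (by simp)
  have h1 : flow (O : Set M) X 0 P.dur ∘ flow (O : Set M) X P.dur 0 =ᶠ[𝓝 u] id :=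
    hL.flow_flow_eq hu
  have h2 := h1.mfderiv_eq (I := 𝓡 n) (I' := 𝓡 n)
  rw [mfderiv_comp u d2 d1, mfderiv_id] at h2
  intro ξ η hξη
  have h3 : ∀ ξ, mfderiv (𝓡 n) (𝓡 n) (flow (O : Set M) X 0 P.dur) (flow (O : Set M) X P.dur 0 u)
    (mfderiv (𝓡 n) (𝓡 n) (flow (O : Set M) X P.dur 0) u ξ) = ξ := fun ξ => DFunLike.congr_fun h2 ξ
  rw [← h3 ξ, hξη, h3]

/-- In charts adapted to slices of a regular foliation, the flow of a lift followed by the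
projection to the slice is the holonomy. -/
lemma IsLift.exists_holonomy {q : ℕ} (hF : F.IsRegular q) {S₁ : F.Slice u} {S : F.Slice v}
    {e : OpenPartialHomeomorph M (Eu n)} {V H : Submodule ℝ (Eu n)} (he : IsAdapted F v e V H)
    (heS : ∀ z ∈ e.source, z ∈ S.carrier ↔ e z ∈ V) :
    ∃ (O' : Opens M) (Z : VF n M), v ∈ O' ∧ F.VanishingSec v O' Z ∧
      Filter.map (flow (O' : Set M) (fun _ => Z) 1 0 ∘ flow (O : Set M) X P.dur 0)
        (𝓝[S₁.carrier] u) = 𝓝[S.carrier] v ∧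
      ∀ᶠ z in 𝓝[S₁.carrier] u,
        flow (O' : Set M) (fun _ => Z) 1 0 (flow (O : Set M) X P.dur 0 z) =
          e.symm (projAlong he.isCompl (e (flow (O : Set M) X P.dur 0 z))) := by
  obtain ⟨e₁, V₁, H₁, he₁, heS₁⟩ := S₁.exists_chart
  obtain ⟨N, hN, huN, hφ, hφu⟩ := hL.flow_range_nhds hu hv
  have hpres := hL.preserves_flow hu hv
  have hinj := hL.mfderiv_flow_injective hu hv
  set φ := flow (O : Set M) X P.dur 0
  set π := projAlong he.isCompl
  set π₁ := projAlong he₁.isCompl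
  set a := e₁ u
  set Θ : Eu n → Eu n := fun x => e (φ (e₁.symm x)) with hΘ_def
  have haS : a ∈ V₁ := (heS₁ u he₁.mem_source).1 S₁.mem
  have hbS : e v ∈ V := (heS v he.mem_source).1 S.mem
  have hea : e₁.symm a = u := e₁.left_inv he₁.mem_source
  have hΘa : Θ a = e v := by rw [hΘ_def]; simp only [hea, hφu]
  have hN1 : IsOpen (N ∩ φ ⁻¹' e.source) :=
    hφ.continuousOn.isOpen_inter_preimage hN e.open_source
  have huN1 : u ∈ N ∩ φ ⁻¹' e.source := ⟨huN, by rw [mem_preimage, hφu]; exact he.mem_source⟩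
  set Ω := e₁.target ∩ e₁.symm ⁻¹' (N ∩ φ ⁻¹' e.source)
  have hΩ : IsOpen Ω := e₁.isOpen_inter_preimage_symm hN1
  have haΩ : a ∈ Ω := ⟨e₁.map_source he₁.mem_source, by rw [mem_preimage, hea]; exact huN1⟩
  have hΘ : ContDiffOn ℝ ∞ Θ Ω := by
    rw [← contMDiffOn_iff_contDiffOn]
    exact (chart_contMDiffOn he.mem_atlas).comp (hφ.comp
      ((chart_symm_contMDiffOn he₁.mem_atlas).mono inter_subset_left) fun x hx => hx.2.1)
      fun x hx => hx.2.2
  have hD : ∀ ξ : TangentSpace (𝓡 n) u, fderiv ℝ Θ a (chartDeriv e₁ u ξ) =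
      chartDeriv e (φ u) (mfderiv (𝓡 n) (𝓡 n) φ u ξ) := by
    have d1 : HasMFDerivAt (𝓡 n) 𝓘(ℝ, Eu n) (e ∘ φ) u
        ((chartDeriv e (φ u)).comp (mfderiv (𝓡 n) (𝓡 n) φ u)) :=
      HasMFDerivAt.comp u (hasMFDerivAt_chart he.mem_atlas huN1.2)
        ((hφ.contMDiffAt (hN.mem_nhds huN)).mdifferentiableAt (by simp)).hasMFDerivAt
    have d2 : HasMFDerivAt (𝓡 n) 𝓘(ℝ, Eu n) (Θ ∘ e₁) u ((fderiv ℝ Θ a).comp (chartDeriv e₁ u)) :=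
      HasMFDerivAt.comp u (((hΘ.contDiffAt (hΩ.mem_nhds haΩ)).differentiableAt
        (by simp)).hasFDerivAt.hasMFDerivAt) (hasMFDerivAt_chart he₁.mem_atlas he₁.mem_source)
    have d3 : e ∘ φ =ᶠ[𝓝 u] Θ ∘ e₁ := by
      filter_upwards [e₁.open_source.mem_nhds he₁.mem_source] with z hz
      simp only [hΘ_def, Function.comp_apply, e₁.left_inv hz]
    exact DFunLike.congr_fun (hasMFDerivAt_unique (d2.congr_of_eventuallyEq d3) d1)
  have hDinj : Function.Injective (fderiv ℝ Θ a) := by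
    intro x x' hx
    obtain ⟨ξ, rfl⟩ := chartDeriv_surjective he₁.mem_atlas he₁.mem_source x
    obtain ⟨ξ', rfl⟩ := chartDeriv_surjective he₁.mem_atlas he₁.mem_source x'
    rw [hD, hD] at hx
    rw [hinj (chartDeriv_injective he.mem_atlas huN1.2 hx)]
  have hDH : ∀ x ∈ H₁, fderiv ℝ Θ a x ∈ H := by
    intro x hx
    rw [← he₁.leafImage_eq hF he₁.mem_source] at hx
    obtain ⟨ξ, hξ, rfl⟩ := hx
    rw [← he.leafImage_eq hF huN1.2]
    have := chartDeriv_mem_leafImage (e := e) (hpres ξ hξ)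
    rw [← hD] at this
    exact this
  have hdim : Module.finrank ℝ H₁ = Module.finrank ℝ H := by
    rw [← he₁.leafImage_eq hF he₁.mem_source, ← he.leafImage_eq hF he.mem_source]
    exact hF.finrank_leafImage_eq he₁.mem_atlas he.mem_atlas he₁.mem_source he.mem_source
  obtain ⟨g, hag, hgs, hgΩ, hgV, hgΘ⟩ := exists_transverse_homeomorph hΩ hΘ haΩ he₁.isCompl he.isCompl
    haS (hΘ.contDiffAt (hΩ.mem_nhds haΩ) |>.differentiableAt (by simp)).hasFDerivAt hDinj hDH hdim
  have hπb : π (e v) = e v := projAlong_of_mem_left he.isCompl hbS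
  have hga : g a = e v := by rw [hgΘ a haS, hΘa]; exact hπb
  have hbg : e v ∈ g.target := hga ▸ g.map_source hag
  have hgb : g.symm (e v) = a := by rw [← hga]; exact g.left_inv hag
  -- The displacement must take `Θ x` to its projection `π (Θ x)` for `x` in `V₁`, and must depend
  -- on this projection `s` only. Since `s = g x`, the point `x` is recovered as `g.symm s`.
  set A : Eu n → Eu n := fun s => π (Θ (π₁ (g.symm s))) - Θ (π₁ (g.symm s)) with hA_def
  have hΘπ : ContDiffOn ℝ ∞ (fun s => Θ (π₁ (g.symm s))) g.target :=
    hΘ.comp (π₁.contDiff.comp_contDiffOn hgs) fun s hs => hgΩ _ (g.map_target hs)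
  obtain ⟨O', Z, hvO', hZ, hflow⟩ := he.exists_vanishingSec hF g.open_target (A := A)
    ((π.contDiff.comp_contDiffOn hΘπ).sub hΘπ) (by rw [hπb]; exact hbg)
    (by
      rw [hπb, hA_def]
      simp only [hgb]
      rw [show π₁ a = a from projAlong_of_mem_left he₁.isCompl haS, hΘa, hπb, sub_self])
    (fun s => by
      have := H.neg_mem (sub_projAlong_mem he.isCompl (Θ (π₁ (g.symm s))))
      rwa [neg_sub] at this)
  have hφt : Tendsto φ (𝓝 u) (𝓝 v) := hL.tendsto_flow_range hu hv
  have hmain : ∀ᶠ z in 𝓝[S₁.carrier] u, g (e₁ z) = π (e (φ z)) ∧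
      flow (O' : Set M) (fun _ => Z) 1 0 (φ z) = e.symm (π (e (φ z))) := by
    have h1 : ∀ᶠ z in 𝓝 u, e₁ z ∈ g.source :=
      (e₁.continuousAt he₁.mem_source).eventually (g.open_source.mem_nhds hag)
    filter_upwards [nhdsWithin_le_nhds (hφt.eventually hflow), nhdsWithin_le_nhds h1,
      nhdsWithin_le_nhds (e₁.open_source.mem_nhds he₁.mem_source), self_mem_nhdsWithin]
      with z h2 h3 h4 h5
    have h6 : e₁ z ∈ V₁ := (heS₁ z h4).1 h5
    have h7 : Θ (e₁ z) = e (φ z) := by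
      rw [hΘ_def]
      simp only [e₁.left_inv h4]
    have h8 : g (e₁ z) = π (e (φ z)) := by rw [hgΘ _ h6, h7]
    refine ⟨h8, ?_⟩
    rw [h2, hA_def]
    simp only
    rw [← show g (e₁ z) = projAlong he.isCompl (e (φ z)) from h8, g.left_inv h3,
      show π₁ (e₁ z) = e₁ z from projAlong_of_mem_left he₁.isCompl h6, h7, add_sub_cancel, h8]
  refine ⟨O', Z, hvO', hZ, ?_, hmain.mono fun z hz => hz.2⟩
  have hcongr : flow (O' : Set M) (fun _ => Z) 1 0 ∘ φ =ᶠ[𝓝[S₁.carrier] u] e.symm ∘ g ∘ e₁ := by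
    filter_upwards [hmain] with z hz
    rw [Function.comp_apply, hz.2, Function.comp_apply, Function.comp_apply, hz.1]
  -- The holonomy is a composite of three local homeomorphisms that match the slices with `V₁` and
  -- `V`, so it maps neighbourhoods in one slice onto neighbourhoods in the other.
  have i1 : e₁.IsImage S₁.carrier (V₁ : Set (Eu n)) := fun z hz => (heS₁ z hz).symm
  have i2 : g.IsImage (V₁ : Set (Eu n)) (V : Set (Eu n)) := fun x _ => hgV x
  have i3 : e.IsImage S.carrier (V : Set (Eu n)) := fun z hz => (heS z hz).symm
  rw [Filter.map_congr hcongr, ← Filter.map_map, ← Filter.map_map,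
    i1.map_nhdsWithin_eq he₁.mem_source, i2.map_nhdsWithin_eq hag, hga,
    i3.symm.map_nhdsWithin_eq (e.map_source he.mem_source), e.left_inv he.mem_source]

end Holonomy

/-! ### Holonomy and transport are equivalent in the regular case -/

section Relations

variable {S : ∀ x, F.Slice x} {x y : F.PathCat}

/-- For regular foliations, paths with the same transport have the same holonomy. -/
lemma IsRegular.holRel_iff {q : ℕ} (hF : F.IsRegular q) (p p' : x ⟶ y) :
    F.HolRel S p p' ↔ transport p = transport p' := by
  refine ⟨fun h => h.transport_eq, fun h => ?_⟩
  obtain ⟨O, X, hL⟩ := p.1.exists_lift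
  obtain ⟨O', X', hL'⟩ := p'.1.exists_lift
  obtain ⟨e, V, H, he, heS⟩ := (S y.pt).exists_chart
  obtain ⟨U, Z, hyU, hZ, hmap, heq⟩ := hL.exists_holonomy p.2.1 p.2.2 hF (S₁ := S x.pt) he heS
  obtain ⟨U', Z', hyU', hZ', hmap', heq'⟩ :=
    hL'.exists_holonomy p'.2.1 p'.2.2 hF (S₁ := S x.pt) he heS
  refine ⟨_, _, id, ⟨O, X, U, Z, hL, hyU, hZ, rfl, hmap⟩,
    ⟨O', X', U', Z', hL', hyU', hZ', rfl, hmap'⟩, isExp_id _ _, ?_⟩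
  -- The transverse coordinates `τ` are first integrals at `y`, and `σ` is their pullback to `x` by
  -- the flow along `p`. Transport of `σ` along `p` returns `τ`. Equality with the transport along
  -- `p'` gives `τ ∘ Fl^X = τ ∘ Fl^X'` near `x`, and both holonomy germs are `e.symm` of these
  -- functions. They are therefore equal, with the identity as the element of `exp`.
  set τ := projAlong he.isCompl ∘ e
  have hτ : F.IsFirstIntegralAt y.pt τ := he.isFirstIntegralAt hF
  set σ := τ ∘ flow (O : Set M) X p.1.dur 0
  have hσ : F.IsFirstIntegralAt x.pt σ := hL.isFirstIntegralAt_source p.2.1 p.2.2 hτ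
  have h1 := (isTransport_iff_of_lift hL (σ := σ) rfl).1 (isTransport_transport p ⟨_, σ, hσ, rfl⟩)
  have h2 := (isTransport_iff_of_lift hL' (σ := σ) rfl).1
    (isTransport_transport p' ⟨_, σ, hσ, rfl⟩)
  rw [h] at h1
  have h3 := Filter.Germ.coe_eq.1 (h1.symm.trans h2)
  have ht := hL'.tendsto_flow_range p'.2.1 p'.2.2
  filter_upwards [heq, heq', nhdsWithin_le_nhds (hL'.flow_flow_eq p'.2.1),
    nhdsWithin_le_nhds (ht.eventually h3),
    nhdsWithin_le_nhds (ht.eventually (hL.flow_flow_eq' p.2.2))] with z e1 e2 e3 e4 e5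
  simp only [Function.comp_apply, id_eq]
  rw [e1, e2]
  congr 1
  simp only [σ, τ, Function.comp_apply, e3, e5] at e4
  exact e4.symm

end Relations

end SingularFoliation

open Diffeology

/-! ### Pushforward diffeologies -/

section Diffeologies

variable {X Y Z : Type*}

/-- Pushforward is adjoint to pullback, which reduces questions about quotient diffeologies to
formal ones. -/
lemma pushforwardD_le_iff {f : X → Y} {d : DiffeologicalSpace X} {d' : DiffeologicalSpace Y} :
    pushforwardD f d ≤ d' ↔ d ≤ pullbackD f d' := by
  rw [DiffeologicalSpace.generateFrom_le_iff, DiffeologicalSpace.le_iff]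
  constructor
  · intro h k p hp
    exact h k _ ⟨p, hp, rfl⟩
  · rintro h k r ⟨p, hp, hr⟩
    change r = f ∘ p at hr
    rw [hr]
    exact h k hp

lemma dSmooth_iff_le_pullbackD {f : X → Y} {d : DiffeologicalSpace X} {d' : DiffeologicalSpace Y} :
    @DSmooth X Y d d' f ↔ d ≤ pullbackD f d' := by
  rw [DiffeologicalSpace.le_iff]
  rfl

lemma pushforwardD_pushforwardD (f : X → Y) (g : Y → Z) (d : DiffeologicalSpace X) :
    pushforwardD g (pushforwardD f d) = pushforwardD (g ∘ f) d := by
  refine eq_of_forall_ge_iff fun d' => ?_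
  rw [pushforwardD_le_iff, pushforwardD_le_iff, pushforwardD_le_iff]
  rfl

/-- An injective subduction is a diffeomorphism. -/
lemma IsSubduction.isDiffeomorphism {dX : DiffeologicalSpace X} {dY : DiffeologicalSpace Y}
    {f : X → Y} (hf : IsSubduction dX dY f) (hinj : Function.Injective f) :
    IsDiffeomorphism dX dY f := by
  obtain ⟨hsurj, rfl⟩ := hf
  refine ⟨Equiv.ofBijective f ⟨hinj, hsurj⟩, fun _ => rfl, ?_, ?_⟩
  · exact dSmooth_iff_le_pullbackD.2 (pushforwardD_le_iff.1 le_rfl)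
  · refine dSmooth_iff_le_pullbackD.2 (pushforwardD_le_iff.2 fun q hq => ?_)
    change (Equiv.ofBijective f ⟨hinj, hsurj⟩).symm ∘ f ∘ q.2 ∈ dX.plots q.1
    have h : (Equiv.ofBijective f ⟨hinj, hsurj⟩).symm ∘ f ∘ q.2 = q.2 :=
      funext fun u => Equiv.ofBijective_symm_apply_apply f ⟨hinj, hsurj⟩ (q.2 u)
    rw [h]
    exact hq

end Diffeologies

/-- A category in which all morphisms have right inverses is a groupoid. -/
lemma isGroupoid_of_exists_rightInverse {C : Type*} [CategoryTheory.Category C]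
    (h : ∀ (x y : C) (f : x ⟶ y), ∃ g : y ⟶ x, f ≫ g = 𝟙 x) : CategoryTheory.IsGroupoid C where
  all_isIso {x y} f := by
    obtain ⟨g, hg⟩ := h x y f
    obtain ⟨f', hf'⟩ := h y x g
    have : f' = f := by
      rw [← CategoryTheory.Category.id_comp f', ← hg, CategoryTheory.Category.assoc, hf',
        CategoryTheory.Category.comp_id]
    exact ⟨g, hg, this ▸ hf'⟩

namespace SingularFoliation

variable {n : ℕ} {M : Type*} [TopologicalSpace M] [ChartedSpace (Eu n) M]
  [IsManifold (𝓡 n) ∞ M] {F : SingularFoliation n M} [T2Space M]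

/-! ### The two holonomy groupoids -/

/-- Functoriality of transport makes the relation compatible with composition, so two paths become
equal in the quotient category exactly when their transports agree. -/
instance : CategoryTheory.Congruence F.transportRel where
  equivalence := ⟨fun _ => rfl, fun h => h.symm, fun h h' => h.trans h'⟩
  comp_left p q q' h := by
    have h' : transport q = transport q' := h
    funext f
    rw [transport_comp, transport_comp, h']
  comp_right {_ _ _ p p'} q h := by
    have h' : transport p = transport p' := h
    funext f
    rw [transport_comp, transport_comp, h']

variable (S : ∀ x, F.Slice x)

/-- The reversed path is a right inverse up to holonomy, and right inverses for all arrows suffice.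
-/
lemma isGroupoid_GVGroupoid : CategoryTheory.IsGroupoid (F.GVGroupoid S) := by
  refine isGroupoid_of_exists_rightInverse ?_
  rintro ⟨x⟩ ⟨y⟩ ⟨p⟩
  obtain ⟨q, hq⟩ := exists_holRel_inverse (S := S) p
  exact ⟨Quot.mk _ q, CategoryTheory.Quotient.sound _ hq⟩

variable (F) in
/-- The transport induced by an element of the Garmendia–Villatoro holonomy groupoid. -/
def transportGV {x y : F.GVGroupoid S} (g : x ⟶ y) : F.InvGerm x.as.pt → F.InvGerm y.as.pt :=
  Quot.lift (fun p : x.as ⟶ y.as => transport p) (by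
    -- Arrows of the quotient category are classes for the closure of `HolRel` under composition on
    -- both sides; functoriality extends the invariance of transport to this closure.
    rintro _ _ ⟨a, b, f, m₁, m₂, g, h⟩
    funext σ
    simp only [transport_comp, h.transport_eq]) g

variable (F) in
/-- The projection from the Garmendia–Villatoro holonomy groupoid to the germinal one. -/
def projGV : F.GVGroupoid S ⥤ F.HolonomyGroupoid :=
  CategoryTheory.Quotient.lift (F.HolRel S) (CategoryTheory.Quotient.functor F.transportRel)
    fun _ _ _ _ h => CategoryTheory.Quotient.sound F.transportRel h.transport_eq

lemma projGV_map_eq_iff {x y : F.GVGroupoid S} (g h : x ⟶ y) :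
    (F.projGV S).map g = (F.projGV S).map h ↔ F.transportGV S g = F.transportGV S h := by
  obtain ⟨p⟩ := g
  obtain ⟨p'⟩ := h
  exact CategoryTheory.Quotient.functor_map_eq_iff F.transportRel p p'

lemma projGV_map_surjective (x y : F.GVGroupoid S) :
    Function.Surjective ((F.projGV S).map : (x ⟶ y) → _) := by
  rintro ⟨p⟩
  exact ⟨Quot.mk _ p, rfl⟩

/-- The inverse up to holonomy is also an inverse up to transport. -/
lemma isGroupoid_holonomyGroupoid (S : ∀ x, F.Slice x) :
    CategoryTheory.IsGroupoid F.HolonomyGroupoid := by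
  refine isGroupoid_of_exists_rightInverse ?_
  rintro ⟨x⟩ ⟨y⟩ ⟨p⟩
  obtain ⟨q, hq⟩ := exists_holRel_inverse (S := S) p
  exact ⟨Quot.mk _ q, CategoryTheory.Quotient.sound F.transportRel hq.transport_eq⟩

lemma isSubduction_projGV :
    IsSubduction (arrD (F.HolRel S)) (arrD F.transportRel) (arrMap (F.projGV S)) := by
  constructor
  · rintro ⟨⟨x⟩, ⟨y⟩, ⟨p⟩⟩
    exact ⟨⟨⟨x⟩, ⟨y⟩, Quot.mk _ p⟩, rfl⟩
  -- Both spaces of arrows carry the pushforward from the space of leafwise paths, and the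
  -- projection commutes with the two quotient maps.
  · rw [pushforwardD_pushforwardD]
    rfl

variable {S}

/-- For regular foliations the projection is bijective on arrows. -/
lemma IsRegular.projGV_map_injective {q : ℕ} (hF : F.IsRegular q) (x y : F.GVGroupoid S) :
    Function.Injective ((F.projGV S).map : (x ⟶ y) → _) := by
  rintro ⟨p⟩ ⟨p'⟩ h
  exact CategoryTheory.Quotient.sound _ ((hF.holRel_iff p p').2 ((projGV_map_eq_iff S _ _).1 h))

/-- The projection is the identity on the points of `M`, so injectivity on all arrows reduces to
injectivity between fixed end points. -/
lemma IsRegular.arrMap_projGV_injective {q : ℕ} (hF : F.IsRegular q) :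
    Function.Injective (arrMap (F.projGV S)) := by
  rintro ⟨⟨x⟩, ⟨y⟩, g⟩ ⟨⟨x'⟩, ⟨y'⟩, g'⟩ h
  have hx : x = x' := congrArg (fun a : Arr F.HolonomyGroupoid => a.1.as) h
  subst hx
  have hy : y = y' := congrArg (fun a : Arr F.HolonomyGroupoid => a.2.1.as) h
  subst hy
  have h1 := eq_of_heq (Sigma.mk.inj (eq_of_heq (Sigma.mk.inj h).2)).2
  exact congrArg (fun g => (⟨⟨x⟩, ⟨y⟩, g⟩ : Arr (F.GVGroupoid S)))
    (hF.projGV_map_injective _ _ h1)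

end SingularFoliation

end SingFol

end

/-! ### The theorem -/

theorem theorem4p15 (n : ℕ) (M : Type*) [TopologicalSpace M] [T2Space M]
    [ChartedSpace (EuclideanSpace ℝ (Fin n)) M] [IsManifold (𝓡 n) ∞ M]
    (F : SingularFoliation n M) (S : ∀ x : M, F.Slice x) :
    -- transport of first integrals along leafwise paths is well defined
    (∀ (x y : F.PathCat) (p : x ⟶ y) (f : F.InvGerm x.pt) (g : F.InvGerm y.pt),
      IsTransport p f g ↔ transport p f = g) ∧
    CategoryTheory.IsGroupoid (F.GVGroupoid S) ∧ CategoryTheory.IsGroupoid F.HolonomyGroupoid ∧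
    ∃ (τ : ∀ {x y : F.GVGroupoid S}, (x ⟶ y) → F.InvGerm x.as.pt → F.InvGerm y.as.pt)
      (P : F.GVGroupoid S ⥤ F.HolonomyGroupoid),
      -- `τ` is the transport induced by the elements of the Garmendia–Villatoro groupoid
      (∀ (x y : F.PathCat) (p : x ⟶ y),
        τ ((CategoryTheory.Quotient.functor (F.HolRel S)).map p) = transport p) ∧
      -- `P` is compatible with the quotient maps from the leafwise path category
      CategoryTheory.Quotient.functor (F.HolRel S) ⋙ P = CategoryTheory.Quotient.functor F.transportRel ∧
      -- `P` exhibits the germinal holonomy groupoid as the diffeological quotient by equality of `τ`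
      (∀ (x y : F.GVGroupoid S) (g h : x ⟶ y), P.map g = P.map h ↔ τ g = τ h) ∧
      IsSubduction (arrD (F.HolRel S)) (arrD F.transportRel) (arrMap P) ∧
      -- in the regular case the two groupoids coincide
      ∀ q ≤ n, F.IsRegular q →
        (∀ (x y : F.PathCat) (p p' : x ⟶ y),
          F.HolRel S p p' ↔ transport p = transport p') ∧
        (∀ (x y : F.GVGroupoid S), Function.Bijective (P.map : (x ⟶ y) → _)) ∧
        IsDiffeomorphism (arrD (F.HolRel S)) (arrD F.transportRel) (arrMap P) := by
  refine ⟨fun _ _ p f g => isTransport_iff p f g, isGroupoid_GVGroupoid S,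
    isGroupoid_holonomyGroupoid S, fun g => F.transportGV S g, F.projGV S, fun _ _ _ => rfl, rfl,
    fun _ _ g h => projGV_map_eq_iff S g h, isSubduction_projGV S, fun q _ hF =>
      ⟨fun _ _ p p' => hF.holRel_iff p p',
        fun x y => ⟨hF.projGV_map_injective x y, projGV_map_surjective S x y⟩,
        (isSubduction_projGV S).isDiffeomorphism hF.arrMap_projGV_injective⟩⟩
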